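/- For an entire function $f$ of exponential type let $h_f(\theta)=\limsup_{r\to\infty}\frac1r\log|f(re^{i\theta})|$ (with $\log 0=-\infty$), and let $K(f)\subset\mathbb C$ be its conjugate indicator diagram, the compact convex set with support function $re^{i\theta}\mapsto r\,h_f(\theta)$, i.e. $K(f)=\{u:\operatorname{Re}(ue^{i\theta})\le h_f(\theta)\text{ for all }\theta\}$ (so $K(0)=\emptyset$). The Borel transform $\mathcal Bf$ is the holomorphic function on $\mathbb C\setminus K(f)$ that equals $\sum_{n\ge0}f^{(n)}(0)/z^{n+1}$ near infinity. For a non-empty compact convex set $K\subset\mathbb C$ with support function $H_K(z)=\sup_{u\in K}\operatorname{Re}(zu)$, let $\mathrm{Exp}(K)$ be the space of entire functions $f$ of exponential type with $K(f)\subset K$, with the topology induced by the norms $\|f\|_{K,n}=\sup_{z\in\mathbb C}|f(z)|e^{-H_K(z)-|z|/n}$, $n\ge1$. Let $H(K)$ be the space of germs of holomorphic functions on $K$. For $\varphi\in H(K)$ and $f\in\mathrm{Exp}(K)$ put $$\varphi(D)f(z)=\frac1{2\pi i}\int_\Gamma \mathcal Bf(\xi)\,\varphi(\xi)e^{\xi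 z}\,d\xi,\qquad \Phi_\varphi f(z)=\frac1{2\pi i}\int_\Gamma \mathcal Bf(\xi)\,e^{\varphi(\xi)z}\,d\xi,$$ where $\Gamma$ is a Cauchy cycle for $K$ in a simply connected open neighbourhood $\Omega_\varphi$ of $K$ on which $\varphi$ is holomorphic, i.e. a cycle in $\Omega_\varphi\setminus K$ with index $1$ about every point of $K$ and index $0$ about every point of $\mathbb C\setminus\Omega_\varphi$. A continuous linear operator $S:Y\to Y$ is quasi-conjugated to a continuous linear operator $T:X\to X$ by a continuous map $\Phi:X\to Y$ if $\Phi$ has dense range and $\Phi\circ T=S\circ\Phi$. Let $K\subset\mathbb C$ be non-empty, compact and convex, and let $\varphi\in H(K)$ be non-constant. Then $\mathcal Bf$ exists for every $f\in\mathrm{Exp}(K)$, a Cauchy cycle as above exists, and $\varphi(D)f$ and $\Phi_\varphi f$ do not depend on its choice. Moreover, $\varphi(D)$ is a continuous linear operator on $\mathrm{Exp}(K)$, and the following hold. (1) $\Phi_\varphi$ is a continuous linear operator from $\mathrm{Exp}(K)$ to $\mathrm{Exp}(\operatorname{conv}\varphi(K))$ with dense range, and $K(\Phi_\varphi f)\subset\operatorname{conv}\varphi(K(f))$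 for every $f\in\mathrm{Exp}(K)$. The differentiation operator $D$ on $\mathrm{Exp}(\operatorname{conv}\varphi(K))$ is quasi-conjugated to $\varphi(D)$ on $\mathrm{Exp}(K)$ by $\Phi_\varphi$. (2) If $\varphi$ is zero-free on $K$, then there is a logarithm $\log\varphi\in H(K)$ of $\varphi$, and for every such logarithm the operator $e_1(D)$, where $e_1(z)=e^z$, is the translation $g\mapsto g(\cdot+1)$ on $\mathrm{Exp}(\operatorname{conv}(\log\varphi(K)))$ and is quasi-conjugated to $\varphi(D)$ on $\mathrm{Exp}(K)$ by the continuous linear operator $\Phi_{\log\varphi}$. (3) If $C\subset\mathbb C$ is compact and convex and $\psi$ maps an open neighbourhood of $C$ biholomorphically onto its image, with $\psi(C)\supset\varphi(K)$, then $\psi(D)$ on $\mathrm{Exp}(\operatorname{conv}(\psi^{-1}\circ\varphi(K)))$ is quasi-conjugated to $\varphi(D)$ on $\mathrm{Exp}(K)$ by the continuous linear operator $\Phi_{\psi^{-1}\circ\varphi}$. -/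

import Mathlib

open Filter Topology Set
open scoped ENNReal

noncomputable section

/-! ### Entire functions of exponential type and their indicator diagrams -/

/-- `f` is of exponential type: `limsup_{r → ∞} log M_f(r) / r ≠ +∞`, where
`M_f(r) = max_{|z| = r} |f z|` and `log 0 = -∞`. -/
def IsExponentialType (f : ℂ → ℂ) : Prop :=
  limsup (fun r : ℝ => ENNReal.log (⨆ z ∈ Metric.sphere (0 : ℂ) r, ‖f z‖ₑ) / (r : EReal))
    atTop ≠ ⊤

/-- The indicator function `h_f(θ) = limsup_{r → ∞} log |f (r e^{iθ})| / r`, in `[-∞, ∞]`. -/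
def indicatorFun (f : ℂ → ℂ) (θ : ℝ) : EReal :=
  limsup (fun r : ℝ => ENNReal.log ‖f (r * Complex.exp (θ * Complex.I))‖ₑ / (r : EReal)) atTop

/-- The conjugate indicator diagram `K(f)`: the compact convex set whose support function is
`r e^{iθ} ↦ r h_f(θ)`, recovered from its support function as an intersection of half planes.
For `f = 0` it is empty. -/
def conjDiagram (f : ℂ → ℂ) : Set ℂ :=
  {u | ∀ θ : ℝ, (((Complex.exp (θ * Complex.I) * u).re : ℝ) : EReal) ≤ indicatorFun f θ}

/-- The support function `H_K(z) = sup {Re (z u) : u ∈ K}`. -/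
def supportFun (K : Set ℂ) (z : ℂ) : ℝ := sSup ((fun u : ℂ => (z * u).re) '' K)

/-! ### The spaces `Exp(K)` -/

/-- `Exp(K)`: the entire functions `f` of exponential type with `K(f) ⊆ K`. -/
@[ext]
structure ExpSpace (K : Set ℂ) where
  toFun : ℂ → ℂ
  entire : Differentiable ℂ toFun
  expType : IsExponentialType toFun
  diagram_subset : conjDiagram toFun ⊆ K

instance (K : Set ℂ) : CoeFun (ExpSpace K) (fun _ => ℂ → ℂ) := ⟨ExpSpace.toFun⟩

/-- `‖f‖_{K,n} = sup_z |f z| exp (- H_K(z) - |z| / n)`, as an element of `[0, ∞]`. -/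
def expNorm (K : Set ℂ) (n : ℕ+) (f : ℂ → ℂ) : ℝ≥0∞ :=
  ⨆ z : ℂ, ‖f z‖ₑ * ENNReal.ofReal (Real.exp (-supportFun K z - (1 / (n : ℝ)) * ‖z‖))

/-- The distance `‖f - g‖_{K,n}` on `Exp(K)`. -/
@[reducible]
def expDist (K : Set ℂ) (n : ℕ+) : PseudoEMetricSpace (ExpSpace K) where
  edist f g := expNorm K n (fun z => f z - g z)
  edist_self f := by simp [expNorm]
  edist_comm f g := by
    simp only [expNorm]
    congr 1
    funext z
    rw [← enorm_neg, neg_sub]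
  edist_triangle f g h := by
    simp only [expNorm]
    refine iSup_le fun z => ?_
    have h1 : ‖f z - h z‖ₑ ≤ ‖f z - g z‖ₑ + ‖g z - h z‖ₑ := by
      rw [← sub_add_sub_cancel (f z) (g z) (h z)]
      exact enorm_add_le _ _
    refine (mul_le_mul_left h1 _).trans ?_
    rw [add_mul]
    exact add_le_add
      (le_iSup (fun z : ℂ => ‖f z - g z‖ₑ *
        ENNReal.ofReal (Real.exp (-supportFun K z - (1 / (n : ℝ)) * ‖z‖))) z)
      (le_iSup (fun z : ℂ => ‖g z - h z‖ₑ *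
        ENNReal.ofReal (Real.exp (-supportFun K z - (1 / (n : ℝ)) * ‖z‖))) z)

/-- The topology of `Exp(K)`, induced by the sequence of norms `‖·‖_{K,n}`, `n ≥ 1`. -/
instance (K : Set ℂ) : TopologicalSpace (ExpSpace K) :=
  ⨅ n : ℕ+, (expDist K n).toUniformSpace.toTopologicalSpace

/-! ### Cycles and Cauchy cycles -/

/-- A closed, piecewise continuously differentiable path in `ℂ`. -/
structure ClosedPath where
  base : ℂ
  path : Path base base
  piecewise_C1 : ∃ (n : ℕ) (t : ℕ → ℝ), Monotone t ∧ t 0 = 0 ∧ t n = 1 ∧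
    ∀ i < n, ContDiffOn ℝ 1 path.extend (Icc (t i) (t (i + 1)))

/-- A cycle is a finite formal sum of closed paths. -/
abbrev PathCycle := List ClosedPath

/-- `∫_Γ g(ξ) dξ`. -/
def PathCycle.integral (Γ : PathCycle) (g : ℂ → ℂ) : ℂ :=
  (Γ.map fun γ =>
    curveIntegral (fun ξ => ContinuousLinearMap.toSpanSingleton ℂ (g ξ)) γ.path).sum

/-- The trace `|Γ|`. -/
def PathCycle.trace (Γ : PathCycle) : Set ℂ := {z | ∃ γ ∈ Γ, z ∈ range γ.path}

/-- The index `ind_Γ(w) = (1 / 2πi) ∫_Γ dξ / (ξ - w)`. -/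
def PathCycle.index (Γ : PathCycle) (w : ℂ) : ℂ :=
  (2 * Real.pi * Complex.I)⁻¹ * Γ.integral fun ξ => (ξ - w)⁻¹

/-- `Γ` is a Cauchy cycle for `K` in `Ω`. -/
structure IsCauchyCycle (Γ : PathCycle) (K Ω : Set ℂ) : Prop where
  trace_subset : Γ.trace ⊆ Ω \ K
  index_one : ∀ u ∈ K, Γ.index u = 1
  index_zero : ∀ w ∉ Ω, Γ.index w = 0

/-! ### Germs, the operators `φ(D)` and the transforms `Φ_φ`

An element of `H(K)` is given by a representative `φ : ℂ → ℂ` with `AnalyticOnNhd ℂ φ K`,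
that is, holomorphic on some open neighbourhood of `K`. -/

/-- `Γ` is a Cauchy cycle for `K` in `Ω_φ`, where `Ω_φ` is some simply connected open
neighbourhood of `K` on which `φ` is holomorphic. -/
def IsGermCycle (K : Set ℂ) (φ : ℂ → ℂ) (Γ : PathCycle) : Prop :=
  ∃ Ω : Set ℂ, IsOpen Ω ∧ IsSimplyConnected Ω ∧ K ⊆ Ω ∧ DifferentiableOn ℂ φ Ω ∧
    IsCauchyCycle Γ K Ω

open scoped Classical in
/-- `(1 / 2πi) ∫_Γ g(ξ) dξ` where `Γ` is a Cauchy cycle for `K` in `Ω_φ`. -/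
def germIntegral (K : Set ℂ) (φ : ℂ → ℂ) (g : ℂ → ℂ) : ℂ :=
  if h : ∃ Γ, IsGermCycle K φ Γ then
    (2 * Real.pi * Complex.I)⁻¹ * h.choose.integral g
  else 0

/-- `g` is the Borel transform of `f`: it is holomorphic off `K(f)` and equals
`∑ f⁽ⁿ⁾(0) / z ^ (n + 1)` near infinity. -/
def IsBorelTransform (f g : ℂ → ℂ) : Prop :=
  DifferentiableOn ℂ g (conjDiagram f)ᶜ ∧
    ∀ᶠ z in Bornology.cobounded ℂ, HasSum (fun n : ℕ => iteratedDeriv n f 0 / z ^ (n + 1)) (g z)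

open scoped Classical in
/-- The Borel transform of `f`, continued analytically to `ℂ \ K(f)`. -/
def borelTransform (f : ℂ → ℂ) : ℂ → ℂ :=
  if h : ∃ g, IsBorelTransform f g then h.choose else 0

/-- `φ(D) f (z) = (1 / 2πi) ∫_Γ Bf(ξ) φ(ξ) e^{ξ z} dξ`. -/
def diffOp (K : Set ℂ) (φ f : ℂ → ℂ) (z : ℂ) : ℂ :=
  germIntegral K φ fun ξ => borelTransform f ξ * φ ξ * Complex.exp (ξ * z)

/-- `Φ_φ f (z) = (1 / 2πi) ∫_Γ Bf(ξ) e^{φ(ξ) z} dξ`. -/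
def expTransform (K : Set ℂ) (φ f : ℂ → ℂ) (z : ℂ) : ℂ :=
  germIntegral K φ fun ξ => borelTransform f ξ * Complex.exp (φ ξ * z)

/-- The germ of `φ` on `K` is constant. -/
def IsConstantGerm (K : Set ℂ) (φ : ℂ → ℂ) : Prop := ∃ c : ℂ, ∀ᶠ z in 𝓝ˢ K, φ z = c

/-- The germ of `φ` on `K` is zero-free. -/
def IsZeroFreeGerm (K : Set ℂ) (φ : ℂ → ℂ) : Prop := ∀ᶠ z in 𝓝ˢ K, φ z ≠ 0

/-- `L` is (a representative of) a logarithm of `φ` in `H(K)`. -/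
def IsLogGerm (K : Set ℂ) (φ L : ℂ → ℂ) : Prop :=
  AnalyticOnNhd ℂ L K ∧ ∀ᶠ z in 𝓝ˢ K, Complex.exp (L z) = φ z

/-- `ψ` maps the open set `V` biholomorphically onto `ψ(V)`, with inverse `χ`. -/
structure IsBiholomorphicOn (ψ χ : ℂ → ℂ) (V : Set ℂ) : Prop where
  isOpen : IsOpen V
  holomorphic : DifferentiableOn ℂ ψ V
  inv_holomorphic : DifferentiableOn ℂ χ (ψ '' V)
  left_inv : ∀ v ∈ V, χ (ψ v) = v

/-! ### Operators and quasi-conjugacy -/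

/-- A continuous linear operator `Exp(K) → Exp(L)`. -/
structure IsContinuousOperator {K L : Set ℂ} (T : ExpSpace K → ExpSpace L) : Prop where
  linear : ∀ (a b : ℂ) (f g : ExpSpace K), ∃ h : ExpSpace K,
    (∀ z, h z = a * f z + b * g z) ∧ ∀ z, T h z = a * T f z + b * T g z
  continuous : Continuous T

/-- `S` on `Exp(L)` is quasi-conjugated to `T` on `Exp(K)` by `Φ`. -/
structure IsQuasiConjugated {K L : Set ℂ} (S : ExpSpace L → ExpSpace L)
    (T : ExpSpace K → ExpSpace K) (Φ : ExpSpace K → ExpSpace L) : Prop where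
  continuousOperator_S : IsContinuousOperator S
  continuousOperator_T : IsContinuousOperator T
  continuousOperator_map : IsContinuousOperator Φ
  denseRange : DenseRange Φ
  comm : Φ ∘ T = S ∘ Φ

end

open MeasureTheory

/-! ### Holomorphic parameter integrals -/

/-! Everything is expressed through the pairing ⟨f, E⟩ = (1/2πi) ∫ Bf(ξ) E(ξ) dξ of f ∈ Exp(K) with
a germ E ∈ H(K). Pólya's representation says ⟨f, e^{ξz}⟩ = f(z), so φ(D) and Φ_φ are both instances
of one transform f ↦ ⟨f, A(ξ) e^{B(ξ)z}⟩ (`contourTransform`): φ(D) has A = φ, B = id, and Φ_φ has A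
= 1, B = φ.

The algebraic core is the transposition rule `pairing_contourTransform`: if Tf = ⟨f, A e^{Bz}⟩, then
⟨Tf, E⟩ = ⟨f, A · (E ∘ B)⟩. Indeed, a Laplace integral along a ray gives B(Tf)(w) = (1/2πi) ∫ Bf(ξ)
A(ξ) / (w - B(ξ)) dξ, and Fubini with Cauchy's formula for E finishes. If ψ ∘ B = φ as germs, both
Φ_B φ(D) f and ψ(D) Φ_B f become ⟨f, φ e^{Bz}⟩. The three parts of the theorem are B = φ with ψ =
id, B = log φ with ψ = exp, and B = ψ⁻¹ ∘ φ. That id(D) is differentiation and exp(D) the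
translation follows from Pólya's representation.

Continuity and mapping properties come from moving the contour close to K. Laplace integrals bound
Bf on the contour by a norm of f, while B sends the contour into a small neighbourhood of L = conv
B(K), so e^{B(ξ)z} grows at most like exp(H_L(z) + ε|z|). The inclusion K(Φ_φ f) ⊂ conv φ(K(f)) is
the same estimate with K(f) in place of K.

Dense range is Hahn–Banach. A functional on the space of continuous functions with weight exp(H_L +
ε|z|) acts on Exp(L) as pairing with the germ E(ξ) = l(e^{ξ·}). If it kills the range, E ∘ B is
annihilated by all of Exp(K), in particular by the monomials z^k e^{lz}, whose pairings are the
Taylor coefficients of E ∘ B at l up to factorials. So E ∘ B vanishes near l, and since B is open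
there (the place where non-constancy is needed) E vanishes identically.

The analytic foundation is Cauchy's theorem in homology form, proved by Dixon's argument for an
abstract notion of closed contour covering cycles, circles and their differences, together with the
construction of the Borel transform by gluing Laplace integrals along all rays. -/

theorem differentiableOn_integral_of_locally_dominated {X : Type*} [MeasurableSpace X]
    {μ : Measure X} {U : Set ℂ} (hU : IsOpen U) {F : ℂ → X → ℂ}
    (hm : ∀ z ∈ U, AEStronglyMeasurable (F z) μ)
    (hd : ∀ᵐ x ∂μ, DifferentiableOn ℂ (fun z => F z x) U)
    (hb : ∀ z₀ ∈ U, ∃ b : X → ℝ, Integrable b μ ∧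
      ∃ r > 0, ∀ᵐ x ∂μ, ∀ z ∈ Metric.ball z₀ r, ‖F z x‖ ≤ b x) :
    DifferentiableOn ℂ (fun z => ∫ x, F z x ∂μ) U := by
  intro z₀ hz₀
  obtain ⟨b, hbi, r, hr, hbb⟩ := hb z₀ hz₀
  obtain ⟨ρ, hρ, hρU⟩ := Metric.isOpen_iff.1 hU z₀ hz₀
  set s := min r ρ with hs
  have hs0 : 0 < s := lt_min hr hρ
  have hsU : Metric.ball z₀ s ⊆ U := (Metric.ball_subset_ball (min_le_right _ _)).trans hρU
  have hsr : Metric.ball z₀ s ⊆ Metric.ball z₀ r := Metric.ball_subset_ball (min_le_left _ _)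
  have hint : Integrable (F z₀) μ :=
    hbi.mono' (hm z₀ hz₀) (hbb.mono fun x hx => hx z₀ (Metric.mem_ball_self hr))
  have hder : ∀ᵐ x ∂μ, ∀ z ∈ U, HasDerivAt (fun z => F z x) (deriv (fun z => F z x) z) z :=
    hd.mono fun x hx z hz => (hx.differentiableAt (hU.mem_nhds hz)).hasDerivAt
  -- Only measurability of each F z is assumed; that of the derivative is inherited from difference
  -- quotients along a sequence of steps at most s/2.
  have hmeas : AEStronglyMeasurable (fun x => deriv (fun z => F z x) z₀) μ := by
    have ht : Tendsto (fun n : ℕ => ((s / 2 / (n + 1 : ℝ) : ℝ) : ℂ)) atTop (𝓝[≠] 0) := by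
      refine tendsto_nhdsWithin_iff.2 ⟨?_, Eventually.of_forall fun n => ?_⟩
      · have h1 : Tendsto (fun n : ℕ => s / 2 / (n + 1 : ℝ)) atTop (𝓝 0) := by
          have := (tendsto_one_div_add_atTop_nhds_zero_nat (𝕜 := ℝ)).const_mul (s / 2)
          simpa [div_eq_mul_inv] using this
        exact (Complex.continuous_ofReal.tendsto' 0 0 Complex.ofReal_zero).comp h1
      · have : (0 : ℝ) < s / 2 / (n + 1 : ℝ) := by positivity
        exact Complex.ofReal_ne_zero.2 this.ne'
    refine aestronglyMeasurable_of_tendsto_ae atTop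
      (f := fun n : ℕ => fun x => (((s / 2 / (n + 1 : ℝ) : ℝ) : ℂ))⁻¹ •
        (F (z₀ + ((s / 2 / (n + 1 : ℝ) : ℝ) : ℂ)) x - F z₀ x)) (fun n => ?_) ?_
    · refine AEStronglyMeasurable.fun_const_smul ((hm _ (hsU ?_)).fun_sub (hm _ hz₀)) _
      have h0 : (0 : ℝ) < s / 2 / (n + 1 : ℝ) := by positivity
      have h1 : s / 2 / (n + 1 : ℝ) ≤ s / 2 :=
        div_le_self (by positivity) (by linarith [Nat.cast_nonneg (α := ℝ) n])
      rw [Metric.mem_ball, dist_eq_norm, add_sub_cancel_left, Complex.norm_real,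
        Real.norm_of_nonneg h0.le]
      linarith
    · filter_upwards [hder] with x hx
      exact (hasDerivAt_iff_tendsto_slope_zero.1 (hx z₀ hz₀)).comp ht
  refine ((hasDerivAt_integral_of_dominated_loc_of_deriv_le
    (F' := fun z x => deriv (fun z => F z x) z) (bound := fun x => b x / (s / 2))
    (Metric.ball_mem_nhds z₀ (half_pos hs0)) ?_ hint hmeas ?_ (hbi.div_const _) ?_
    ).2).differentiableAt.differentiableWithinAt
  · exact eventually_of_mem (hU.mem_nhds hz₀) hm
  · filter_upwards [hbb, hd] with x hx hdx z hz
    have hsub : Metric.closedBall z (s / 2) ⊆ Metric.ball z₀ s := by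
      intro w hw
      rw [Metric.mem_closedBall] at hw
      rw [Metric.mem_ball] at hz ⊢
      linarith [dist_triangle w z z₀]
    -- Cauchy's estimate on circles of radius s/2 turns the bound for F into one for its derivative,
    -- so no separate domination is required.
    refine Complex.norm_deriv_le_of_forall_mem_sphere_norm_le (half_pos hs0) ?_ fun w hw =>
      hx w (hsr (hsub (Metric.sphere_subset_closedBall hw)))
    refine DifferentiableOn.diffContOnCl (hdx.mono ?_)
    exact (Metric.closure_ball_subset_closedBall).trans (hsub.trans hsU)
  · filter_upwards [hder] with x hx z hz
    exact hx z (hsU (Metric.ball_subset_ball (by linarith) hz))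

/-! ### Closed contours -/

/-- `I` is integration along a closed contour with trace in the compact set `S`: on continuous
functions it is given by a complex density, and it vanishes on functions with a primitive. -/
def IsClosedContour (S : Set ℂ) (I : (ℂ → ℂ) → ℂ) : Prop :=
  IsCompact S ∧
  (∃ (X : Type) (_ : MeasurableSpace X) (μ : Measure X) (u v : X → ℂ),
    IsFiniteMeasure μ ∧ Measurable u ∧ (∀ x, u x ∈ S) ∧ Integrable v μ ∧
      ∀ g, ContinuousOn g S → I g = ∫ x, v x * g (u x) ∂μ) ∧
  ∀ G g : ℂ → ℂ, ContinuousOn g S → (∀ z ∈ S, HasDerivAt G (g z) z) → I g = 0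

theorem ContinuousOn.stronglyMeasurable_comp_of_forall_mem {X Y : Type*} [MeasurableSpace X]
    [TopologicalSpace Y] {Z : Type*} [TopologicalSpace Z] [MeasurableSpace Z] [BorelSpace Z]
    [TopologicalSpace.PseudoMetrizableSpace Z] [SecondCountableTopology Z]
    {G : Z → Y} {S : Set Z} {u : X → Z}
    (hG : ContinuousOn G S) (hu : Measurable u) (huS : ∀ x, u x ∈ S) :
    StronglyMeasurable fun x => G (u x) := by
  have h1 : StronglyMeasurable (Set.codRestrict u S huS) := (hu.subtype_mk).stronglyMeasurable
  exact (continuousOn_iff_continuous_domRestrict.1 hG).comp_stronglyMeasurable h1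

theorem integrable_smul_comp_of_continuousOn {X E : Type*} [MeasurableSpace X] {μ : Measure X}
    [NormedAddCommGroup E] [NormedSpace ℂ E] {S : Set ℂ} (hS : IsCompact S) {u v : X → ℂ}
    (hu : Measurable u) (huS : ∀ x, u x ∈ S) (hv : Integrable v μ) {G : ℂ → E}
    (hG : ContinuousOn G S) : Integrable (fun x => v x • G (u x)) μ := by
  obtain ⟨C, hC⟩ := hS.exists_bound_of_continuousOn hG
  refine (hv.norm.mul_const C).mono'
    (hv.aestronglyMeasurable.smul
      (hG.stronglyMeasurable_comp_of_forall_mem hu huS).aestronglyMeasurable)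
    (Eventually.of_forall fun x => ?_)
  rw [norm_smul]
  exact mul_le_mul_of_nonneg_left (hC _ (huS x)) (norm_nonneg _)

namespace IsClosedContour

variable {S S' : Set ℂ} {I J : (ℂ → ℂ) → ℂ}

theorem isCompact (h : IsClosedContour S I) : IsCompact S := h.1

theorem linear (h : IsClosedContour S I) (a b : ℂ) {f g : ℂ → ℂ} (hf : ContinuousOn f S)
    (hg : ContinuousOn g S) : I (fun z => a * f z + b * g z) = a * I f + b * I g := by
  obtain ⟨hS, ⟨X, _, μ, u, v, _, hu, huS, hv, hI⟩, -⟩ := h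
  have h1 := integrable_smul_comp_of_continuousOn hS hu huS hv hf
  have h2 := integrable_smul_comp_of_continuousOn hS hu huS hv hg
  simp only [smul_eq_mul] at h1 h2
  rw [hI f hf, hI g hg, hI _ (by fun_prop), ← integral_const_mul, ← integral_const_mul,
    ← integral_add (h1.const_mul a) (h2.const_mul b)]
  congr 1; ext x; ring

theorem const_mul (h : IsClosedContour S I) (a : ℂ) {f : ℂ → ℂ} (hf : ContinuousOn f S) :
    I (fun z => a * f z) = a * I f := by
  simpa using h.linear a 0 hf hf

theorem congr (h : IsClosedContour S I) {f g : ℂ → ℂ} (hf : ContinuousOn f S) (hfg : EqOn f g S) :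
    I f = I g := by
  obtain ⟨hS, ⟨X, _, μ, u, v, _, hu, huS, hv, hI⟩, -⟩ := h
  rw [hI f hf, hI g (hf.congr fun x hx => (hfg hx).symm)]
  congr 1; ext x; rw [hfg (huS x)]

theorem norm_le (h : IsClosedContour S I) : ∃ C, 0 ≤ C ∧ ∀ (g : ℂ → ℂ) (M : ℝ),
    ContinuousOn g S → (∀ z ∈ S, ‖g z‖ ≤ M) → ‖I g‖ ≤ C * M := by
  obtain ⟨hS, ⟨X, _, μ, u, v, _, hu, huS, hv, hI⟩, -⟩ := h
  refine ⟨∫ x, ‖v x‖ ∂μ, integral_nonneg fun _ => norm_nonneg _, fun g M hg hM => ?_⟩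
  rw [hI g hg, ← integral_mul_const]
  refine norm_integral_le_of_norm_le (hv.norm.mul_const M) (Eventually.of_forall fun x => ?_)
  rw [norm_mul]
  exact mul_le_mul_of_nonneg_left (hM _ (huS x)) (norm_nonneg _)

theorem differentiableOn (h : IsClosedContour S I) {U : Set ℂ} (hU : IsOpen U)
    {g : ℂ → ℂ → ℂ} (hg : ContinuousOn (Function.uncurry g) (U ×ˢ S))
    (hd : ∀ ξ ∈ S, DifferentiableOn ℂ (fun z => g z ξ) U) :
    DifferentiableOn ℂ (fun z => I (g z)) U := by
  obtain ⟨hS, ⟨X, _, μ, u, v, _, hu, huS, hv, hI⟩, -⟩ := h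
  have hgz : ∀ z ∈ U, ContinuousOn (g z) S := fun z hz =>
    hg.comp (Continuous.continuousOn (by fun_prop : Continuous fun ξ : ℂ => (z, ξ)))
      fun ξ hξ => ⟨hz, hξ⟩
  have hb : ∀ z₀ ∈ U, ∃ b : X → ℝ, Integrable b μ ∧
      ∃ r > 0, ∀ᵐ x ∂μ, ∀ z ∈ Metric.ball z₀ r, ‖v x * g z (u x)‖ ≤ b x := by
    intro z₀ hz₀
    obtain ⟨r, hr, hrU⟩ := Metric.nhds_basis_closedBall.mem_iff.1 (hU.mem_nhds hz₀)
    obtain ⟨C, hC⟩ := ((isCompact_closedBall z₀ r).prod hS).exists_bound_of_continuousOn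
      (hg.mono (prod_mono hrU Subset.rfl))
    refine ⟨fun x => ‖v x‖ * C, hv.norm.mul_const C, r, hr, Eventually.of_forall
      fun x z hz => ?_⟩
    rw [norm_mul]
    exact mul_le_mul_of_nonneg_left (hC (z, u x) ⟨Metric.ball_subset_closedBall hz, huS x⟩)
      (norm_nonneg _)
  refine (differentiableOn_integral_of_locally_dominated (μ := μ)
    (F := fun z x => v x * g z (u x)) hU ?_ ?_ hb).congr fun z hz => hI _ (hgz z hz)
  · intro z hz
    exact (integrable_smul_comp_of_continuousOn hS hu huS hv (hgz z hz)).aestronglyMeasurable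
  · exact Eventually.of_forall fun x => (hd _ (huS x)).const_mul _

/-- `I` acts on scalar functions only. The Bochner integral against the same density is its
vector-valued counterpart; it allows a functional to be moved under the contour integral in the
Hahn–Banach argument. -/
theorem exists_vector_integral (h : IsClosedContour S I) {E : Type*} [NormedAddCommGroup E]
    [NormedSpace ℂ E] [CompleteSpace E] {G : ℂ → E} (hG : ContinuousOn G S) :
    ∃ y : E, ∀ l : E →L[ℂ] ℂ, l y = I (fun ξ => l (G ξ)) := by
  obtain ⟨hS, ⟨X, _, μ, u, v, _, hu, huS, hv, hI⟩, -⟩ := h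
  refine ⟨∫ x, v x • G (u x) ∂μ, fun l => ?_⟩
  rw [hI (fun ξ => l (G ξ)) (l.continuous.comp_continuousOn hG),
    ← l.integral_comp_comm (integrable_smul_comp_of_continuousOn hS hu huS hv hG)]
  simp

/-- Fubini between a contour and a half-line, used for the Laplace integral of a function that is
itself a contour integral. -/
theorem integral_swap (h : IsClosedContour S I) {ν : Measure ℝ} [SFinite ν] {k : ℝ → ℂ → ℂ}
    (hk : ContinuousOn (Function.uncurry k) (univ ×ˢ S)) {b : ℝ → ℝ} (hb : Integrable b ν)
    (hkb : ∀ᵐ y ∂ν, ∀ ξ ∈ S, ‖k y ξ‖ ≤ b y) :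
    ∫ y, I (k y) ∂ν = I (fun ξ => ∫ y, k y ξ ∂ν) := by
  obtain ⟨hS, ⟨X, _, μ, u, v, _, hu, huS, hv, hI⟩, -⟩ := h
  have h1 : ∀ y, ContinuousOn (k y) S := fun y =>
    hk.comp (Continuous.continuousOn (by fun_prop : Continuous fun ξ : ℂ => (y, ξ)))
      fun ξ hξ => ⟨mem_univ _, hξ⟩
  have h2 : ∀ ξ ∈ S, Continuous fun y => k y ξ := fun ξ hξ => by
    rw [← continuousOn_univ]
    exact hk.comp (Continuous.continuousOn (by fun_prop : Continuous fun y : ℝ => (y, ξ)))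
      fun y _ => ⟨mem_univ _, hξ⟩
  have h3 : ContinuousOn (fun ξ => ∫ y, k y ξ ∂ν) S := by
    refine continuousOn_of_dominated (bound := b) (fun ξ hξ => (h2 ξ hξ).aestronglyMeasurable)
      (fun ξ hξ => hkb.mono fun y hy => hy ξ hξ) hb (Eventually.of_forall fun y => h1 y)
  rw [hI _ h3]
  simp_rw [hI _ (h1 _), ← integral_const_mul]
  refine integral_integral_swap (f := fun y x => v x * k y (u x)) ?_
  have hm : StronglyMeasurable fun p : ℝ × X => k p.1 (u p.2) := by
    exact hk.stronglyMeasurable_comp_of_forall_mem (u := fun p : ℝ × X => (p.1, u p.2))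
      (measurable_fst.prodMk (hu.comp measurable_snd)) fun p => ⟨mem_univ _, huS _⟩
  refine (hb.mul_prod hv.norm).mono' (hv.aestronglyMeasurable.comp_snd.mul
    hm.aestronglyMeasurable) ?_
  have : ∀ᵐ p : ℝ × X ∂(ν.prod μ), ∀ ξ ∈ S, ‖k p.1 ξ‖ ≤ b p.1 :=
    Measure.quasiMeasurePreserving_fst.ae hkb
  filter_upwards [this] with p hp
  simp only [Function.uncurry]
  rw [norm_mul, mul_comm]
  exact mul_le_mul_of_nonneg_right (hp _ (huS _)) (norm_nonneg _)

theorem contour_swap (h : IsClosedContour S I) (h' : IsClosedContour S' J) {k : ℂ → ℂ → ℂ}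
    (hk : ContinuousOn (Function.uncurry k) (S ×ˢ S')) :
    I (fun ξ => J (k ξ)) = J (fun w => I (fun ξ => k ξ w)) := by
  obtain ⟨hS, ⟨X, _, μ, u, v, _, hu, huS, hv, hI⟩, -⟩ := h
  obtain ⟨hS', ⟨X', _, μ', u', v', _, hu', huS', hv', hJ⟩, -⟩ := h'
  obtain ⟨C, hC⟩ := (hS.prod hS').exists_bound_of_continuousOn hk
  have h1 : ∀ ξ ∈ S, ContinuousOn (k ξ) S' := fun ξ hξ =>
    hk.comp (Continuous.continuousOn (by fun_prop : Continuous fun w : ℂ => (ξ, w)))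
      fun w hw => ⟨hξ, hw⟩
  have h2 : ∀ w ∈ S', ContinuousOn (fun ξ => k ξ w) S := fun w hw =>
    hk.comp (Continuous.continuousOn (by fun_prop : Continuous fun ξ : ℂ => (ξ, w)))
      fun ξ hξ => ⟨hξ, hw⟩
  have h3 : ContinuousOn (fun ξ => ∫ x, v' x * k ξ (u' x) ∂μ') S :=
    continuousOn_of_dominated (bound := fun x => ‖v' x‖ * C)
      (fun ξ hξ => (integrable_smul_comp_of_continuousOn hS' hu' huS' hv'
        (h1 ξ hξ)).aestronglyMeasurable)
      (fun ξ hξ => Eventually.of_forall fun x => by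
        rw [norm_mul]
        exact mul_le_mul_of_nonneg_left (hC (ξ, u' x) ⟨hξ, huS' x⟩) (norm_nonneg _))
      (hv'.norm.mul_const C)
      (Eventually.of_forall fun x => (h2 _ (huS' x)).const_mul _)
  have h4 : ContinuousOn (fun w => ∫ x, v x * k (u x) w ∂μ) S' :=
    continuousOn_of_dominated (bound := fun x => ‖v x‖ * C)
      (fun w hw => (integrable_smul_comp_of_continuousOn hS hu huS hv
        (h2 w hw)).aestronglyMeasurable)
      (fun w hw => Eventually.of_forall fun x => by
        rw [norm_mul]
        exact mul_le_mul_of_nonneg_left (hC (u x, w) ⟨huS x, hw⟩) (norm_nonneg _))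
      (hv.norm.mul_const C)
      (Eventually.of_forall fun x => (h1 _ (huS x)).const_mul _)
  have e1 : EqOn (fun ξ => J (k ξ)) (fun ξ => ∫ x, v' x * k ξ (u' x) ∂μ') S :=
    fun ξ hξ => hJ _ (h1 ξ hξ)
  have e2 : EqOn (fun w => I (fun ξ => k ξ w)) (fun w => ∫ x, v x * k (u x) w ∂μ) S' :=
    fun w hw => hI _ (h2 w hw)
  rw [hI _ (h3.congr e1), hJ _ (h4.congr e2)]
  have e3 : ∀ x, v x * J (k (u x)) = ∫ x', v x * (v' x' * k (u x) (u' x')) ∂μ' := fun x => by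
    rw [integral_const_mul, hJ _ (h1 _ (huS x))]
  have e4 : ∀ x', v' x' * I (fun ξ => k ξ (u' x')) =
      ∫ x, v x * (v' x' * k (u x) (u' x')) ∂μ := fun x' => by
    rw [hI _ (h2 _ (huS' x')), ← integral_const_mul]
    congr 1; ext x; ring
  simp_rw [e3, e4]
  refine integral_integral_swap ?_
  have hm : StronglyMeasurable fun p : X × X' => k (u p.1) (u' p.2) :=
    hk.stronglyMeasurable_comp_of_forall_mem (u := fun p : X × X' => (u p.1, u' p.2))
      ((hu.comp measurable_fst).prodMk (hu'.comp measurable_snd)) fun p => ⟨huS _, huS' _⟩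
  refine ((hv.norm.mul_prod hv'.norm).mul_const C).mono' (hv.aestronglyMeasurable.comp_fst.mul
    (hv'.aestronglyMeasurable.comp_snd.mul hm.aestronglyMeasurable))
    (Eventually.of_forall fun p => ?_)
  simp only [Function.uncurry]
  rw [norm_mul, norm_mul, ← mul_assoc]
  exact mul_le_mul_of_nonneg_left (hC (u p.1, u' p.2) ⟨huS _, huS' _⟩) (by positivity)

end IsClosedContour

/-! ### Linear combinations of contours, and local constancy of the index -/

theorem measurableEmbedding_inl (X X' : Type*) [MeasurableSpace X] [MeasurableSpace X'] :
    MeasurableEmbedding (Sum.inl : X → X ⊕ X') :=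
  ⟨Sum.inl_injective, measurable_inl, fun _ hs => hs.inl_image⟩

theorem measurableEmbedding_inr (X X' : Type*) [MeasurableSpace X] [MeasurableSpace X'] :
    MeasurableEmbedding (Sum.inr : X' → X ⊕ X') :=
  ⟨Sum.inr_injective, measurable_inr, fun _ hs => hs.inr_image⟩

namespace IsClosedContour

variable {S S' : Set ℂ} {I J : (ℂ → ℂ) → ℂ}

/-- The combination is parametrised by the disjoint union of the two parameter spaces. With c = -1
it is the difference of two contours, to which Cauchy's theorem is applied to prove independence of
the contour. -/
theorem add_const_mul (h : IsClosedContour S I) (h' : IsClosedContour S' J) (c : ℂ) :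
    IsClosedContour (S ∪ S') (fun g => I g + c * J g) := by
  obtain ⟨hS, ⟨X, _, μ, u, v, _, hu, huS, hv, hI⟩, hp⟩ := h
  obtain ⟨hS', ⟨X', _, μ', u', v', _, hu', huS', hv', hJ⟩, hp'⟩ := h'
  refine ⟨hS.union hS', ⟨X ⊕ X', inferInstance, μ.map Sum.inl + μ'.map Sum.inr,
    Sum.elim u u', Sum.elim v (fun x => c * v' x), ⟨?_⟩, hu.sumElim hu', ?_, ?_, ?_⟩, ?_⟩
  · rw [Measure.add_apply, Measure.map_apply measurable_inl .univ,
      Measure.map_apply measurable_inr .univ]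
    simp [measure_lt_top]
  · rintro (x | x)
    · exact Or.inl (huS x)
    · exact Or.inr (huS' x)
  · refine Integrable.add_measure ?_ ?_
    · rw [(measurableEmbedding_inl X X').integrable_map_iff]
      exact hv
    · rw [(measurableEmbedding_inr X X').integrable_map_iff]
      exact hv'.const_mul c
  · intro g hg
    have hg1 := hg.mono subset_union_left
    have hg2 := hg.mono subset_union_right
    have i1 := integrable_smul_comp_of_continuousOn hS hu huS hv hg1
    have i2 := integrable_smul_comp_of_continuousOn hS' hu' huS' hv' hg2
    simp only [smul_eq_mul] at i1 i2
    dsimp only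
    rw [integral_add_measure, (measurableEmbedding_inl X X').integral_map,
      (measurableEmbedding_inr X X').integral_map, hI g hg1, hJ g hg2, ← integral_const_mul]
    · simp [mul_assoc]
    · rw [(measurableEmbedding_inl X X').integrable_map_iff]
      exact i1
    · rw [(measurableEmbedding_inr X X').integrable_map_iff]
      refine (i2.const_mul c).congr (Eventually.of_forall fun x => ?_)
      simp [mul_assoc]
  · intro G g hg hG
    dsimp only
    rw [hp G g (hg.mono subset_union_left) fun z hz => hG z (Or.inl hz),
      hp' G g (hg.mono subset_union_right) fun z hz => hG z (Or.inr hz)]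
    simp

theorem continuousOn_inv_sub {w : ℂ} (hw : w ∉ S) : ContinuousOn (fun ξ => (ξ - w)⁻¹) S :=
  (continuousOn_id.sub continuousOn_const).inv₀ fun ξ hξ =>
    sub_ne_zero.2 fun h => hw (by rwa [← show ξ = w from h])

/-- The difference of the two kernels has the primitive log(1 - (z - w)/(ξ - w)) = log((ξ - z)/(ξ -
w)), whose argument stays in the disc of radius 1 about 1 and hence in the slit plane. -/
theorem index_eq_of_dist_lt (h : IsClosedContour S I) {z w : ℂ}
    (hd : ∀ ξ ∈ S, ‖z - w‖ < ‖ξ - w‖) :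
    I (fun ξ => (ξ - z)⁻¹) = I (fun ξ => (ξ - w)⁻¹) := by
  have hw : w ∉ S := fun hw => by
    have := hd w hw
    rw [sub_self, norm_zero] at this
    exact absurd this (not_lt.2 (norm_nonneg _))
  have hz : z ∉ S := fun hz => absurd (hd z hz) (lt_irrefl _)
  have h1 := h.linear 1 (-1) (continuousOn_inv_sub hz) (continuousOn_inv_sub hw)
  have h2 := h.2.2 (fun ξ => Complex.log (1 - (z - w) / (ξ - w)))
    (fun ξ => 1 * (ξ - z)⁻¹ + -1 * (ξ - w)⁻¹)
    (by
      have := continuousOn_inv_sub hz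
      have := continuousOn_inv_sub hw
      fun_prop) (fun ξ hξ => ?_)
  · rw [h2] at h1
    linear_combination -h1
  · have h0 : ξ - w ≠ 0 := sub_ne_zero.2 fun h => hw (h ▸ hξ)
    have h0' : ξ - z ≠ 0 := sub_ne_zero.2 fun h => hz (h ▸ hξ)
    have hlt : ‖-((z - w) / (ξ - w))‖ < 1 := by
      rw [norm_neg, norm_div, div_lt_one (norm_pos_iff.2 h0)]
      exact hd ξ hξ
    have hs := Complex.mem_slitPlane_of_norm_lt_one hlt
    have hdv : HasDerivAt (fun ξ => 1 - (z - w) / (ξ - w)) ((z - w) / (ξ - w) ^ 2) ξ := by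
      have := (((hasDerivAt_id ξ).sub_const w).fun_inv h0).const_mul (z - w)
      convert! (this.const_sub 1) using 1
      simp only [id]
      ring
    have hs' : 1 - (z - w) / (ξ - w) ∈ Complex.slitPlane := by
      rwa [sub_eq_add_neg]
    convert! hdv.clog hs' using 1
    have h3 : 1 - (z - w) / (ξ - w) = (ξ - z) / (ξ - w) := by field_simp; ring
    rw [h3]
    field_simp
    ring

/-- Here log(1 - ξ/z) is a primitive of the kernel on the whole contour. -/
theorem index_eq_zero_of_norm_lt (h : IsClosedContour S I) {z : ℂ}
    (hd : ∀ ξ ∈ S, ‖ξ‖ < ‖z‖) : I (fun ξ => (ξ - z)⁻¹) = 0 := by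
  have hz : z ∉ S := fun hz => absurd (hd z hz) (lt_irrefl _)
  refine h.2.2 (fun ξ => Complex.log (1 - ξ / z)) _ (continuousOn_inv_sub hz) fun ξ hξ => ?_
  have hz0 : z ≠ 0 := norm_pos_iff.1 ((norm_nonneg _).trans_lt (hd ξ hξ))
  have h0' : ξ - z ≠ 0 := sub_ne_zero.2 fun h => hz (h ▸ hξ)
  have h0'' : z - ξ ≠ 0 := sub_ne_zero.2 fun h => hz (h ▸ hξ)
  have hlt : ‖-(ξ / z)‖ < 1 := by
    rw [norm_neg, norm_div, div_lt_one (norm_pos_iff.2 hz0)]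
    exact hd ξ hξ
  have hs := Complex.mem_slitPlane_of_norm_lt_one hlt
  have hs' : 1 - ξ / z ∈ Complex.slitPlane := by rwa [sub_eq_add_neg]
  have hdv : HasDerivAt (fun ξ => 1 - ξ / z) (-(1 / z)) ξ :=
    ((hasDerivAt_id ξ).div_const z).const_sub 1
  convert! hdv.clog hs' using 1
  have h3 : 1 - ξ / z = (z - ξ) / z := by field_simp
  rw [h3]
  field_simp
  ring

theorem eventually_index_eq (h : IsClosedContour S I) {w : ℂ} (hw : w ∉ S) :
    ∀ᶠ z in 𝓝 w, z ∉ S ∧ I (fun ξ => (ξ - z)⁻¹) = I (fun ξ => (ξ - w)⁻¹) := by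
  obtain ⟨r, hr, hrS⟩ := Metric.isOpen_iff.1 h.isCompact.isClosed.isOpen_compl w hw
  filter_upwards [Metric.ball_mem_nhds w hr] with z hz
  refine ⟨hrS hz, h.index_eq_of_dist_lt fun ξ hξ => ?_⟩
  by_contra! hlt
  refine hrS (show ξ ∈ Metric.ball w r from ?_) hξ
  rw [Metric.mem_ball, dist_eq_norm] at hz ⊢
  exact hlt.trans_lt hz

end IsClosedContour

/-! ### Dixon's proof of Cauchy's theorem -/

theorem dslope_symm (f : ℂ → ℂ) (a b : ℂ) : dslope f a b = dslope f b a := by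
  rcases eq_or_ne a b with rfl | h
  · rfl
  · rw [dslope_of_ne _ h, dslope_of_ne _ h.symm, slope_comm]

/-- Joint continuity is clear off the diagonal. At a diagonal point (a, a), strict differentiability
controls the quotients with x ≠ y, and continuity of f' controls the nearby diagonal points. -/
theorem continuousOn_uncurry_dslope {f : ℂ → ℂ} {U : Set ℂ} (hU : IsOpen U)
    (hf : DifferentiableOn ℂ f U) :
    ContinuousOn (Function.uncurry (dslope f)) (U ×ˢ U) := by
  rintro ⟨a, b⟩ ⟨ha, hb⟩
  refine ContinuousAt.continuousWithinAt ?_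
  have ca := (hf.differentiableAt (hU.mem_nhds ha)).continuousAt
  have cb := (hf.differentiableAt (hU.mem_nhds hb)).continuousAt
  rcases eq_or_ne a b with rfl | hab
  · have han : AnalyticAt ℂ f a := hf.analyticAt (hU.mem_nhds ha)
    have hst := han.hasStrictDerivAt
    have hd : ContinuousAt (deriv f) a := han.deriv.continuousAt
    rw [Metric.continuousAt_iff']
    intro ε hε
    have h1 := (hst.isLittleO).def (half_pos hε)
    have h2 : ∀ᶠ p : ℂ × ℂ in 𝓝 (a, a), dist (deriv f p.1) (deriv f a) < ε :=
      (continuousAt_fst (p := (a, a))).eventually (Metric.continuousAt_iff'.1 hd ε hε)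
    filter_upwards [h1, h2] with p hp hp2
    obtain ⟨x, y⟩ := p
    simp only [Function.uncurry, dslope_same]
    rcases eq_or_ne x y with rfl | hxy
    · simpa using hp2
    · rw [dslope_of_ne _ hxy.symm, slope_def_field, dist_eq_norm]
      simp only [ContinuousLinearMap.toSpanSingleton_apply] at hp
      have h0 : y - x ≠ 0 := sub_ne_zero.2 hxy.symm
      have h0' : 0 < ‖y - x‖ := norm_pos_iff.2 h0
      have : (f y - f x) / (y - x) - deriv f a = -(f x - f y - (x - y) • deriv f a) / (y - x) := by
        rw [smul_eq_mul]; field_simp; ring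
      rw [this, norm_div, norm_neg, div_lt_iff₀ h0']
      rw [norm_sub_rev x y] at hp
      nlinarith
  · have h1 : ∀ᶠ p : ℂ × ℂ in 𝓝 (a, b), Function.uncurry (dslope f) p =
        (f p.2 - f p.1) / (p.2 - p.1) := by
      have : IsOpen {p : ℂ × ℂ | p.2 ≠ p.1} := isOpen_ne_fun continuous_snd continuous_fst
      filter_upwards [this.mem_nhds (show (a, b) ∈ {p : ℂ × ℂ | p.2 ≠ p.1} from hab.symm)]
        with p hp
      simp only [Function.uncurry]
      rw [dslope_of_ne _ hp, slope_def_field]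
    refine ContinuousAt.congr ?_ (h1.mono fun _ h => h.symm)
    refine ContinuousAt.div ?_ (by fun_prop) (sub_ne_zero.2 hab.symm)
    exact (ContinuousAt.comp (x := (a, b)) (f := Prod.snd) cb continuousAt_snd).sub
      (ContinuousAt.comp (x := (a, b)) (f := Prod.fst) ca continuousAt_fst)

namespace IsClosedContour

variable {S S' : Set ℂ} {I J : (ℂ → ℂ) → ℂ}

theorem integral_dslope_of_notMem (h : IsClosedContour S I) {f : ℂ → ℂ} (hf : ContinuousOn f S)
    {z : ℂ} (hz : z ∉ S) :
    I (dslope f z) = I (fun ξ => f ξ * (ξ - z)⁻¹) - f z * I (fun ξ => (ξ - z)⁻¹) := by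
  have hc := continuousOn_inv_sub hz
  have h1 := h.linear 1 (-f z) (hf.fun_mul hc) hc
  have h2 : EqOn (fun ξ => 1 * (f ξ * (ξ - z)⁻¹) + -f z * (ξ - z)⁻¹) (dslope f z) S := by
    intro ξ hξ
    have h0 : ξ ≠ z := fun h => hz (h ▸ hξ)
    dsimp only
    rw [dslope_of_ne _ h0, slope_def_field]
    ring
  rw [← h.congr (by fun_prop) h2, h1]
  ring

/-- Dixon's argument: F(z) = ∫ (f(ξ) - f(z))/(ξ - z) dξ on U and G(z) = ∫ f(ξ)/(ξ - z) dξ where the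
index vanishes agree on the overlap. The two open sets cover the plane, so they glue to an entire
function tending to 0 at infinity, which is 0 by Liouville. -/
theorem integral_dslope_eq_zero (h : IsClosedContour S I) {U : Set ℂ} (hU : IsOpen U)
    (hSU : S ⊆ U) (hind : ∀ w ∉ U, I (fun ξ => (ξ - w)⁻¹) = 0) {f : ℂ → ℂ}
    (hf : DifferentiableOn ℂ f U) {z : ℂ} (hz : z ∈ U) : I (dslope f z) = 0 := by
  classical
  set F : ℂ → ℂ := fun z => I (dslope f z) with hF
  set G : ℂ → ℂ := fun z => I (fun ξ => f ξ * (ξ - z)⁻¹) with hG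
  set V : Set ℂ := {z | z ∉ S ∧ I (fun ξ => (ξ - z)⁻¹) = 0} with hV
  have hfS : ContinuousOn f S := hf.continuousOn.mono hSU
  have hVo : IsOpen V := by
    rw [isOpen_iff_mem_nhds]
    rintro w ⟨hw, hw0⟩
    filter_upwards [h.eventually_index_eq hw] with z hz
    exact ⟨hz.1, hz.2.trans hw0⟩
  have hFd : DifferentiableOn ℂ F U := by
    refine h.differentiableOn (g := dslope f) hU ((continuousOn_uncurry_dslope hU hf).mono
      (prod_mono Subset.rfl hSU)) fun ξ hξ => ?_
    have : (fun z => dslope f z ξ) = dslope f ξ := funext fun z => dslope_symm f z ξ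
    rw [this]
    exact (Complex.differentiableOn_dslope (hU.mem_nhds (hSU hξ))).2 hf
  have hGd : DifferentiableOn ℂ G V := by
    refine h.differentiableOn (g := fun z ξ => f ξ * (ξ - z)⁻¹) hVo ?_ fun ξ hξ => ?_
    · refine ContinuousOn.mul (f := fun p : ℂ × ℂ => f p.2) (hfS.comp continuousOn_snd
        fun p hp => hp.2) (ContinuousOn.inv₀ (by fun_prop) fun p hp => ?_)
      exact sub_ne_zero.2 fun h => hp.1.1 (h ▸ hp.2)
    · refine DifferentiableOn.const_mul (DifferentiableOn.inv (by fun_prop) fun z hz => ?_) _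
      exact sub_ne_zero.2 fun h => hz.1 (h ▸ hξ)
  have hFG : ∀ z ∈ U, z ∈ V → F z = G z := fun z _ hzV => by
    rw [hF, hG]
    simp only
    rw [h.integral_dslope_of_notMem hfS hzV.1, hzV.2]
    ring
  set H : ℂ → ℂ := fun z => if z ∈ U then F z else G z with hH
  have hHF : EqOn H F U := fun z hz => if_pos hz
  have hHG : EqOn H G V := fun z hz => by
    by_cases hzU : z ∈ U
    · rw [hHF hzU, hFG z hzU hz]
    · exact if_neg hzU
  have hHd : Differentiable ℂ H := fun z => by
    by_cases hzU : z ∈ U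
    · exact (hFd.congr hHF).differentiableAt (hU.mem_nhds hzU)
    · have hzV : z ∈ V := ⟨fun h => hzU (hSU h), hind z hzU⟩
      exact (hGd.congr hHG).differentiableAt (hVo.mem_nhds hzV)
  have hlim : Tendsto H (cocompact ℂ) (𝓝 0) := by
    obtain ⟨R, hR⟩ := h.isCompact.isBounded.exists_norm_le
    obtain ⟨M, hM⟩ := h.isCompact.exists_bound_of_continuousOn hfS
    obtain ⟨C, hC0, hC⟩ := h.norm_le
    have hb : ∀ᶠ z in cocompact ℂ, ‖H z‖ ≤ C * (M * (‖z‖ - R)⁻¹) := by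
      filter_upwards [(tendsto_norm_cocompact_atTop (E := ℂ)).eventually (eventually_gt_atTop R)]
        with z hz
      have hzS : z ∉ S := fun h => absurd (hR z h) (not_le.2 hz)
      have hzV : z ∈ V := ⟨hzS, h.index_eq_zero_of_norm_lt fun ξ hξ => (hR ξ hξ).trans_lt hz⟩
      rw [hHG hzV]
      refine hC _ _ (hfS.mul (continuousOn_inv_sub hzS)) fun ξ hξ => ?_
      rw [norm_mul, norm_inv]
      have h1 : ‖z‖ - R ≤ ‖ξ - z‖ := by
        have := norm_sub_norm_le z ξ
        rw [norm_sub_rev] at this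
        linarith [hR ξ hξ]
      exact mul_le_mul (hM ξ hξ) (inv_anti₀ (by linarith) h1) (by positivity)
        ((norm_nonneg _).trans (hM ξ hξ))
    refine squeeze_zero_norm' hb ?_
    have h1 : Tendsto (fun z : ℂ => (‖z‖ - R)⁻¹) (cocompact ℂ) (𝓝 0) :=
      tendsto_inv_atTop_zero.comp
        (tendsto_atTop_add_const_right _ (-R) (tendsto_norm_cocompact_atTop (E := ℂ)))
    simpa using (h1.const_mul M).const_mul C
  have := hHd.apply_eq_of_tendsto_cocompact z hlim
  rw [← this, hHF hz]

/-- **Cauchy's integral formula**, homology version. -/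
theorem integral_mul_inv_sub (h : IsClosedContour S I) {U : Set ℂ} (hU : IsOpen U)
    (hSU : S ⊆ U) (hind : ∀ w ∉ U, I (fun ξ => (ξ - w)⁻¹) = 0) {f : ℂ → ℂ}
    (hf : DifferentiableOn ℂ f U) {z : ℂ} (hz : z ∈ U) (hzS : z ∉ S) :
    I (fun ξ => f ξ * (ξ - z)⁻¹) = f z * I (fun ξ => (ξ - z)⁻¹) := by
  have h1 := h.integral_dslope_eq_zero hU hSU hind hf hz
  rw [h.integral_dslope_of_notMem (hf.continuousOn.mono hSU) hzS] at h1
  exact sub_eq_zero.1 h1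

/-- **Cauchy's theorem**, homology version. -/
theorem integral_eq_zero (h : IsClosedContour S I) {U : Set ℂ} (hU : IsOpen U)
    (hSU : S ⊆ U) (hind : ∀ w ∉ U, I (fun ξ => (ξ - w)⁻¹) = 0) {f : ℂ → ℂ}
    (hf : DifferentiableOn ℂ f U) : I f = 0 := by
  rcases U.eq_empty_or_nonempty with rfl | ⟨z, hz⟩
  · have hS : S = ∅ := subset_empty_iff.1 hSU
    subst hS
    exact h.2.2 f f (continuousOn_empty _) fun z hz => hz.elim
  -- The difference quotient of (ξ - z) f(ξ) based at z is f itself, so vanishing of the quotient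
  -- integral is already Cauchy's theorem.
  · set f₁ : ℂ → ℂ := fun ξ => (ξ - z) * f ξ with hf₁
    have hd : DifferentiableOn ℂ f₁ U := by fun_prop
    have h1 := h.integral_dslope_eq_zero hU hSU hind hd hz
    have h2 : dslope f₁ z = f := by
      ext ξ
      rcases eq_or_ne ξ z with rfl | hξ
      · rw [dslope_same]
        have := ((hasDerivAt_id ξ).sub_const ξ).fun_mul
          (hf.differentiableAt (hU.mem_nhds hz)).hasDerivAt
        simpa using this.deriv
      · have : ξ - z ≠ 0 := sub_ne_zero.2 hξ
        rw [dslope_of_ne _ hξ, slope_def_field, hf₁]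
        simp only
        field_simp
        ring
    rwa [h2] at h1

end IsClosedContour

/-! ### Paths and circles as closed contours -/

theorem IsClosedContour.congr_fun {S : Set ℂ} {I J : (ℂ → ℂ) → ℂ} (h : IsClosedContour S I)
    (hIJ : ∀ g, ContinuousOn g S → J g = I g) : IsClosedContour S J := by
  obtain ⟨hS, ⟨X, mX, μ, u, v, hμ, hu, huS, hv, hI⟩, hp⟩ := h
  exact ⟨hS, ⟨X, mX, μ, u, v, hμ, hu, huS, hv, fun g hg => (hIJ g hg).trans (hI g hg)⟩,
    fun G g hg hG => (hIJ g hg).trans (hp G g hg hG)⟩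

/-- Vanishing on derivatives is the fundamental theorem of calculus, in the version allowing a
countable exceptional set, together with p a = p b. The exceptional set takes care of the corners of
piecewise smooth paths. -/
theorem isClosedContour_intervalIntegral {S : Set ℂ} (hS : IsCompact S) {p v : ℝ → ℂ} {a b : ℝ}
    (hab : a ≤ b) (hp : Continuous p) (hpS : ∀ t, p t ∈ S) (hpab : p a = p b)
    (hv : IntervalIntegrable v volume a b) {s : Set ℝ} (hs : s.Countable)
    (hd : ∀ t ∈ Ioo a b \ s, HasDerivAt p (v t) t) :
    IsClosedContour S (fun g => ∫ t in a..b, v t * g (p t)) := by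
  have hv' : Integrable v (volume.restrict (Ioc a b)) :=
    (intervalIntegrable_iff_integrableOn_Ioc_of_le hab).1 hv
  refine ⟨hS, ⟨ℝ, inferInstance, volume.restrict (Ioc a b), p, v, inferInstance,
    hp.measurable, hpS, hv', fun g _ => intervalIntegral.integral_of_le hab⟩, fun G g hg hG => ?_⟩
  have hint : IntervalIntegrable (fun t => v t * g (p t)) volume a b :=
    (intervalIntegrable_iff_integrableOn_Ioc_of_le hab).2
      (integrable_smul_comp_of_continuousOn hS hp.measurable hpS hv' hg)
  dsimp only
  rw [integral_eq_of_hasDerivAt_off_countable_of_le (fun t => G (p t)) _ hab hs ?_ ?_ hint,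
    hpab, sub_self]
  · intro t _
    exact ((hG _ (hpS t)).continuousAt.comp hp.continuousAt).continuousWithinAt
  · intro t ht
    have := (hG _ (hpS t)).comp t (hd t ht)
    rwa [mul_comm] at this

theorem isClosedContour_circleIntegral (c : ℂ) {R : ℝ} (hR : 0 ≤ R) :
    IsClosedContour (Metric.sphere c R) (fun g => ∮ z in C(c, R), g z) := by
  refine (isClosedContour_intervalIntegral (p := circleMap c R) (v := deriv (circleMap c R))
    (isCompact_sphere c R) Real.two_pi_pos.le (continuous_circleMap c R)
    (fun t => circleMap_mem_sphere c hR t) (by simpa using (periodic_circleMap c R 0).symm) ?_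
    countable_empty ?_).congr_fun fun g _ => ?_
  · simp only [funext fun t => deriv_circleMap c R t]
    exact (by fun_prop : Continuous fun t => circleMap 0 R t * Complex.I).intervalIntegrable _ _
  · intro t _
    exact (differentiable_circleMap c R t).hasDerivAt
  · simp [circleIntegral]

theorem exists_mem_Ioo_of_notMem_range {n : ℕ} {t : ℕ → ℝ} {x : ℝ} (h0 : t 0 < x) (h1 : x < t n)
    (hx : x ∉ range t) : ∃ i < n, x ∈ Ioo (t i) (t (i + 1)) := by
  by_contra! h
  have : ∀ i ≤ n, t i < x := by
    intro i
    induction i with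
    | zero => exact fun _ => h0
    | succ i ih =>
      intro hi
      have h2 := ih (by omega)
      have h3 := h i (by omega)
      by_contra! h4
      exact h3 ⟨h2, lt_of_le_of_ne h4 fun h5 => hx ⟨_, h5.symm⟩⟩
  exact absurd (this n le_rfl) (not_lt.2 h1.le)

theorem ClosedPath.isClosedContour (γ : ClosedPath) :
    IsClosedContour (range γ.path) (fun g =>
      curveIntegral (fun ξ => ContinuousLinearMap.toSpanSingleton ℂ (g ξ)) γ.path) := by
  obtain ⟨b, p, n, t, htm, ht0, htn, hC⟩ := γ
  have hdiff : ∀ i < n, ∀ x ∈ Ioo (t i) (t (i + 1)), DifferentiableAt ℝ p.extend x ∧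
      deriv p.extend x = derivWithin p.extend (Icc (t i) (t (i + 1))) x := by
    intro i hi x hx
    have hmem := Icc_mem_nhds hx.1 hx.2
    have h1 := ((hC i hi).differentiableOn one_ne_zero).differentiableAt hmem
    exact ⟨h1, (derivWithin_of_mem_nhds hmem).symm⟩
  -- On each piece the one-sided derivative is continuous up to the endpoints, hence integrable, and
  -- it agrees with `deriv` in the interior.
  have hint : IntervalIntegrable (deriv p.extend) volume 0 1 := by
    rw [← ht0, ← htn]
    refine IntervalIntegrable.trans_iterate fun i hi => ?_
    rcases (htm (Nat.le_succ i)).eq_or_lt with h | h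
    · rw [Nat.succ_eq_add_one] at h
      rw [h]
    · rw [Nat.succ_eq_add_one] at h
      have hc : ContinuousOn (derivWithin p.extend (Icc (t i) (t (i + 1))))
          (Icc (t i) (t (i + 1))) :=
        (hC i hi).continuousOn_derivWithin (uniqueDiffOn_Icc h) le_rfl
      have h1 := hc.intervalIntegrable_of_Icc (μ := volume) h.le
      rw [intervalIntegrable_iff_integrableOn_Ioo_of_le h.le] at h1 ⊢
      exact h1.congr_fun (fun x hx => ((hdiff i hi x hx).2).symm) measurableSet_Ioo
  refine (isClosedContour_intervalIntegral (p := p.extend) (v := deriv p.extend)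
    (isCompact_range p.continuous) zero_le_one p.continuous_extend
    (fun x => by rw [← p.extend_range]; exact mem_range_self x) (by simp) hint
    (countable_range t) ?_).congr_fun fun g _ => ?_
  · rintro x ⟨hx, hxt⟩
    obtain ⟨i, hi, hxi⟩ := exists_mem_Ioo_of_notMem_range (n := n) (by rw [ht0]; exact hx.1)
      (by rw [htn]; exact hx.2) hxt
    exact (hdiff i hi x hxi).1.hasDerivAt
  · rw [curveIntegral_eq_intervalIntegral_deriv]
    simp

theorem PathCycle.isClosedContour (Γ : PathCycle) : IsClosedContour Γ.trace Γ.integral := by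
  induction Γ with
  | nil =>
    have h : PathCycle.trace [] = ∅ := by ext; simp [PathCycle.trace]
    rw [h]
    refine ⟨isCompact_empty, ⟨Empty, inferInstance, 0, Empty.elim, Empty.elim, inferInstance,
      measurable_of_empty _, fun x => x.elim, ?_, fun g _ => ?_⟩, fun G g _ _ => ?_⟩
    · exact integrable_zero_measure
    · simp [PathCycle.integral]
    · simp [PathCycle.integral]
  | cons γ Γ ih =>
    have h := γ.isClosedContour.add_const_mul ih 1
    have h1 : PathCycle.trace (γ :: Γ) = range γ.path ∪ PathCycle.trace Γ := by
      ext z; simp [PathCycle.trace]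
    rw [h1]
    refine h.congr_fun fun g _ => ?_
    simp [PathCycle.integral]

/-- The closed path given by a smooth function on the line. -/
noncomputable def ClosedPath.ofContDiff (p : ℝ → ℂ) (hp : ContDiff ℝ 1 p) (h01 : p 0 = p 1) :
    ClosedPath where
  base := p 0
  path := Path.ofLine (f := p) hp.continuous.continuousOn rfl h01.symm
  piecewise_C1 := by
    refine ⟨1, fun n => n, Nat.mono_cast, by simp, by simp, fun i hi => ?_⟩
    obtain rfl : i = 0 := by omega
    refine hp.contDiffOn.congr fun t ht => ?_
    have ht' : t ∈ Icc (0 : ℝ) 1 := by simpa using ht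
    rw [Path.extend_apply _ ht']
    rfl

theorem PathCycle.integral_ofContDiff {p : ℝ → ℂ} (hp : ContDiff ℝ 1 p) (h01 : p 0 = p 1)
    (g : ℂ → ℂ) :
    PathCycle.integral [ClosedPath.ofContDiff p hp h01] g = ∫ t in (0 : ℝ)..1, deriv p t * g (p t) := by
  simp only [PathCycle.integral, List.map_cons, List.map_nil, List.sum_cons, List.sum_nil, add_zero]
  rw [curveIntegral_eq_intervalIntegral_deriv]
  have he : EqOn (ClosedPath.ofContDiff p hp h01).path.extend p (Icc 0 1) := fun t ht => by
    rw [Path.extend_apply _ ht]; rfl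
  refine intervalIntegral.integral_congr_ae ?_
  -- The extended path is constant outside [0, 1], so its derivative need not be that of p at the
  -- endpoints; one discards the endpoint 1.
  have h1 : ∀ᵐ t : ℝ, t ≠ 1 := by simp [ae_iff, measure_singleton]
  filter_upwards [h1] with t ht1 ht
  rw [uIoc_of_le zero_le_one] at ht
  have ht' : t ∈ Ioo (0 : ℝ) 1 := ⟨ht.1, lt_of_le_of_ne ht.2 ht1⟩
  have h2 : (ClosedPath.ofContDiff p hp h01).path.extend =ᶠ[𝓝 t] p :=
    eventually_of_mem (Icc_mem_nhds ht'.1 ht'.2) he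
  rw [h2.deriv_eq, h2.eq_of_nhds]
  simp

theorem PathCycle.trace_ofContDiff {p : ℝ → ℂ} (hp : ContDiff ℝ 1 p) (h01 : p 0 = p 1) :
    PathCycle.trace [ClosedPath.ofContDiff p hp h01] ⊆ range p := by
  rintro z ⟨γ, hγ, t, rfl⟩
  rw [List.mem_singleton] at hγ
  subst hγ
  exact ⟨t, rfl⟩

/-! ### Existence of Cauchy cycles -/

-- In a fixed direction e the admissible radii form an interval, because K and Ω are convex and c ∈
-- K: a ray from c leaves K once and, if it leaves Ω, does so later. A radius slightly beyond the
-- exit point of K stays admissible for nearby directions, and a partition of unity merges these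
-- local constants into a smooth function.
open scoped Manifold in
theorem exists_radius_function {K Ω : Set ℂ} (hK : IsCompact K) (hKc : Convex ℝ K)
    (hΩ : IsOpen Ω) (hΩc : Convex ℝ Ω) (hKΩ : K ⊆ Ω) {c : ℂ} (hc : c ∈ K) :
    ∃ R : ℂ → ℝ, ContDiff ℝ 1 R ∧ ∀ e : ℂ, ‖e‖ = 1 →
      0 < R e ∧ c + R e * e ∈ Ω ∧ c + R e * e ∉ K := by
  -- The condition is imposed only for ‖e‖ > 1/2, so that the choice is unconstrained near e = 0 and
  -- R can be built on the vector space ℂ instead of the circle.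
  set t : ℂ → Set ℝ := fun e => {s | 1 / 2 < ‖e‖ → 0 < s ∧ c + s * e ∈ Ω ∧ c + s * e ∉ K} with ht
  have hconv : ∀ e, Convex ℝ (t e) := by
    intro e
    rw [convex_iff_ordConnected]
    refine ⟨fun x hx y hy s hs he => ?_⟩
    obtain ⟨hx0, -, hxK⟩ := hx he
    obtain ⟨hy0, hyΩ, -⟩ := hy he
    have hs0 : 0 < s := hx0.trans_le hs.1
    refine ⟨hs0, ?_, fun hsK => hxK ?_⟩
    · have h := hΩc (hKΩ hc) hyΩ (a := 1 - s / y) (b := s / y)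
        (sub_nonneg.2 ((div_le_one hy0).2 hs.2)) (by positivity) (by ring)
      convert h using 1
      have : (y : ℂ) ≠ 0 := by exact_mod_cast hy0.ne'
      simp only [Complex.real_smul]; push_cast; field_simp; ring
    · have h := hKc hc hsK (a := 1 - x / s) (b := x / s)
        (sub_nonneg.2 ((div_le_one hs0).2 hs.1)) (by positivity) (by ring)
      convert h using 1
      have : (s : ℂ) ≠ 0 := by exact_mod_cast hs0.ne'
      simp only [Complex.real_smul]; push_cast; field_simp; ring
  have hloc : ∀ e : ℂ, ∃ s : ℝ, ∀ᶠ e' in 𝓝 e, s ∈ t e' := by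
    intro e
    rcases lt_or_ge ‖e‖ (1 / 2) with he | he
    · refine ⟨0, ?_⟩
      filter_upwards [(isOpen_Iio.preimage continuous_norm).mem_nhds he] with e' he' h
      exact absurd h (not_lt.2 (le_of_lt he'))
    · have he0 : 0 < ‖e‖ := by linarith
      -- sSup A is the parameter at which the ray leaves K; any slightly larger s lies outside K and
      -- still in Ω.
      set A : Set ℝ := {s | 0 ≤ s ∧ c + s * e ∈ K} with hA
      have hAc : IsClosed A := isClosed_Ici.inter
        (hK.isClosed.preimage (by fun_prop : Continuous fun s : ℝ => c + s * e))
      obtain ⟨M, hM⟩ := hK.isBounded.exists_norm_le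
      have hAb : BddAbove A := by
        refine ⟨(M + ‖c‖) / ‖e‖, fun s hs => ?_⟩
        rw [le_div_iff₀ he0]
        have h1 := hM _ hs.2
        have h2 : ‖(s : ℂ) * e‖ ≤ ‖c + s * e‖ + ‖c‖ := by
          have := norm_sub_le (c + s * e) c
          simpa using this
        rw [norm_mul, Complex.norm_real, Real.norm_of_nonneg hs.1] at h2
        linarith
      have hAn : A.Nonempty := ⟨0, le_rfl, by simpa using hc⟩
      have hm : sSup A ∈ A := hAc.csSup_mem hAn hAb
      have hcont : Continuous fun s : ℝ => c + s * e := by fun_prop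
      have h1 : ∀ᶠ s : ℝ in 𝓝[>] (sSup A), c + (s : ℂ) * e ∈ Ω :=
        (hcont.continuousAt.eventually (hΩ.mem_nhds (hKΩ hm.2))).filter_mono nhdsWithin_le_nhds
      obtain ⟨s, hs1, hs2⟩ := (h1.and self_mem_nhdsWithin).exists
      have hs0 : 0 < s := hm.1.trans_lt hs2
      have hsK : c + (s : ℂ) * e ∉ K := fun h =>
        absurd (le_csSup hAb (show s ∈ A from ⟨hs0.le, h⟩)) (not_le.2 hs2)
      refine ⟨s, ?_⟩
      have hcont' : Continuous fun e : ℂ => c + s * e := by fun_prop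
      filter_upwards [hcont'.continuousAt.eventually (hΩ.mem_nhds hs1),
        hcont'.continuousAt.eventually (hK.isClosed.isOpen_compl.mem_nhds hsK)] with e' h2 h3 _
      exact ⟨hs0, h2, h3⟩
  obtain ⟨R, hR⟩ := exists_contMDiffMap_forall_mem_convex_of_local_const (n := 1) 𝓘(ℝ, ℂ) hconv hloc
  exact ⟨R, R.contMDiff.contDiff, fun e he => hR e (by rw [he]; norm_num)⟩

theorem IsClosedContour.index_eq_of_isPreconnected {S : Set ℂ} {I : (ℂ → ℂ) → ℂ}
    (h : IsClosedContour S I) {K : Set ℂ} (hK : IsPreconnected K) (hKS : Disjoint K S)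
    {a b : ℂ} (ha : a ∈ K) (hb : b ∈ K) :
    I (fun ξ => (ξ - b)⁻¹) = I (fun ξ => (ξ - a)⁻¹) := by
  set u : Set ℂ := {z | z ∉ S ∧ I (fun ξ => (ξ - z)⁻¹) = I (fun ξ => (ξ - a)⁻¹)} with hu
  set v : Set ℂ := {z | z ∉ S ∧ I (fun ξ => (ξ - z)⁻¹) ≠ I (fun ξ => (ξ - a)⁻¹)} with hv
  have huo : IsOpen u := isOpen_iff_mem_nhds.2 fun w hw => by
    filter_upwards [h.eventually_index_eq hw.1] with z hz using ⟨hz.1, hz.2.trans hw.2⟩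
  have hvo : IsOpen v := isOpen_iff_mem_nhds.2 fun w hw => by
    filter_upwards [h.eventually_index_eq hw.1] with z hz using ⟨hz.1, hz.2 ▸ hw.2⟩
  have := hK.subset_left_of_subset_union huo hvo
    (Set.disjoint_left.2 fun z hz hz' => hz'.2 hz.2)
    (fun z hz => (em _).imp (fun h => ⟨hKS.notMem_of_mem_left hz, h⟩)
      fun h => ⟨hKS.notMem_of_mem_left hz, h⟩) ⟨a, ha, hKS.notMem_of_mem_left ha, rfl⟩
  exact (this hb).2

/-- A half plane separates w from Ω. After a rotation, ξ - w has positive real part on the contour,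
so the principal logarithm gives a primitive of the kernel. -/
theorem IsClosedContour.index_eq_zero_of_convex {S : Set ℂ} {I : (ℂ → ℂ) → ℂ}
    (h : IsClosedContour S I) {Ω : Set ℂ} (hΩ : IsOpen Ω) (hΩc : Convex ℝ Ω) (hS : S ⊆ Ω)
    {w : ℂ} (hw : w ∉ Ω) : I (fun ξ => (ξ - w)⁻¹) = 0 := by
  obtain ⟨f, hf⟩ := geometric_hahn_banach_open_point hΩc hΩ hw
  -- The complex number representing the real functional f by f z = -Re(α z).
  set α : ℂ := -((f 1 : ℂ) - f Complex.I * Complex.I) with hα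
  have hre : ∀ z, (α * z).re = -f z := by
    intro z
    have : f z = z.re * f 1 + z.im * f Complex.I := by
      conv_lhs => rw [← Complex.re_add_im z]
      have h1 : (z.re : ℂ) + z.im * Complex.I = z.re • (1 : ℂ) + z.im • Complex.I := by simp
      rw [h1, map_add, map_smul, map_smul]; rfl
    rw [this, hα]
    simp
    ring
  refine h.2.2 (fun ξ => Complex.log (α * (ξ - w))) _
    (continuousOn_inv_sub fun hwS => hw (hS hwS)) fun ξ hξ => ?_
  have h1 : 0 < (α * (ξ - w)).re := by
    rw [hre, map_sub]; linarith [hf ξ (hS hξ)]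
  have h0 : α ≠ 0 := by rintro h; simp [h] at h1
  have h2 : ξ - w ≠ 0 := by rintro h; simp [h] at h1
  have := (((hasDerivAt_id ξ).sub_const w).const_mul α).clog
    (Or.inl h1)
  convert! this using 1
  simp only [id]
  field_simp

/-- The curve is star-shaped about a point c ∈ K and runs in a thickening of K, which is again
convex. Its index is computed at c, carried to all of K by connectedness, and is 0 outside the
thickening by convexity. -/
theorem exists_convex_cauchyCycle {K U : Set ℂ} (hK : IsCompact K) (hKc : Convex ℝ K)
    (hKn : K.Nonempty) (hU : IsOpen U) (hKU : K ⊆ U) :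
    ∃ Ω, IsOpen Ω ∧ Convex ℝ Ω ∧ K ⊆ Ω ∧ Ω ⊆ U ∧ ∃ Γ : PathCycle, IsCauchyCycle Γ K Ω := by
  obtain ⟨δ, hδ, hδU⟩ := hK.exists_thickening_subset_open hU hKU
  refine ⟨Metric.thickening δ K, Metric.isOpen_thickening, hKc.thickening δ,
    Metric.self_subset_thickening hδ K, hδU, ?_⟩
  obtain ⟨c, hc⟩ := hKn
  obtain ⟨R, hRs, hR⟩ := exists_radius_function hK hKc Metric.isOpen_thickening
    (hKc.thickening δ) (Metric.self_subset_thickening hδ K) hc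
  set e : ℝ → ℂ := fun t => Complex.exp (2 * Real.pi * t * Complex.I) with he
  have he1 : ∀ t, ‖e t‖ = 1 := fun t => by
    have : (2 * Real.pi * t * Complex.I : ℂ) = ((2 * Real.pi * t : ℝ) : ℂ) * Complex.I := by
      push_cast; ring
    rw [he]; simp only; rw [this, Complex.norm_exp_ofReal_mul_I]
  have hed : ∀ t, HasDerivAt e (2 * Real.pi * Complex.I * e t) t := fun t => by
    have h1 : HasDerivAt (fun t : ℝ => (2 * Real.pi * t * Complex.I : ℂ))
        (2 * Real.pi * Complex.I) t := by
      have := ((Complex.ofRealCLM.hasDerivAt (x := t)).const_mul (2 * Real.pi : ℂ)).mul_const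
        Complex.I
      simpa using this
    convert! h1.cexp using 1
    exact mul_comm _ _
  have hes : ContDiff ℝ 1 e := by
    rw [he]
    exact (((contDiff_const.mul Complex.ofRealCLM.contDiff).mul contDiff_const).cexp)
  have he01 : e 0 = 1 ∧ e 1 = 1 := by
    refine ⟨by simp [he], ?_⟩
    simp [he, Complex.exp_two_pi_mul_I]
  set ρ : ℝ → ℝ := fun t => R (e t) with hρ
  have hρs : ContDiff ℝ 1 ρ := hRs.comp hes
  have hρ0 : ∀ t, 0 < ρ t := fun t => (hR _ (he1 t)).1
  set p : ℝ → ℂ := fun t => c + ρ t * e t with hp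
  have hps : ContDiff ℝ 1 p :=
    contDiff_const.add ((Complex.ofRealCLM.contDiff.comp hρs).mul hes)
  have hp01 : p 0 = p 1 := by simp [hp, hρ, he01]
  have hpS : range p ⊆ Metric.thickening δ K \ K := by
    rintro _ ⟨t, rfl⟩
    exact ⟨(hR _ (he1 t)).2.1, (hR _ (he1 t)).2.2⟩
  set Γ : PathCycle := [ClosedPath.ofContDiff p hps hp01] with hΓ
  have htr : Γ.trace ⊆ Metric.thickening δ K \ K := (PathCycle.trace_ofContDiff hps hp01).trans hpS
  have hcont := Γ.isClosedContour
  have hind : Γ.integral (fun ξ => (ξ - c)⁻¹) = 2 * Real.pi * Complex.I := by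
    rw [hΓ, PathCycle.integral_ofContDiff]
    have hρd : ∀ t, HasDerivAt ρ (deriv ρ t) t := fun t =>
      ((hρs.differentiable one_ne_zero) t).hasDerivAt
    -- log ρ(t) + 2πit is a global branch of log(p(t) - c). Its real part has equal values at t = 0
    -- and t = 1, so only 2πi remains.
    have hd : ∀ t, HasDerivAt (fun t : ℝ => ((Real.log (ρ t) : ℝ) : ℂ) + 2 * Real.pi * Complex.I * t)
        (deriv p t * (p t - c)⁻¹) t := by
      intro t
      have h1 := ((hρd t).log (hρ0 t).ne').ofReal_comp
      have h2 := (Complex.ofRealCLM.hasDerivAt (x := t)).const_mul (2 * Real.pi * Complex.I)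
      have h3 : HasDerivAt p (((deriv ρ t : ℝ) : ℂ) * e t + ρ t * (2 * Real.pi * Complex.I * e t)) t :=
        (((hρd t).ofReal_comp.mul (hed t))).const_add c
      rw [h3.deriv]
      convert! h1.add h2 using 1
      have h4 : (ρ t : ℂ) ≠ 0 := by exact_mod_cast (hρ0 t).ne'
      have h5 : e t ≠ 0 := Complex.exp_ne_zero _
      simp only [hp, Complex.ofRealCLM_apply, Complex.ofReal_one, mul_one, Complex.ofReal_div,
        add_sub_cancel_left]
      field_simp
    rw [intervalIntegral.integral_eq_sub_of_hasDerivAt (fun t _ => hd t)]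
    · simp [hρ, he01]
    · refine Continuous.intervalIntegrable ?_ _ _
      refine (hps.continuous_deriv le_rfl).mul ((hps.continuous.sub continuous_const).inv₀ ?_)
      intro t
      have h4 : (ρ t : ℂ) ≠ 0 := by exact_mod_cast (hρ0 t).ne'
      simpa [hp] using ⟨(hρ0 t).ne', Complex.exp_ne_zero _⟩
  refine ⟨Γ, htr, fun u hu => ?_, fun w hw => ?_⟩
  · rw [PathCycle.index, hcont.index_eq_of_isPreconnected hKc.isPreconnected
      (Set.disjoint_left.2 fun z hz hz' => (htr hz').2 hz) hc hu, hind]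
    exact inv_mul_cancel₀ Complex.two_pi_I_ne_zero
  · rw [PathCycle.index, hcont.index_eq_zero_of_convex Metric.isOpen_thickening
      (hKc.thickening δ) (htr.trans sdiff_subset) hw, mul_zero]

/-! ### Support functions -/

section SupportFun

variable {K L : Set ℂ}

theorem bddAbove_image_re_mul (hK : IsCompact K) (z : ℂ) :
    BddAbove ((fun u : ℂ => (z * u).re) '' K) :=
  (hK.image (by fun_prop)).bddAbove

theorem re_mul_le_supportFun (hK : IsCompact K) {u : ℂ} (hu : u ∈ K) (z : ℂ) :
    (z * u).re ≤ supportFun K z :=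
  le_csSup (bddAbove_image_re_mul hK z) ⟨u, hu, rfl⟩

theorem supportFun_le (hK : K.Nonempty) {z : ℂ} {M : ℝ} (h : ∀ u ∈ K, (z * u).re ≤ M) :
    supportFun K z ≤ M :=
  csSup_le (hK.image _) (by rintro _ ⟨u, hu, rfl⟩; exact h u hu)

theorem supportFun_ofReal_mul_le (hK : IsCompact K) (hKn : K.Nonempty) {r : ℝ} (hr : 0 ≤ r)
    (z : ℂ) : supportFun K (r * z) ≤ r * supportFun K z :=
  supportFun_le hKn fun u hu => by
    rw [mul_assoc, Complex.re_ofReal_mul]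
    exact mul_le_mul_of_nonneg_left (re_mul_le_supportFun hK hu z) hr

theorem continuous_supportFun (hK : IsCompact K) (hKn : K.Nonempty) :
    Continuous (supportFun K) := by
  obtain ⟨M, hM⟩ := hK.isBounded.exists_norm_le
  have h : ∀ z w, supportFun K z - supportFun K w ≤ M * ‖z - w‖ := fun z w => by
    rw [sub_le_iff_le_add]
    refine supportFun_le hKn fun u hu => ?_
    have h1 := re_mul_le_supportFun hK hu w
    have h2 : ((z - w) * u).re ≤ ‖z - w‖ * M := by
      refine (Complex.re_le_norm _).trans ?_
      rw [norm_mul]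
      exact mul_le_mul_of_nonneg_left (hM u hu) (norm_nonneg _)
    rw [sub_mul, Complex.sub_re] at h2
    linarith
  refine (LipschitzWith.of_dist_le_mul (K := M.toNNReal) fun z w => ?_).continuous
  rw [dist_eq_norm, dist_eq_norm]
  refine le_trans ?_ (mul_le_mul_of_nonneg_right (Real.le_coe_toNNReal M) (norm_nonneg _))
  rw [Real.norm_eq_abs, abs_le]
  constructor
  · have := h w z
    rw [norm_sub_rev] at this
    linarith
  · exact h z w

theorem re_mul_le_supportFun_add (hK : IsCompact K) {δ : ℝ} {ξ : ℂ}
    (hξ : ξ ∈ Metric.thickening δ K) (z : ℂ) : (z * ξ).re ≤ supportFun K z + δ * ‖z‖ := by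
  obtain ⟨u, hu, hd⟩ := Metric.mem_thickening_iff.1 hξ
  have h1 := re_mul_le_supportFun hK hu z
  have h2 : (z * (ξ - u)).re ≤ ‖z‖ * δ := by
    refine (Complex.re_le_norm _).trans ?_
    rw [norm_mul, ← dist_eq_norm]
    exact mul_le_mul_of_nonneg_left hd.le (norm_nonneg _)
  rw [mul_sub, Complex.sub_re] at h2
  linarith

/-- If p is the nearest point of K to u, then the direction conj(u - p)/|u - p| supports K at p, and
u lies beyond the supporting line by exactly its distance to K. The quantitative gap becomes the
decay rate of Laplace integrals. -/
theorem exists_supportFun_add_infDist_le (hK : IsCompact K) (hKc : Convex ℝ K)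
    (hKn : K.Nonempty) {u : ℂ} (hu : u ∉ K) :
    ∃ θ : ℝ, supportFun K (Complex.exp (θ * Complex.I)) + Metric.infDist u K ≤
      (Complex.exp (θ * Complex.I) * u).re := by
  obtain ⟨p, hp, hd⟩ := hK.exists_infDist_eq_dist hKn u
  have h1 : ‖u - p‖ = ⨅ w : K, ‖u - w‖ := by
    rw [← dist_eq_norm, ← hd, Metric.infDist_eq_iInf]
    simp only [dist_eq_norm]
  have h2 := (norm_eq_iInf_iff_real_inner_le_zero hKc hp).1 h1
  have h0 : u - p ≠ 0 := sub_ne_zero.2 fun h => hu (h ▸ hp)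
  have hn : 0 < ‖u - p‖ := norm_pos_iff.2 h0
  set α : ℂ := (starRingEnd ℂ) (u - p) / ‖u - p‖ with hα
  have hα1 : ‖α‖ = 1 := by
    rw [hα, norm_div, RCLike.norm_conj, Complex.norm_real, norm_norm, div_self hn.ne']
  refine ⟨α.arg, ?_⟩
  have hexp : Complex.exp (α.arg * Complex.I) = α := by
    have := Complex.norm_mul_exp_arg_mul_I α
    rwa [hα1, Complex.ofReal_one, one_mul] at this
  rw [hexp, ← le_sub_iff_add_le]
  refine supportFun_le hKn fun k hk => ?_
  have h3 := h2 k hk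
  rw [Complex.inner] at h3
  have h4 : (α * (k - p)).re ≤ 0 := by
    rw [hα, div_mul_eq_mul_div, Complex.div_ofReal_re]
    rw [mul_comm] at h3
    exact div_nonpos_of_nonpos_of_nonneg h3 hn.le
  have h5 : (α * (u - p)).re = ‖u - p‖ := by
    rw [hα, div_mul_eq_mul_div, Complex.div_ofReal_re, mul_comm, Complex.mul_conj,
      Complex.ofReal_re, Complex.normSq_eq_norm_sq, sq, mul_div_assoc, div_self hn.ne', mul_one]
  rw [hd, dist_eq_norm]
  rw [mul_sub, Complex.sub_re] at h4 h5
  linarith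

theorem supportFun_lt_of_notMem (hK : IsCompact K) (hKc : Convex ℝ K)
    (hKn : K.Nonempty) {u : ℂ} (hu : u ∉ K) :
    ∃ θ : ℝ, supportFun K (Complex.exp (θ * Complex.I)) < (Complex.exp (θ * Complex.I) * u).re := by
  obtain ⟨θ, hθ⟩ := exists_supportFun_add_infDist_le hK hKc hKn hu
  have := (hK.isClosed.notMem_iff_infDist_pos hKn).1 hu
  exact ⟨θ, by linarith⟩

end SupportFun

/-! ### Exponential type and growth bounds -/

theorem ENNReal.log_div_le_iff {x : ℝ≥0∞} {r a : ℝ} (hr : 0 < r) :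
    ENNReal.log x / (r : EReal) ≤ (a : EReal) ↔ x ≤ ENNReal.ofReal (Real.exp (a * r)) := by
  rw [EReal.div_le_iff_le_mul (by exact_mod_cast hr) (EReal.coe_ne_top r), ← EReal.exp_coe,
    ← EReal.exp_le_exp_iff, ENNReal.exp_log, ← EReal.coe_mul, mul_comm]

theorem enorm_le_ofReal_iff {z : ℂ} {a : ℝ} (ha : 0 ≤ a) : ‖z‖ₑ ≤ ENNReal.ofReal a ↔ ‖z‖ ≤ a := by
  rw [← ofReal_norm, ENNReal.ofReal_le_ofReal_iff ha]

theorem limsup_log_div_le {u : ℝ → ℝ≥0∞} {C a : ℝ}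
    (h : ∀ r > 0, u r ≤ ENNReal.ofReal (C * Real.exp (a * r))) :
    limsup (fun r : ℝ => ENNReal.log (u r) / (r : EReal)) atTop ≤ (a : EReal) := by
  refine EReal.le_of_forall_lt_iff_le.1 fun b hb => ?_
  rw [EReal.coe_lt_coe_iff] at hb
  refine limsup_le_of_le (by isBoundedDefault) ?_
  have h1 : Tendsto (fun r : ℝ => Real.exp ((b - a) * r)) atTop atTop :=
    Real.tendsto_exp_atTop.comp (tendsto_id.const_mul_atTop (sub_pos.2 hb))
  filter_upwards [eventually_gt_atTop 0, h1.eventually (eventually_ge_atTop C)] with r hr hr1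
  rw [ENNReal.log_div_le_iff hr]
  refine (h r hr).trans (ENNReal.ofReal_le_ofReal ?_)
  refine (mul_le_mul_of_nonneg_right hr1 (Real.exp_pos _).le).trans ?_
  rw [← Real.exp_add]
  exact (Real.exp_le_exp.2 (by linarith)).trans le_rfl

theorem indicatorFun_le_of_bound {f : ℂ → ℂ} {θ C a : ℝ} (hC : 0 ≤ C)
    (h : ∀ r > 0, ‖f ((r : ℝ) * Complex.exp (θ * Complex.I))‖ ≤ C * Real.exp (a * r)) :
    indicatorFun f θ ≤ (a : EReal) :=
  limsup_log_div_le fun r hr => (enorm_le_ofReal_iff (by positivity)).2 (h r hr)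

theorem isExponentialType_of_bound {f : ℂ → ℂ} {C a : ℝ} (hC : 0 ≤ C)
    (h : ∀ z, ‖f z‖ ≤ C * Real.exp (a * ‖z‖)) : IsExponentialType f := by
  refine ((limsup_log_div_le (C := C) (a := a) fun r hr => ?_).trans_lt (EReal.coe_lt_top a)).ne
  refine iSup₂_le fun z hz => (enorm_le_ofReal_iff (by positivity)).2 ?_
  rw [mem_sphere_zero_iff_norm] at hz
  rw [← hz]
  exact h z

theorem exists_bound_of_indicatorFun_lt {f : ℂ → ℂ} (hf : Continuous f) {θ a : ℝ}
    (h : indicatorFun f θ < (a : EReal)) :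
    ∃ C, 0 ≤ C ∧ ∀ r : ℝ, 0 ≤ r →
      ‖f (r * Complex.exp (θ * Complex.I))‖ ≤ C * Real.exp (a * r) := by
  have h1 := eventually_lt_of_limsup_lt h
  obtain ⟨R, hR⟩ := eventually_atTop.1 (h1.and (eventually_gt_atTop 0))
  obtain ⟨M, hM⟩ := (isCompact_Icc (a := (0 : ℝ)) (b := R)).exists_bound_of_continuousOn
    (f := fun r : ℝ => (Real.exp (-(a * r)) : ℂ) * f (r * Complex.exp (θ * Complex.I)))
    (by fun_prop)
  refine ⟨max M 1, by positivity, fun r hr => ?_⟩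
  rcases le_total r R with hrR | hrR
  · have h2 := hM r ⟨hr, hrR⟩
    rw [norm_mul, Complex.norm_real, Real.norm_of_nonneg (Real.exp_pos _).le, Real.exp_neg,
      inv_mul_le_iff₀ (Real.exp_pos _)] at h2
    exact (h2.trans_eq (mul_comm _ _)).trans (mul_le_mul_of_nonneg_right (le_max_left _ _) (Real.exp_pos _).le)
  · obtain ⟨h2, h3⟩ := hR r hrR
    have h4 := (enorm_le_ofReal_iff (Real.exp_pos _).le).1 ((ENNReal.log_div_le_iff h3).1 h2.le)
    refine h4.trans ?_
    exact le_mul_of_one_le_left (Real.exp_pos _).le (le_max_right _ _)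

theorem IsExponentialType.exists_bound {f : ℂ → ℂ} (hf : Continuous f)
    (h : IsExponentialType f) :
    ∃ C A, 0 < C ∧ 0 < A ∧ ∀ z, ‖f z‖ ≤ C * Real.exp (A * ‖z‖) := by
  obtain ⟨A, hA, -⟩ := EReal.lt_iff_exists_real_btwn.1 (lt_top_iff_ne_top.2 h)
  have h1 := eventually_lt_of_limsup_lt hA
  obtain ⟨R, hR⟩ := eventually_atTop.1 (h1.and (eventually_gt_atTop 0))
  obtain ⟨M, hM⟩ := (isCompact_closedBall (0 : ℂ) R).exists_bound_of_continuousOn hf.continuousOn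
  refine ⟨max M 1, max A 1, by positivity, by positivity, fun z => ?_⟩
  rcases le_total ‖z‖ R with hz | hz
  · have h2 := hM z (mem_closedBall_zero_iff.2 hz)
    have h3 : (1 : ℝ) ≤ Real.exp (max A 1 * ‖z‖) := Real.one_le_exp (by positivity)
    exact (h2.trans (le_max_left _ _)).trans (le_mul_of_one_le_right (by positivity) h3)
  · obtain ⟨h2, h3⟩ := hR _ hz
    have h4 := (ENNReal.log_div_le_iff h3).1 h2.le
    have h5 : ‖f z‖ₑ ≤ ⨆ w ∈ Metric.sphere (0 : ℂ) ‖z‖, ‖f w‖ₑ :=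
      le_iSup₂ (f := fun w (_ : w ∈ Metric.sphere (0 : ℂ) ‖z‖) => ‖f w‖ₑ) z (by simp)
    have h6 := (enorm_le_ofReal_iff (Real.exp_pos _).le).1 (h5.trans h4)
    refine h6.trans ((Real.exp_le_exp.2 ?_).trans
      (le_mul_of_one_le_left (Real.exp_pos _).le (le_max_right _ _)))
    exact mul_le_mul_of_nonneg_right (le_max_left _ _) h3.le

/-- `f` grows at most like `exp (H_K(z) + ε |z|)` for every `ε > 0`. -/
def HasGrowth (K : Set ℂ) (f : ℂ → ℂ) : Prop :=
  ∀ ε > 0, ∃ C, 0 ≤ C ∧ ∀ z, ‖f z‖ ≤ C * Real.exp (supportFun K z + ε * ‖z‖)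

section Growth

variable {K : Set ℂ}

theorem HasGrowth.isExponentialType (hK : IsCompact K) (hKn : K.Nonempty) {f : ℂ → ℂ}
    (h : HasGrowth K f) : IsExponentialType f := by
  obtain ⟨C, hC, hf⟩ := h 1 one_pos
  obtain ⟨M, hM⟩ := hK.isBounded.exists_norm_le
  refine isExponentialType_of_bound hC (a := M + 1) fun z => (hf z).trans ?_
  refine mul_le_mul_of_nonneg_left (Real.exp_le_exp.2 ?_) hC
  have : supportFun K z ≤ M * ‖z‖ := supportFun_le hKn fun u hu => by
    refine (Complex.re_le_norm _).trans ?_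
    rw [norm_mul, mul_comm]
    exact mul_le_mul_of_nonneg_right (hM u hu) (norm_nonneg _)
  linarith

theorem HasGrowth.indicatorFun_le (hK : IsCompact K) (hKn : K.Nonempty) {f : ℂ → ℂ}
    (h : HasGrowth K f) (θ : ℝ) :
    indicatorFun f θ ≤ (supportFun K (Complex.exp (θ * Complex.I)) : ℝ) := by
  refine EReal.le_of_forall_lt_iff_le.1 fun b hb => ?_
  rw [EReal.coe_lt_coe_iff] at hb
  obtain ⟨C, hC, hf⟩ := h _ (sub_pos.2 hb)
  refine indicatorFun_le_of_bound hC fun r hr => (hf _).trans ?_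
  refine mul_le_mul_of_nonneg_left (Real.exp_le_exp.2 ?_) hC
  have h1 := supportFun_ofReal_mul_le hK hKn hr.le (Complex.exp (θ * Complex.I))
  rw [norm_mul, Complex.norm_real, Complex.norm_exp_ofReal_mul_I, Real.norm_of_nonneg hr.le]
  linarith

theorem conjDiagram_subset_of_indicatorFun_le (hK : IsCompact K) (hKc : Convex ℝ K)
    (hKn : K.Nonempty) {f : ℂ → ℂ}
    (h : ∀ θ, indicatorFun f θ ≤ (supportFun K (Complex.exp (θ * Complex.I)) : ℝ)) :
    conjDiagram f ⊆ K := by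
  intro u hu
  by_contra huK
  obtain ⟨θ, hθ⟩ := supportFun_lt_of_notMem hK hKc hKn huK
  have := (hu θ).trans (h θ)
  rw [EReal.coe_le_coe_iff] at this
  linarith

/-- The element of `Exp(K)` given by an entire function with suitable growth. -/
def ExpSpace.ofGrowth (hK : IsCompact K) (hKc : Convex ℝ K) (hKn : K.Nonempty) {f : ℂ → ℂ}
    (hf : Differentiable ℂ f) (h : HasGrowth K f) : ExpSpace K :=
  ⟨f, hf, h.isExponentialType hK hKn,
    conjDiagram_subset_of_indicatorFun_le hK hKc hKn (h.indicatorFun_le hK hKn)⟩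

end Growth

theorem isClosed_conjDiagram (f : ℂ → ℂ) : IsClosed (conjDiagram f) := by
  have : conjDiagram f = ⋂ θ : ℝ, {u | (((Complex.exp (θ * Complex.I) * u).re : ℝ) : EReal) ≤
      indicatorFun f θ} := by
    ext u; simp [conjDiagram]
  rw [this]
  refine isClosed_iInter fun θ => isClosed_le ?_ continuous_const
  exact continuous_coe_real_ereal.comp (by fun_prop)

theorem convex_conjDiagram (f : ℂ → ℂ) : Convex ℝ (conjDiagram f) := by
  intro x hx y hy a b ha hb hab θ
  have h1 : (Complex.exp (θ * Complex.I) * (a • x + b • y)).re ≤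
      max (Complex.exp (θ * Complex.I) * x).re (Complex.exp (θ * Complex.I) * y).re := by
    set e := Complex.exp (θ * Complex.I)
    have : (e * (a • x + b • y)).re = a * (e * x).re + b * (e * y).re := by
      simp; ring
    rw [this]
    calc a * (e * x).re + b * (e * y).re
        ≤ a * max (e * x).re (e * y).re + b * max (e * x).re (e * y).re := by
          gcongr
          · exact le_max_left _ _
          · exact le_max_right _ _
      _ = max (e * x).re (e * y).re := by rw [← add_mul, hab, one_mul]
  refine (EReal.coe_le_coe_iff.2 h1).trans ?_
  rcases max_choice (Complex.exp (θ * Complex.I) * x).re (Complex.exp (θ * Complex.I) * y).re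
    with h | h
  · rw [h]; exact hx θ
  · rw [h]; exact hy θ

/-! ### Laplace integrals along rays -/

/-- The Laplace integral `∫ f(w) e^{-ξ w} dw` along the ray with argument `θ`. -/
noncomputable def laplaceRay (f : ℂ → ℂ) (θ : ℝ) (ξ : ℂ) : ℂ :=
  ∫ r in Ioi (0 : ℝ), f (r * Complex.exp (θ * Complex.I)) *
    Complex.exp (-(ξ * (r * Complex.exp (θ * Complex.I)))) * Complex.exp (θ * Complex.I)

/-- The half plane on which the Laplace integral along the ray with argument `θ` converges. -/
def laplaceHalfPlane (f : ℂ → ℂ) (θ : ℝ) : Set ℂ :=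
  {ξ | indicatorFun f θ < (((Complex.exp (θ * Complex.I) * ξ).re : ℝ) : EReal)}

theorem isOpen_laplaceHalfPlane (f : ℂ → ℂ) (θ : ℝ) : IsOpen (laplaceHalfPlane f θ) :=
  isOpen_lt continuous_const (continuous_coe_real_ereal.comp (by fun_prop))

theorem convex_laplaceHalfPlane (f : ℂ → ℂ) (θ : ℝ) : Convex ℝ (laplaceHalfPlane f θ) := by
  intro x hx y hy a b ha hb hab
  have h1 : min (Complex.exp (θ * Complex.I) * x).re (Complex.exp (θ * Complex.I) * y).re ≤
      (Complex.exp (θ * Complex.I) * (a • x + b • y)).re := by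
    set e := Complex.exp (θ * Complex.I)
    have : (e * (a • x + b • y)).re = a * (e * x).re + b * (e * y).re := by
      simp; ring
    rw [this]
    calc min (e * x).re (e * y).re = a * min (e * x).re (e * y).re +
          b * min (e * x).re (e * y).re := by rw [← add_mul, hab, one_mul]
      _ ≤ a * (e * x).re + b * (e * y).re := by
          gcongr
          · exact min_le_left _ _
          · exact min_le_right _ _
  refine lt_of_lt_of_le ?_ (EReal.coe_le_coe_iff.2 h1)
  rcases min_choice (Complex.exp (θ * Complex.I) * x).re (Complex.exp (θ * Complex.I) * y).re
    with h | h
  · rw [h]; exact hx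
  · rw [h]; exact hy

/-- This covering is what makes the Laplace integrals continue the Borel series to the whole
complement of the diagram. -/
theorem compl_conjDiagram (f : ℂ → ℂ) : (conjDiagram f)ᶜ = ⋃ θ, laplaceHalfPlane f θ := by
  ext u
  simp [conjDiagram, laplaceHalfPlane]

theorem norm_laplace_integrand (f : ℂ → ℂ) (θ : ℝ) (ξ : ℂ) (r : ℝ) :
    ‖f (r * Complex.exp (θ * Complex.I)) *
      Complex.exp (-(ξ * (r * Complex.exp (θ * Complex.I)))) * Complex.exp (θ * Complex.I)‖ =
    ‖f (r * Complex.exp (θ * Complex.I))‖ *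
      Real.exp (-((Complex.exp (θ * Complex.I) * ξ).re * r)) := by
  rw [norm_mul, norm_mul, Complex.norm_exp_ofReal_mul_I, mul_one, Complex.norm_exp]
  congr 2
  have : -(ξ * (r * Complex.exp (θ * Complex.I))) =
      -((r : ℂ) * (Complex.exp (θ * Complex.I) * ξ)) := by ring
  rw [this, Complex.neg_re, Complex.re_ofReal_mul, mul_comm]

theorem continuous_laplace_integrand {f : ℂ → ℂ} (hf : Continuous f) (θ : ℝ) (ξ : ℂ) :
    Continuous fun r : ℝ => f (r * Complex.exp (θ * Complex.I)) *
      Complex.exp (-(ξ * (r * Complex.exp (θ * Complex.I)))) * Complex.exp (θ * Complex.I) := by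
  fun_prop

theorem integrableOn_exp_neg_mul_Ioi {b : ℝ} (hb : 0 < b) (C : ℝ) :
    Integrable (fun r : ℝ => C * Real.exp (-(b * r))) (volume.restrict (Ioi 0)) := by
  have := (exp_neg_integrableOn_Ioi 0 hb).const_mul C
  simpa [IntegrableOn] using this

theorem norm_laplace_integrand_le {f : ℂ → ℂ} {θ a b C : ℝ} {ξ : ℂ} (hC : 0 ≤ C)
    (h : ∀ r : ℝ, 0 ≤ r → ‖f (r * Complex.exp (θ * Complex.I))‖ ≤ C * Real.exp (a * r))
    (hb : b ≤ (Complex.exp (θ * Complex.I) * ξ).re) :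
    ∀ᵐ r : ℝ ∂(volume.restrict (Ioi (0 : ℝ))), ‖f (r * Complex.exp (θ * Complex.I)) *
      Complex.exp (-(ξ * (r * Complex.exp (θ * Complex.I)))) * Complex.exp (θ * Complex.I)‖ ≤
        C * Real.exp (-((b - a) * r)) := by
  filter_upwards [ae_restrict_mem measurableSet_Ioi] with r hr
  have hr0 : 0 ≤ r := le_of_lt hr
  rw [norm_laplace_integrand]
  calc _ ≤ C * Real.exp (a * r) * Real.exp (-(b * r)) := by
        refine mul_le_mul (h r hr0) (Real.exp_le_exp.2 ?_) (Real.exp_pos _).le (by positivity)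
        exact neg_le_neg (mul_le_mul_of_nonneg_right hb hr0)
    _ = _ := by rw [mul_assoc, ← Real.exp_add]; ring_nf

theorem integrable_laplace_integrand {f : ℂ → ℂ} (hf : Continuous f) {θ : ℝ} {ξ : ℂ}
    (hξ : ξ ∈ laplaceHalfPlane f θ) :
    Integrable (fun r : ℝ => f (r * Complex.exp (θ * Complex.I)) *
      Complex.exp (-(ξ * (r * Complex.exp (θ * Complex.I)))) * Complex.exp (θ * Complex.I))
      (volume.restrict (Ioi 0)) := by
  obtain ⟨a, ha, haξ⟩ := EReal.lt_iff_exists_real_btwn.1 hξ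
  rw [EReal.coe_lt_coe_iff] at haξ
  obtain ⟨C, hC, hb⟩ := exists_bound_of_indicatorFun_lt hf ha
  exact (integrableOn_exp_neg_mul_Ioi (sub_pos.2 haξ) C).mono'
    (continuous_laplace_integrand hf θ ξ).aestronglyMeasurable
    (norm_laplace_integrand_le hC hb le_rfl)

theorem norm_laplaceRay_le {f : ℂ → ℂ} {θ a C : ℝ} {ξ : ℂ} (hC : 0 ≤ C)
    (h : ∀ r : ℝ, 0 ≤ r → ‖f (r * Complex.exp (θ * Complex.I))‖ ≤ C * Real.exp (a * r))
    (ha : a < (Complex.exp (θ * Complex.I) * ξ).re) :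
    ‖laplaceRay f θ ξ‖ ≤ C / ((Complex.exp (θ * Complex.I) * ξ).re - a) := by
  have hpos := sub_pos.2 ha
  refine (norm_integral_le_of_norm_le (integrableOn_exp_neg_mul_Ioi hpos C)
    (norm_laplace_integrand_le hC h le_rfl)).trans ?_
  rw [integral_const_mul]
  have := integral_exp_mul_Ioi (neg_neg_of_pos hpos) 0
  simp only [neg_mul, mul_zero, Real.exp_zero] at this
  rw [this]
  apply le_of_eq
  field_simp

theorem differentiableOn_laplaceRay {f : ℂ → ℂ} (hf : Continuous f) (θ : ℝ) :
    DifferentiableOn ℂ (laplaceRay f θ) (laplaceHalfPlane f θ) := by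
  refine differentiableOn_integral_of_locally_dominated (isOpen_laplaceHalfPlane f θ)
    (fun ξ _ => (continuous_laplace_integrand hf θ ξ).aestronglyMeasurable)
    (Eventually.of_forall fun r => Differentiable.differentiableOn (by fun_prop)) ?_
  intro ξ₀ hξ₀
  obtain ⟨a, ha, haξ⟩ := EReal.lt_iff_exists_real_btwn.1 hξ₀
  rw [EReal.coe_lt_coe_iff] at haξ
  obtain ⟨b, hab, hbξ⟩ := exists_between haξ
  obtain ⟨C, hC, hbd⟩ := exists_bound_of_indicatorFun_lt hf ha
  have hc : ContinuousAt (fun ξ => (Complex.exp (θ * Complex.I) * ξ).re) ξ₀ := by fun_prop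
  obtain ⟨ρ, hρ, hρb⟩ := Metric.eventually_nhds_iff_ball.1 (hc.eventually (eventually_gt_nhds hbξ))
  refine ⟨fun r => C * Real.exp (-((b - a) * r)), integrableOn_exp_neg_mul_Ioi (sub_pos.2 hab) C,
    ρ, hρ, ?_⟩
  filter_upwards [ae_restrict_mem measurableSet_Ioi] with r hr ξ hξ
  have hr0 : 0 ≤ r := le_of_lt hr
  rw [norm_laplace_integrand]
  calc _ ≤ C * Real.exp (a * r) * Real.exp (-(b * r)) := by
        refine mul_le_mul (hbd r hr0) (Real.exp_le_exp.2 ?_) (Real.exp_pos _).le (by positivity)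
        exact neg_le_neg (mul_le_mul_of_nonneg_right (hρb ξ hξ).le hr0)
    _ = _ := by rw [mul_assoc, ← Real.exp_add]; ring_nf

/-! ### Comparison with the Borel series -/

theorem integrable_pow_mul_exp_neg_mul_Ioi (n : ℕ) {b : ℝ} (hb : 0 < b) :
    Integrable (fun r : ℝ => r ^ n * Real.exp (-(b * r))) (volume.restrict (Ioi 0)) := by
  have := integrableOn_rpow_mul_exp_neg_mul_rpow (s := n) (p := 1) (b := b)
    (by linarith [Nat.cast_nonneg (α := ℝ) n]) one_pos hb
  refine this.congr_fun (fun r _ => ?_) measurableSet_Ioi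
  simp

theorem integrable_complex_pow_mul_exp_neg_mul_Ioi (n : ℕ) {s : ℂ} (hs : 0 < s.re) :
    Integrable (fun r : ℝ => (r : ℂ) ^ n * Complex.exp (-(s * r))) (volume.restrict (Ioi 0)) := by
  refine (integrable_pow_mul_exp_neg_mul_Ioi n hs).mono'
    (Continuous.aestronglyMeasurable (by fun_prop)) ?_
  filter_upwards [ae_restrict_mem measurableSet_Ioi] with r hr
  rw [norm_mul, norm_pow, Complex.norm_real, Real.norm_of_nonneg (le_of_lt hr), Complex.norm_exp]
  simp

theorem integral_pow_mul_exp_neg_mul_Ioi (n : ℕ) {s : ℂ} (hs : 0 < s.re) :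
    ∫ r in Ioi (0 : ℝ), (r : ℂ) ^ n * Complex.exp (-(s * r)) = n.factorial / s ^ (n + 1) := by
  have hs0 : s ≠ 0 := by rintro rfl; simp at hs
  induction n with
  | zero =>
    have h := integral_exp_mul_complex_Ioi (a := -s) (by simpa using hs) 0
    simp only [neg_mul, Complex.ofReal_zero, mul_zero, Complex.exp_zero] at h
    simp only [pow_zero, one_mul, h, Nat.factorial_zero, Nat.cast_one, zero_add, pow_one]
    rw [neg_div_neg_eq]
  | succ n ih =>
    have i0 := integrable_complex_pow_mul_exp_neg_mul_Ioi n hs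
    have i1 := integrable_complex_pow_mul_exp_neg_mul_Ioi (n + 1) hs
    have hd : ∀ r : ℝ, HasDerivAt (fun r : ℝ => (r : ℂ) ^ (n + 1) * Complex.exp (-(s * r)))
        ((n + 1) * ((r : ℂ) ^ n * Complex.exp (-(s * r))) -
          s * ((r : ℂ) ^ (n + 1) * Complex.exp (-(s * r)))) r := fun r => by
      have h1 := (Complex.ofRealCLM.hasDerivAt (x := r)).fun_pow (n + 1)
      have h2 := ((Complex.ofRealCLM.hasDerivAt (x := r)).const_mul s).fun_neg.cexp
      have h3 := h1.fun_mul h2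
      simp only [Complex.ofRealCLM_apply, Complex.ofReal_one, mul_one, Nat.add_sub_cancel] at h3
      convert! h3 using 1
      push_cast
      ring
    have hi := (i0.const_mul ((n : ℂ) + 1)).sub (i1.const_mul s)
    have ht := tendsto_zero_of_hasDerivAt_of_integrableOn_Ioi (a := 0) (fun r _ => hd r) hi i1
    have h := integral_Ioi_of_hasDerivAt_of_tendsto' (a := 0) (fun r _ => hd r) hi ht
    rw [integral_sub (i0.const_mul _) (i1.const_mul _), integral_const_mul, integral_const_mul,
      ih] at h
    simp only [Complex.ofReal_zero, ne_eq, Nat.add_eq_zero_iff, one_ne_zero, and_false,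
      not_false_eq_true, zero_pow, zero_mul, sub_zero] at h
    rw [sub_eq_zero] at h
    rw [eq_div_iff (pow_ne_zero _ hs0), pow_succ s (n + 1), Nat.factorial_succ, ← mul_assoc,
      mul_right_comm, mul_comm _ s, ← h]
    push_cast
    field_simp

theorem integral_real_pow_mul_exp_neg_mul_Ioi (n : ℕ) {b : ℝ} (hb : 0 < b) :
    ∫ r in Ioi (0 : ℝ), r ^ n * Real.exp (-(b * r)) = n.factorial / b ^ (n + 1) := by
  have h := integral_pow_mul_exp_neg_mul_Ioi n (s := b) (by simpa using hb)
  have h2 : ∫ r in Ioi (0 : ℝ), (r : ℂ) ^ n * Complex.exp (-(b * r)) =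
      ((∫ r in Ioi (0 : ℝ), r ^ n * Real.exp (-(b * r)) : ℝ) : ℂ) := by
    rw [← integral_complex_ofReal]
    congr 1; ext r; push_cast; rfl
  rw [h2] at h
  exact_mod_cast h

/-- Cauchy's estimate on the circle of radius n, with n! ≤ n^n. The resulting ratio e^A is crude,
but some region of convergence of the Borel series is all that is needed. -/
theorem norm_iteratedDeriv_zero_le {f : ℂ → ℂ} (hf : Differentiable ℂ f) {C A : ℝ} (hC : 0 < C)
    (h : ∀ z, ‖f z‖ ≤ C * Real.exp (A * ‖z‖)) (n : ℕ) :
    ‖iteratedDeriv n f 0‖ ≤ C * Real.exp A ^ n := by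
  rcases Nat.eq_zero_or_pos n with rfl | hn
  · simpa using h 0
  · have hn' : (0 : ℝ) < n := by exact_mod_cast hn
    have h1 := Complex.norm_iteratedDeriv_le_of_forall_mem_sphere_norm_le n (c := 0) (R := n)
      (C := C * Real.exp (A * n)) hn' hf.diffContOnCl fun z hz => by
        have := h z
        rwa [mem_sphere_zero_iff_norm.1 hz] at this
    refine h1.trans ?_
    rw [div_le_iff₀ (by positivity), ← Real.exp_nat_mul, mul_comm A]
    have h2 : (n.factorial : ℝ) ≤ (n : ℝ) ^ n := by exact_mod_cast Nat.factorial_le_pow n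
    rw [mul_comm]
    exact mul_le_mul_of_nonneg_left h2 (by positivity)

/-- Integrating the Taylor series of f term by term against the exponential, each monomial giving a
Gamma integral. The condition on ξ makes the integrated norms a convergent geometric series. -/
theorem hasSum_laplaceRay {f : ℂ → ℂ} (hf : Differentiable ℂ f) {C A : ℝ} (hC : 0 < C)
    (h : ∀ z, ‖f z‖ ≤ C * Real.exp (A * ‖z‖)) {θ : ℝ} {ξ : ℂ}
    (hξ : Real.exp A < (Complex.exp (θ * Complex.I) * ξ).re) :
    HasSum (fun n : ℕ => iteratedDeriv n f 0 / ξ ^ (n + 1)) (laplaceRay f θ ξ) := by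
  set e := Complex.exp (θ * Complex.I) with he
  set σ := (e * ξ).re with hσ
  have hσ0 : 0 < σ := (Real.exp_pos A).trans hξ
  have he0 : e ≠ 0 := Complex.exp_ne_zero _
  have he1 : ‖e‖ = 1 := Complex.norm_exp_ofReal_mul_I θ
  have hξ0 : ξ ≠ 0 := by rintro rfl; simp [hσ] at hσ0
  set F : ℕ → ℝ → ℂ := fun n r => (iteratedDeriv n f 0 / n.factorial * e ^ (n + 1)) *
    ((r : ℂ) ^ n * Complex.exp (-((e * ξ) * r))) with hF
  have hnorm : ∀ n r, r ∈ Ioi (0 : ℝ) → ‖F n r‖ = ‖iteratedDeriv n f 0‖ / n.factorial *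
      (r ^ n * Real.exp (-(σ * r))) := fun n r hr => by
    simp only [hF, norm_mul, norm_div, norm_pow, he1, Complex.norm_real,
      Real.norm_of_nonneg (le_of_lt hr), Complex.norm_exp]
    simp [hσ]
  have hFm : ∀ n, AEStronglyMeasurable (F n) (volume.restrict (Ioi (0 : ℝ))) := fun n =>
    Continuous.aestronglyMeasurable (by fun_prop)
  have hFi : ∀ n, Integrable (F n) (volume.restrict (Ioi (0 : ℝ))) := fun n => by
    refine ((integrable_pow_mul_exp_neg_mul_Ioi n hσ0).const_mul
      (‖iteratedDeriv n f 0‖ / n.factorial)).mono' (hFm n) ?_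
    filter_upwards [ae_restrict_mem measurableSet_Ioi] with r hr using (hnorm n r hr).le
  have hFn : ∀ n, ∫ r in Ioi (0 : ℝ), ‖F n r‖ = ‖iteratedDeriv n f 0‖ / σ ^ (n + 1) := fun n => by
    rw [setIntegral_congr_fun measurableSet_Ioi (hnorm n), integral_const_mul,
      integral_real_pow_mul_exp_neg_mul_Ioi n hσ0]
    have : (n.factorial : ℝ) ≠ 0 := by exact_mod_cast n.factorial_ne_zero
    field_simp
  have hsum : Summable fun n => ∫ r in Ioi (0 : ℝ), ‖F n r‖ := by
    simp_rw [hFn]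
    have hq : Summable fun n : ℕ => C / σ * (Real.exp A / σ) ^ n :=
      (summable_geometric_of_lt_one (by positivity) ((div_lt_one hσ0).2 hξ)).mul_left _
    refine Summable.of_nonneg_of_le (fun n => by positivity) (fun n => ?_) hq
    rw [div_pow, div_mul_div_comm, pow_succ' σ]
    exact div_le_div_of_nonneg_right (norm_iteratedDeriv_zero_le hf hC h n) (by positivity)
  have hmain := hasSum_integral_of_summable_integral_norm hFi hsum
  have hFint : ∀ n, ∫ r in Ioi (0 : ℝ), F n r = iteratedDeriv n f 0 / ξ ^ (n + 1) := fun n => by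
    simp only [hF]
    rw [integral_const_mul, integral_pow_mul_exp_neg_mul_Ioi n hσ0]
    have : (n.factorial : ℂ) ≠ 0 := by exact_mod_cast n.factorial_ne_zero
    rw [mul_pow]
    field_simp
  simp_rw [hFint] at hmain
  rw [show laplaceRay f θ ξ = ∫ r in Ioi (0 : ℝ), ∑' n, F n r from ?_]
  · exact hmain
  unfold laplaceRay
  refine setIntegral_congr_fun measurableSet_Ioi fun r _ => ?_
  have h1 := (Complex.hasSum_taylorSeries_of_entire hf 0 (r * e)).mul_right
    (Complex.exp (-(ξ * (r * e))) * e)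
  have h2 : (fun n : ℕ => (n.factorial : ℂ)⁻¹ • ((r : ℂ) * e - 0) ^ n • iteratedDeriv n f 0 *
      (Complex.exp (-(ξ * (r * e))) * e)) = fun n => F n r := by
    ext n
    have h3 : -(ξ * (r * e)) = -(e * ξ * r) := by ring
    simp only [hF, smul_eq_mul, sub_zero, h3, mul_pow]
    ring
  rw [mul_assoc, ← h1.tsum_eq, ← h2]

/-! ### The Borel transform -/

theorem exp_mul_I_mul_exp_neg (θ : ℝ) (t : ℂ) :
    Complex.exp (θ * Complex.I) * (t * Complex.exp (-(θ * Complex.I))) = t := by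
  rw [mul_left_comm, ← Complex.exp_add, add_neg_cancel, Complex.exp_zero, mul_one]

theorem exp_mul_I_mul_exp_neg' (θ θ' : ℝ) (t : ℝ) :
    (Complex.exp (θ * Complex.I) * (t * Complex.exp (-(θ' * Complex.I)))).re =
      t * Real.cos (θ - θ') := by
  rw [mul_left_comm, ← Complex.exp_add, Complex.re_ofReal_mul]
  have : (θ * Complex.I + -(θ' * Complex.I) : ℂ) = ((θ - θ' : ℝ) : ℂ) * Complex.I := by
    push_cast; ring
  rw [this, Complex.exp_ofReal_mul_I_re]

theorem eqOn_of_convex_of_eqOn_open {f g : ℂ → ℂ} {U V : Set ℂ} (hU : IsOpen U)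
    (hUc : Convex ℝ U) (hf : DifferentiableOn ℂ f U) (hg : DifferentiableOn ℂ g U)
    (hV : IsOpen V) (hUV : (U ∩ V).Nonempty) (h : EqOn f g (U ∩ V)) : EqOn f g U := by
  obtain ⟨z, hz⟩ := hUV
  refine (hf.analyticOnNhd hU).eqOn_of_preconnected_of_eventuallyEq (hg.analyticOnNhd hU)
    hUc.isPreconnected hz.1 (eventually_of_mem ((hU.inter hV).mem_nhds hz) h)

section Borel

variable {f : ℂ → ℂ} (hf : Differentiable ℂ f)
include hf

/-- When the rays are not opposite, the two half planes share points far out in both directions,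
where each Laplace integral equals the Borel series. The identity theorem on the convex intersection
does the rest. -/
theorem laplaceRay_eqOn_of_cos {C A : ℝ} (hC : 0 < C)
    (h : ∀ z, ‖f z‖ ≤ C * Real.exp (A * ‖z‖)) {θ θ' : ℝ} (hθ : -1 < Real.cos (θ - θ')) :
    EqOn (laplaceRay f θ) (laplaceRay f θ') (laplaceHalfPlane f θ ∩ laplaceHalfPlane f θ') := by
  set V : Set ℂ := {ξ | Real.exp A < (Complex.exp (θ * Complex.I) * ξ).re ∧
    Real.exp A < (Complex.exp (θ' * Complex.I) * ξ).re} with hV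
  have hc : ∀ θ : ℝ, Continuous fun ξ : ℂ => (Complex.exp (θ * Complex.I) * ξ).re := fun θ =>
    Complex.continuous_re.comp (continuous_const.mul continuous_id)
  have hVo : IsOpen V :=
    (isOpen_lt continuous_const (hc θ)).inter (isOpen_lt continuous_const (hc θ'))
  refine eqOn_of_convex_of_eqOn_open
    ((isOpen_laplaceHalfPlane f θ).inter (isOpen_laplaceHalfPlane f θ'))
    ((convex_laplaceHalfPlane f θ).inter (convex_laplaceHalfPlane f θ'))
    ((differentiableOn_laplaceRay hf.continuous θ).mono inter_subset_left)
    ((differentiableOn_laplaceRay hf.continuous θ').mono inter_subset_right) hVo ?_ ?_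
  · have hind : ∀ θ : ℝ, indicatorFun f θ ≤ (A : EReal) := fun θ =>
      indicatorFun_le_of_bound hC.le fun r hr => by
        have := h (r * Complex.exp (θ * Complex.I))
        rwa [norm_mul, Complex.norm_real, Complex.norm_exp_ofReal_mul_I, mul_one,
          Real.norm_of_nonneg hr.le] at this
    -- The point t(e^{-iθ} + e^{-iθ'}) has real part t(1 + cos(θ - θ')) = e^A + 1 in both
    -- directions.
    set t : ℝ := (Real.exp A + 1) / (1 + Real.cos (θ - θ')) with ht
    have hd : 0 < 1 + Real.cos (θ - θ') := by linarith
    have h1 : (Complex.exp (θ * Complex.I) * (t * Complex.exp (-(θ * Complex.I)) +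
        t * Complex.exp (-(θ' * Complex.I)))).re = Real.exp A + 1 := by
      rw [mul_add, Complex.add_re, exp_mul_I_mul_exp_neg', exp_mul_I_mul_exp_neg', sub_self,
        Real.cos_zero, ht]
      field_simp
    have h2 : (Complex.exp (θ' * Complex.I) * (t * Complex.exp (-(θ * Complex.I)) +
        t * Complex.exp (-(θ' * Complex.I)))).re = Real.exp A + 1 := by
      rw [mul_add, Complex.add_re, exp_mul_I_mul_exp_neg', exp_mul_I_mul_exp_neg', sub_self,
        Real.cos_zero, ← neg_sub θ θ', Real.cos_neg, ht]
      field_simp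
      ring
    have hA : A < Real.exp A + 1 := by linarith [Real.add_one_le_exp A]
    refine ⟨t * Complex.exp (-(θ * Complex.I)) + t * Complex.exp (-(θ' * Complex.I)), ⟨?_, ?_⟩,
      ?_, ?_⟩
    · exact (hind θ).trans_lt (by rw [h1]; exact_mod_cast hA)
    · exact (hind θ').trans_lt (by rw [h2]; exact_mod_cast hA)
    · rw [h1]; linarith
    · rw [h2]; linarith
  · intro ξ hξ
    exact (hasSum_laplaceRay hf hC h hξ.2.1).unique (hasSum_laplaceRay hf hC h hξ.2.2)

/-- For opposite rays the intersection may be a strip that avoids the region of convergence of the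
Borel series. A third, perpendicular ray has a half plane meeting the strip, and it is comparable
with both. -/
theorem laplaceRay_eqOn {C A : ℝ} (hC : 0 < C)
    (h : ∀ z, ‖f z‖ ≤ C * Real.exp (A * ‖z‖)) (θ θ' : ℝ) :
    EqOn (laplaceRay f θ) (laplaceRay f θ') (laplaceHalfPlane f θ ∩ laplaceHalfPlane f θ') := by
  rcases (Real.neg_one_le_cos (θ - θ')).lt_or_eq with hlt | heq
  · exact laplaceRay_eqOn_of_cos hf hC h hlt
  · set θ'' := θ + Real.pi / 2 with hθ''
    have hs : Real.sin (θ - θ') = 0 := by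
      have := Real.sin_sq_add_cos_sq (θ - θ')
      rw [← heq] at this
      have h0 : Real.sin (θ - θ') ^ 2 = 0 := by linarith
      exact pow_eq_zero_iff two_ne_zero |>.1 h0
    have c1 : Real.cos (θ - θ'') = 0 := by
      rw [hθ'', show θ - (θ + Real.pi / 2) = -(Real.pi / 2) by ring, Real.cos_neg,
        Real.cos_pi_div_two]
    have c2 : Real.cos (θ' - θ'') = 0 := by
      rw [hθ'', show θ' - (θ + Real.pi / 2) = -((θ - θ') + Real.pi / 2) by ring, Real.cos_neg,
        Real.cos_add_pi_div_two, hs, neg_zero]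
    intro ξ hξ
    have e1 := laplaceRay_eqOn_of_cos hf hC h (θ := θ) (θ' := θ'') (by rw [c1]; norm_num)
    have e2 := laplaceRay_eqOn_of_cos hf hC h (θ := θ') (θ' := θ'') (by rw [c2]; norm_num)
    refine eqOn_of_convex_of_eqOn_open (V := laplaceHalfPlane f θ'')
      ((isOpen_laplaceHalfPlane f θ).inter (isOpen_laplaceHalfPlane f θ'))
      ((convex_laplaceHalfPlane f θ).inter (convex_laplaceHalfPlane f θ'))
      ((differentiableOn_laplaceRay hf.continuous θ).mono inter_subset_left)
      ((differentiableOn_laplaceRay hf.continuous θ').mono inter_subset_right)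
      (isOpen_laplaceHalfPlane f θ'') ?_ ?_ hξ
    · have hind : indicatorFun f θ'' ≤ (A : EReal) :=
        indicatorFun_le_of_bound hC.le fun r hr => by
          have := h (r * Complex.exp (θ'' * Complex.I))
          rwa [norm_mul, Complex.norm_real, Complex.norm_exp_ofReal_mul_I, mul_one,
            Real.norm_of_nonneg hr.le] at this
      -- Moving ξ along e^{-iθ''} does not change its real parts in the directions θ and θ', and t
      -- is chosen to raise the one in direction θ'' to A + 1.
      set t : ℝ := A + 1 - (Complex.exp (θ'' * Complex.I) * ξ).re with ht
      refine ⟨ξ + t * Complex.exp (-(θ'' * Complex.I)), ⟨?_, ?_⟩, ?_⟩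
      · rw [laplaceHalfPlane, mem_ofPred_eq, mul_add, Complex.add_re, exp_mul_I_mul_exp_neg', c1,
          mul_zero, add_zero]
        exact hξ.1
      · rw [laplaceHalfPlane, mem_ofPred_eq, mul_add, Complex.add_re, exp_mul_I_mul_exp_neg', c2,
          mul_zero, add_zero]
        exact hξ.2
      · rw [laplaceHalfPlane, mem_ofPred_eq, mul_add, Complex.add_re, exp_mul_I_mul_exp_neg',
          sub_self, Real.cos_zero, mul_one, ht]
        refine hind.trans_lt ?_
        rw [EReal.coe_lt_coe_iff]
        linarith
    · intro w hw
      rw [e1 ⟨hw.1.1, hw.2⟩, e2 ⟨hw.1.2, hw.2⟩]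

/-- The Laplace integrals agree on overlaps, so they glue to a holomorphic function off the diagram.
-/
theorem exists_isBorelTransform (he : IsExponentialType f) : ∃ g, IsBorelTransform f g := by
  classical
  obtain ⟨C, A, hC, hA, h⟩ := he.exists_bound hf.continuous
  set g : ℂ → ℂ := fun ξ => if hξ : ∃ θ, ξ ∈ laplaceHalfPlane f θ then laplaceRay f hξ.choose ξ
    else 0 with hg
  have hgL : ∀ θ, EqOn g (laplaceRay f θ) (laplaceHalfPlane f θ) := fun θ ξ hξ => by
    have hex : ∃ θ, ξ ∈ laplaceHalfPlane f θ := ⟨θ, hξ⟩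
    simp only [hg, dif_pos hex]
    exact laplaceRay_eqOn hf hC h _ _ ⟨hex.choose_spec, hξ⟩
  refine ⟨g, ?_, ?_⟩
  · rw [compl_conjDiagram]
    intro ξ hξ
    obtain ⟨θ, hθ⟩ := mem_iUnion.1 hξ
    exact (((differentiableOn_laplaceRay hf.continuous θ).congr (hgL θ)).differentiableAt
      ((isOpen_laplaceHalfPlane f θ).mem_nhds hθ)).differentiableWithinAt
  · filter_upwards [(tendsto_norm_cobounded_atTop (E := ℂ)).eventually
      (eventually_gt_atTop (Real.exp A))] with ξ hξ
    -- The ray with argument -arg ξ is the one along which e^{-ξw} decays fastest; there the real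
    -- part in question is |ξ|.
    have h1 : Complex.exp ((-ξ.arg : ℝ) * Complex.I) * ξ = ‖ξ‖ := by
      conv_lhs => rw [← Complex.norm_mul_exp_arg_mul_I ξ]
      rw [mul_left_comm, Complex.ofReal_neg, ← Complex.exp_add, neg_mul]
      simp
    have h2 : Real.exp A < (Complex.exp ((-ξ.arg : ℝ) * Complex.I) * ξ).re := by
      rw [h1, Complex.ofReal_re]; exact hξ
    have h3 := hasSum_laplaceRay hf hC h h2
    rwa [← hgL (-ξ.arg) ?_] at h3
    have hind : indicatorFun f (-ξ.arg) ≤ (A : EReal) :=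
      indicatorFun_le_of_bound hC.le fun r hr => by
        have := h (r * Complex.exp ((-ξ.arg : ℝ) * Complex.I))
        rwa [norm_mul, Complex.norm_real, Complex.norm_exp_ofReal_mul_I, mul_one,
          Real.norm_of_nonneg hr.le] at this
    refine hind.trans_lt ?_
    rw [EReal.coe_lt_coe_iff]
    linarith [Real.add_one_le_exp A]

theorem isBorelTransform_borelTransform (he : IsExponentialType f) :
    IsBorelTransform f (borelTransform f) := by
  have h := exists_isBorelTransform hf he
  rw [borelTransform, dif_pos h]
  exact h.choose_spec

/-- `borelTransform` is an arbitrary choice among functions with the defining property. The identity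
theorem on each half plane, started from the Borel series, pins down its values off K(f). -/
theorem borelTransform_eqOn_laplaceRay (he : IsExponentialType f) (θ : ℝ) :
    EqOn (borelTransform f) (laplaceRay f θ) (laplaceHalfPlane f θ) := by
  obtain ⟨C, A, hC, hA, h⟩ := he.exists_bound hf.continuous
  obtain ⟨hd, hs⟩ := isBorelTransform_borelTransform hf he
  obtain ⟨R, hR⟩ := (Metric.hasBasis_cobounded_compl_closedBall (0 : ℂ)).eventually_iff.1 hs
  set V : Set ℂ := {ξ | max R (Real.exp A) < (Complex.exp (θ * Complex.I) * ξ).re} with hV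
  have hVo : IsOpen V := isOpen_lt continuous_const (by fun_prop)
  have hsub : laplaceHalfPlane f θ ⊆ (conjDiagram f)ᶜ := by
    rw [compl_conjDiagram]; exact subset_iUnion _ θ
  refine eqOn_of_convex_of_eqOn_open (isOpen_laplaceHalfPlane f θ) (convex_laplaceHalfPlane f θ)
    (hd.mono hsub) (differentiableOn_laplaceRay hf.continuous θ) hVo ?_ ?_
  · have hind : indicatorFun f θ ≤ (A : EReal) :=
      indicatorFun_le_of_bound hC.le fun r hr => by
        have := h (r * Complex.exp (θ * Complex.I))
        rwa [norm_mul, Complex.norm_real, Complex.norm_exp_ofReal_mul_I, mul_one,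
          Real.norm_of_nonneg hr.le] at this
    have h1 := exp_mul_I_mul_exp_neg θ ((max R (Real.exp A) + 1 : ℝ) : ℂ)
    refine ⟨((max R (Real.exp A) + 1 : ℝ) : ℂ) * Complex.exp (-(θ * Complex.I)), ?_, ?_⟩
    · rw [laplaceHalfPlane, mem_ofPred_eq, h1, Complex.ofReal_re]
      refine hind.trans_lt ?_
      rw [EReal.coe_lt_coe_iff]
      linarith [Real.add_one_le_exp A, le_max_right R (Real.exp A)]
    · rw [hV, mem_ofPred_eq, h1, Complex.ofReal_re]
      linarith
  · rintro ξ ⟨-, hξV⟩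
    have hξ : max R (Real.exp A) < (Complex.exp (θ * Complex.I) * ξ).re := hξV
    have h2 := (le_max_right _ _).trans_lt hξ
    refine HasSum.unique (hR.2 ?_) (hasSum_laplaceRay hf hC h h2)
    rw [mem_compl_iff, mem_closedBall_zero_iff, not_le]
    refine ((le_max_left _ _).trans_lt hξ).trans_le ((Complex.re_le_norm _).trans ?_)
    rw [norm_mul, Complex.norm_exp_ofReal_mul_I, one_mul]

end Borel

/-! ### Cauchy contours -/

/-- `I` is integration over a closed contour in `Ω \ S`, normalised to have index `1` about the
points of `K` and index `0` about the points outside `Ω`. -/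
structure IsCauchyContour (S : Set ℂ) (I : (ℂ → ℂ) → ℂ) (K Ω : Set ℂ) : Prop where
  closed : IsClosedContour S I
  subset : S ⊆ Ω \ K
  index_one : ∀ u ∈ K, I (fun ξ => (ξ - u)⁻¹) = 1
  index_zero : ∀ w ∉ Ω, I (fun ξ => (ξ - w)⁻¹) = 0

theorem IsClosedContour.smul {S : Set ℂ} {I : (ℂ → ℂ) → ℂ} (h : IsClosedContour S I) (c : ℂ) :
    IsClosedContour S (fun g => c * I g) := by
  obtain ⟨hS, ⟨X, mX, μ, u, v, hμ, hu, huS, hv, hI⟩, hp⟩ := h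
  refine ⟨hS, ⟨X, mX, μ, u, fun x => c * v x, hμ, hu, huS, hv.const_mul c, fun g hg => ?_⟩,
    fun G g hg hG => by simp only [hp G g hg hG, mul_zero]⟩
  simp only [hI g hg]
  rw [ ← integral_const_mul]
  simp only [mul_assoc]

theorem IsClosedContour.hasSum {S : Set ℂ} {I : (ℂ → ℂ) → ℂ} (h : IsClosedContour S I)
    {g : ℕ → ℂ → ℂ} {G : ℂ → ℂ} {b : ℕ → ℝ} (hg : ∀ n, ContinuousOn (g n) S)
    (hG : ContinuousOn G S) (hb : Summable b) (hgb : ∀ n, ∀ ξ ∈ S, ‖g n ξ‖ ≤ b n)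
    (hs : ∀ ξ ∈ S, HasSum (fun n => g n ξ) (G ξ)) : HasSum (fun n => I (g n)) (I G) := by
  obtain ⟨hS, ⟨X, mX, μ, u, v, hμ, hu, huS, hv, hI⟩, hp⟩ := h
  rw [hI G hG, funext fun n => hI (g n) (hg n)]
  have hm : ∀ n, Integrable (fun x => v x * g n (u x)) μ := fun n =>
    integrable_smul_comp_of_continuousOn hS hu huS hv (hg n)
  refine hasSum_integral_of_dominated_convergence (fun n x => ‖v x‖ * b n)
    (fun n => (hm n).aestronglyMeasurable) (fun n => Eventually.of_forall fun x => ?_)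
    (Eventually.of_forall fun x => hb.mul_left _) ?_
    (Eventually.of_forall fun x => (hs _ (huS x)).mul_left _)
  · rw [norm_mul]
    exact mul_le_mul_of_nonneg_left (hgb n _ (huS x)) (norm_nonneg _)
  · simp only [tsum_mul_left]
    exact hv.norm.mul_const _

namespace IsCauchyContour

variable {S S' K K' Ω Ω' : Set ℂ} {I J : (ℂ → ℂ) → ℂ}

theorem mono_left (h : IsCauchyContour S I K Ω) (hK : K' ⊆ K) : IsCauchyContour S I K' Ω :=
  ⟨h.closed, fun _ hz => ⟨(h.subset hz).1, fun hK' => (h.subset hz).2 (hK hK')⟩,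
    fun u hu => h.index_one u (hK hu), h.index_zero⟩

theorem mono_right (h : IsCauchyContour S I K Ω) (hΩ : Ω ⊆ Ω') : IsCauchyContour S I K Ω' :=
  ⟨h.closed, fun _ hz => ⟨hΩ (h.subset hz).1, (h.subset hz).2⟩, h.index_one,
    fun w hw => h.index_zero w fun hw' => hw (hΩ hw')⟩

/-- The difference of the two contours has index 1 - 1 = 0 about K and 0 outside Ω ∪ Ω', so Cauchy's
theorem applies on (Ω ∪ Ω') \ K. Different neighbourhoods are allowed for the two contours. -/
theorem integral_eq (h : IsCauchyContour S I K Ω) (h' : IsCauchyContour S' J K Ω')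
    (hK : IsClosed K) (hΩ : IsOpen Ω) (hΩ' : IsOpen Ω') {g : ℂ → ℂ}
    (hg : DifferentiableOn ℂ g ((Ω ∪ Ω') \ K)) : I g = J g := by
  have hc := h.closed.add_const_mul h'.closed (-1)
  have hU : IsOpen ((Ω ∪ Ω') \ K) := (hΩ.union hΩ').sdiff hK
  have h0 := hc.integral_eq_zero hU ?_ ?_ hg
  · linear_combination h0
  · rintro z (hz | hz)
    · exact ⟨Or.inl (h.subset hz).1, (h.subset hz).2⟩
    · exact ⟨Or.inr (h'.subset hz).1, (h'.subset hz).2⟩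
  · intro w hw
    by_cases hwK : w ∈ K
    · rw [h.index_one w hwK, h'.index_one w hwK]; ring
    · have : w ∉ Ω ∪ Ω' := fun h => hw ⟨h, hwK⟩
      rw [h.index_zero w fun h => this (Or.inl h), h'.index_zero w fun h => this (Or.inr h)]
      ring

/-- Cauchy's theorem. -/
theorem integral_eq_zero (h : IsCauchyContour S I K Ω) (hΩ : IsOpen Ω) {g : ℂ → ℂ}
    (hg : DifferentiableOn ℂ g Ω) : I g = 0 :=
  h.closed.integral_eq_zero hΩ (fun _ hz => (h.subset hz).1) h.index_zero hg

/-- Cauchy's integral formula. -/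
theorem integral_mul_inv_sub (h : IsCauchyContour S I K Ω) (hΩ : IsOpen Ω) {g : ℂ → ℂ}
    (hg : DifferentiableOn ℂ g Ω) {z : ℂ} (hz : z ∈ K) (hKΩ : K ⊆ Ω) :
    I (fun ξ => g ξ * (ξ - z)⁻¹) = g z := by
  rw [h.closed.integral_mul_inv_sub hΩ (fun _ hz => (h.subset hz).1) h.index_zero hg (hKΩ hz)
    fun hS => (h.subset hS).2 hz, h.index_one z hz, mul_one]

end IsCauchyContour

theorem IsCauchyCycle.isCauchyContour {Γ : PathCycle} {K Ω : Set ℂ} (h : IsCauchyCycle Γ K Ω) :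
    IsCauchyContour Γ.trace (fun g => (2 * Real.pi * Complex.I)⁻¹ * Γ.integral g) K Ω :=
  ⟨Γ.isClosedContour.smul _, h.trace_subset, h.index_one, h.index_zero⟩

theorem isCauchyContour_circle {c : ℂ} {R : ℝ} (hR : 0 ≤ R) {K : Set ℂ}
    (hK : K ⊆ Metric.ball c R) : IsCauchyContour (Metric.sphere c R)
      (fun g => (2 * Real.pi * Complex.I)⁻¹ * ∮ z in C(c, R), g z) K univ := by
  refine ⟨(isClosedContour_circleIntegral c hR).smul _, fun z hz => ⟨mem_univ _, fun hzK => ?_⟩,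
    fun u hu => ?_, fun w hw => absurd (mem_univ w) hw⟩
  · exact (Metric.mem_ball.1 (hK hzK)).ne (Metric.mem_sphere.1 hz)
  · dsimp only
    rw [circleIntegral.integral_sub_inv_of_mem_ball (hK hu), inv_mul_cancel₀ Complex.two_pi_I_ne_zero]

theorem Convex.isSimplyConnected {Ω : Set ℂ} (h : Convex ℝ Ω) (hn : Ω.Nonempty) :
    IsSimplyConnected Ω := by
  have := h.contractibleSpace hn
  exact (inferInstance : SimplyConnectedSpace Ω)

section Pairing

variable {K : Set ℂ} (hK : IsCompact K) (hKc : Convex ℝ K) (hKn : K.Nonempty)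
include hK hKc hKn

theorem exists_isGermCycle {E : ℂ → ℂ} {U : Set ℂ} (hU : IsOpen U) (hKU : K ⊆ U)
    (hE : DifferentiableOn ℂ E U) : ∃ Γ, IsGermCycle K E Γ := by
  obtain ⟨Ω, hΩ, hΩc, hKΩ, hΩU, Γ, hΓ⟩ := exists_convex_cauchyCycle hK hKc hKn hU hKU
  exact ⟨Γ, Ω, hΩ, hΩc.isSimplyConnected (hKn.mono hKΩ), hKΩ, hE.mono hΩU, hΓ⟩

theorem exists_isCauchyContour {U : Set ℂ} (hU : IsOpen U) (hKU : K ⊆ U) :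
    ∃ S I, IsCauchyContour S I K U := by
  obtain ⟨Ω, hΩ, hΩc, hKΩ, hΩU, Γ, hΓ⟩ := exists_convex_cauchyCycle hK hKc hKn hU hKU
  exact ⟨_, _, hΓ.isCauchyContour.mono_right hΩU⟩

/-- Contour integrals of `g F`, with `g` holomorphic off `K` and `F` holomorphic where `E` is, do
not depend on the Cauchy contour. -/
theorem germIntegral_eq {E F g : ℂ → ℂ} {Ω : Set ℂ} (hΩ : IsOpen Ω) (hKΩ : K ⊆ Ω)
    (hE : DifferentiableOn ℂ E Ω)
    (hF : ∀ V, DifferentiableOn ℂ E V → DifferentiableOn ℂ F V)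
    (hg : DifferentiableOn ℂ g Kᶜ) {S : Set ℂ} {I : (ℂ → ℂ) → ℂ} (h : IsCauchyContour S I K Ω) :
    germIntegral K E (fun ξ => g ξ * F ξ) = I (fun ξ => g ξ * F ξ) := by
  have hex := exists_isGermCycle hK hKc hKn hΩ hKΩ hE
  rw [germIntegral, dif_pos hex]
  obtain ⟨Ω', hΩ', -, hKΩ', hEΩ', hΓ⟩ := hex.choose_spec
  refine hΓ.isCauchyContour.integral_eq h hK.isClosed hΩ' hΩ ?_
  refine (hg.mono fun z hz => hz.2).fun_mul fun z hz => ?_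
  rcases hz.1 with hz | hz
  · exact ((hF _ hEΩ').differentiableAt (hΩ'.mem_nhds hz)).differentiableWithinAt
  · exact ((hF _ hE).differentiableAt (hΩ.mem_nhds hz)).differentiableWithinAt

end Pairing

/-! ### Growth and the Borel transform -/

theorem norm_le_of_growth_on_ray {K : Set ℂ} (hK : IsCompact K) (hKn : K.Nonempty) {f : ℂ → ℂ}
    {C ε : ℝ} (hC : 0 ≤ C) (h : ∀ z, ‖f z‖ ≤ C * Real.exp (supportFun K z + ε * ‖z‖)) (θ : ℝ)
    {r : ℝ} (hr : 0 ≤ r) : ‖f (r * Complex.exp (θ * Complex.I))‖ ≤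
      C * Real.exp ((supportFun K (Complex.exp (θ * Complex.I)) + ε) * r) := by
  refine (h _).trans (mul_le_mul_of_nonneg_left (Real.exp_le_exp.2 ?_) hC)
  have h1 := supportFun_ofReal_mul_le hK hKn hr (Complex.exp (θ * Complex.I))
  rw [norm_mul, Complex.norm_real, Complex.norm_exp_ofReal_mul_I, Real.norm_of_nonneg hr]
  linarith

section BorelGrowth

variable {K : Set ℂ} (hK : IsCompact K) (hKc : Convex ℝ K) (hKn : K.Nonempty)
include hK hKn

theorem borelTransform_eq_laplaceRay {f : ℂ → ℂ} (hf : Differentiable ℂ f) (h : HasGrowth K f)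
    {θ : ℝ} {ξ : ℂ}
    (hξ : supportFun K (Complex.exp (θ * Complex.I)) < (Complex.exp (θ * Complex.I) * ξ).re) :
    ξ ∈ laplaceHalfPlane f θ ∧ borelTransform f ξ = laplaceRay f θ ξ := by
  have hm : ξ ∈ laplaceHalfPlane f θ :=
    (h.indicatorFun_le hK hKn θ).trans_lt (EReal.coe_lt_coe_iff.2 hξ)
  exact ⟨hm, borelTransform_eqOn_laplaceRay hf (h.isExponentialType hK hKn) θ hm⟩

include hKc

theorem differentiableOn_borelTransform {f : ℂ → ℂ} (hf : Differentiable ℂ f)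
    (h : HasGrowth K f) : DifferentiableOn ℂ (borelTransform f) Kᶜ :=
  (isBorelTransform_borelTransform hf (h.isExponentialType hK hKn)).1.mono <|
    compl_subset_compl.2 <| conjDiagram_subset_of_indicatorFun_le hK hKc hKn
      (h.indicatorFun_le hK hKn)

/-- A single ray serves all three functions, since its half plane depends only on K; linearity is
then that of the Laplace integral. -/
theorem borelTransform_linear {f g h : ℂ → ℂ} (hf : Differentiable ℂ f) (hg : Differentiable ℂ g)
    (hh : Differentiable ℂ h) (hfK : HasGrowth K f) (hgK : HasGrowth K g) (hhK : HasGrowth K h)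
    {a b : ℂ} (hab : ∀ z, h z = a * f z + b * g z) {ξ : ℂ} (hξ : ξ ∉ K) :
    borelTransform h ξ = a * borelTransform f ξ + b * borelTransform g ξ := by
  obtain ⟨θ, hθ⟩ := supportFun_lt_of_notMem hK hKc hKn hξ
  obtain ⟨mf, ef⟩ := borelTransform_eq_laplaceRay hK hKn hf hfK hθ
  obtain ⟨mg, eg⟩ := borelTransform_eq_laplaceRay hK hKn hg hgK hθ
  rw [ef, eg, (borelTransform_eq_laplaceRay hK hKn hh hhK hθ).2, laplaceRay, laplaceRay,
    laplaceRay, ← integral_const_mul, ← integral_const_mul,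
    ← integral_add ((integrable_laplace_integrand hf.continuous mf).const_mul a)
      ((integrable_laplace_integrand hg.continuous mg).const_mul b)]
  congr 1
  ext r
  rw [hab]
  ring

/-- The Laplace integral along the ray normal to K nearest ξ decays at rate at least `infDist ξ K` -
ε. This bounds Bf on a contour by a norm of f, which is the source of all continuity statements. -/
theorem norm_borelTransform_le {f : ℂ → ℂ} (hf : Differentiable ℂ f) (hfK : HasGrowth K f)
    {C ε : ℝ} (hC : 0 ≤ C)
    (h : ∀ z, ‖f z‖ ≤ C * Real.exp (supportFun K z + ε * ‖z‖)) (hε : 0 < ε) {ξ : ℂ}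
    (hξ : ε < Metric.infDist ξ K) :
    ‖borelTransform f ξ‖ ≤ C / (Metric.infDist ξ K - ε) := by
  have hξK : ξ ∉ K := (hK.isClosed.notMem_iff_infDist_pos hKn).2 (hε.trans hξ)
  obtain ⟨θ, hθ⟩ := exists_supportFun_add_infDist_le hK hKc hKn hξK
  rw [(borelTransform_eq_laplaceRay hK hKn hf hfK (by linarith)).2]
  refine (norm_laplaceRay_le hC
    (fun r hr => norm_le_of_growth_on_ray hK hKn hC h θ hr) (by linarith)).trans ?_
  exact div_le_div_of_nonneg_left hC (by linarith) (by linarith)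

end BorelGrowth

/-- Polya's representation over a large circle. -/
theorem exists_circle_integral_borelTransform_mul_exp {f : ℂ → ℂ} (hf : Differentiable ℂ f)
    (he : IsExponentialType f) : ∃ R₀ : ℝ, ∀ R > R₀, ∀ z : ℂ,
      (2 * Real.pi * Complex.I)⁻¹ *
        (∮ ξ in C(0, R), borelTransform f ξ * Complex.exp (ξ * z)) = f z := by
  obtain ⟨C, A, hC, hA, hCA⟩ := he.exists_bound hf.continuous
  obtain ⟨hd, hs⟩ := isBorelTransform_borelTransform hf he
  obtain ⟨R₁, -, hR₁⟩ := (Metric.hasBasis_cobounded_compl_closedBall (0 : ℂ)).eventually_iff.1 hs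
  refine ⟨max R₁ (Real.exp A), fun R hR z => ?_⟩
  have hRA : Real.exp A < R := (le_max_right _ _).trans_lt hR
  have hR0 : 0 < R := (Real.exp_pos A).trans hRA
  have hsum : ∀ ξ ∈ Metric.sphere (0 : ℂ) R,
      HasSum (fun n : ℕ => iteratedDeriv n f 0 / ξ ^ (n + 1)) (borelTransform f ξ) := fun ξ hξ => by
    refine hR₁ ?_
    rw [mem_compl_iff, mem_closedBall_zero_iff, not_le, mem_sphere_zero_iff_norm.1 hξ]
    exact (le_max_left _ _).trans_lt hR
  have hne : ∀ ξ ∈ Metric.sphere (0 : ℂ) R, ξ ≠ 0 := fun ξ hξ h0 => by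
    rw [h0, mem_sphere_zero_iff_norm, norm_zero] at hξ
    exact hR0.ne hξ
  set b : ℕ → ℝ := fun n => C * Real.exp A ^ n / R ^ (n + 1) with hb
  have hbs : Summable b := by
    have : b = fun n => C / R * (Real.exp A / R) ^ n := by
      ext n; simp only [hb, div_pow, pow_succ]; field_simp
    rw [this]
    exact (summable_geometric_of_lt_one (by positivity) ((div_lt_one hR0).2 hRA)).mul_left _
  have hbn : ∀ n, ∀ ξ ∈ Metric.sphere (0 : ℂ) R, ‖iteratedDeriv n f 0 / ξ ^ (n + 1)‖ ≤ b n :=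
    fun n ξ hξ => by
      rw [norm_div, norm_pow, mem_sphere_zero_iff_norm.1 hξ]
      exact div_le_div_of_nonneg_right (norm_iteratedDeriv_zero_le hf hC hCA n) (by positivity)
  have hcn : ∀ n, ContinuousOn (fun ξ : ℂ => iteratedDeriv n f 0 / ξ ^ (n + 1))
      (Metric.sphere (0 : ℂ) R) := fun n =>
    continuousOn_const.div (continuousOn_id.pow _) fun ξ hξ => pow_ne_zero _ (hne ξ hξ)
  have hcB : ContinuousOn (borelTransform f) (Metric.sphere (0 : ℂ) R) := by
    refine ContinuousOn.congr (f := fun ξ => ∑' n, iteratedDeriv n f 0 / ξ ^ (n + 1))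
      (continuousOn_tsum hcn hbs hbn) fun ξ hξ => (hsum ξ hξ).tsum_eq.symm
  obtain ⟨M, hM⟩ := (isCompact_sphere (0 : ℂ) R).exists_bound_of_continuousOn
    (f := fun ξ : ℂ => Complex.exp (ξ * z)) (by fun_prop)
  have h1 := ((isClosedContour_circleIntegral 0 hR0.le).smul (2 * Real.pi * Complex.I)⁻¹).hasSum
    (g := fun n ξ => iteratedDeriv n f 0 / ξ ^ (n + 1) * Complex.exp (ξ * z))
    (G := fun ξ => borelTransform f ξ * Complex.exp (ξ * z)) (b := fun n => b n * M)
    (fun n => (hcn n).mul (by fun_prop)) (hcB.mul (by fun_prop)) (hbs.mul_right M)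
    (fun n ξ hξ => by
      rw [norm_mul]
      exact mul_le_mul (hbn n ξ hξ) (hM ξ hξ) (norm_nonneg _) ((norm_nonneg _).trans (hbn n ξ hξ)))
    (fun ξ hξ => (hsum ξ hξ).mul_right _)
  -- The n-th term of the Borel series integrates to f⁽ⁿ⁾(0) z^n / n!, by Cauchy's formula for the
  -- n-th derivative of e^{ξz} at 0; the sum is the Taylor series of f.
  refine h1.unique ?_
  have h2 := Complex.hasSum_taylorSeries_of_entire hf 0 z
  refine h2.congr_fun fun n => ?_
  have h3 := DiffContOnCl.circleIntegral_one_div_sub_center_pow_smul (c := 0) hR0 n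
    (f := fun ξ => Complex.exp (ξ * z))
    (Differentiable.diffContOnCl (by fun_prop))
  have h4 : iteratedDeriv n (fun ξ => Complex.exp (ξ * z)) 0 = z ^ n := by
    simp only [mul_comm _ z]
    rw [iteratedDeriv_cexp_const_mul]
    simp
  rw [h4] at h3
  have h5 : (∮ ξ in C(0, R), iteratedDeriv n f 0 / ξ ^ (n + 1) * Complex.exp (ξ * z)) =
      iteratedDeriv n f 0 * ∮ ξ in C(0, R), (1 / (ξ - 0) ^ (n + 1)) • Complex.exp (ξ * z) := by
    rw [← circleIntegral.integral_const_mul]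
    congr 1
    ext ξ
    simp only [sub_zero, smul_eq_mul]
    ring
  rw [h5, h3]
  have := Complex.two_pi_I_ne_zero
  simp only [sub_zero, smul_eq_mul]
  field_simp

/-! ### The pairing of `Exp(K)` and `H(K)` -/

/-- The pairing `(1 / 2πi) ∫ Bf(ξ) E(ξ) dξ` of `f` with the germ `E`. -/
noncomputable def pairing (K : Set ℂ) (f E : ℂ → ℂ) : ℂ :=
  germIntegral K E fun ξ => borelTransform f ξ * E ξ

section Pairing

variable {K : Set ℂ} (hK : IsCompact K) (hKc : Convex ℝ K) (hKn : K.Nonempty)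
include hK hKc hKn

theorem pairing_eq {f E : ℂ → ℂ} (hB : DifferentiableOn ℂ (borelTransform f) Kᶜ) {Ω : Set ℂ}
    (hΩ : IsOpen Ω) (hKΩ : K ⊆ Ω) (hE : DifferentiableOn ℂ E Ω) {S : Set ℂ} {I : (ℂ → ℂ) → ℂ}
    (h : IsCauchyContour S I K Ω) : pairing K f E = I (fun ξ => borelTransform f ξ * E ξ) :=
  germIntegral_eq hK hKc hKn hΩ hKΩ hE (fun _ hV => hV) hB h

/-- Since e^{ξz} is entire in ξ, the contour may be taken to be a large circle, on which Bf is given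
by its series. -/
theorem pairing_exp {f : ℂ → ℂ} (hf : Differentiable ℂ f) (he : IsExponentialType f)
    (hB : DifferentiableOn ℂ (borelTransform f) Kᶜ) (z : ℂ) :
    pairing K f (fun ξ => Complex.exp (ξ * z)) = f z := by
  obtain ⟨R₀, hR₀⟩ := exists_circle_integral_borelTransform_mul_exp hf he
  obtain ⟨R₁, hR₁⟩ := hK.isBounded.subset_ball 0
  set R := max (max R₀ R₁) 0 + 1 with hR
  have h0 : R₀ < R := by have := le_max_left R₀ R₁; have := le_max_left (max R₀ R₁) 0; linarith
  have h1 : R₁ ≤ R := by have := le_max_right R₀ R₁; have := le_max_left (max R₀ R₁) 0; linarith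
  have h2 : 0 ≤ R := by have := le_max_right (max R₀ R₁) 0; linarith
  rw [pairing_eq hK hKc hKn hB isOpen_univ (subset_univ K)
    (Differentiable.differentiableOn (by fun_prop))
    (isCauchyContour_circle h2 (hR₁.trans (Metric.ball_subset_ball h1)))]
  exact hR₀ R h0 z

omit hKc in
theorem exists_pos_lt_infDist {S : Set ℂ} (hS : IsCompact S) (hSK : S ⊆ Kᶜ) :
    ∃ δ > 0, ∀ ξ ∈ S, 2 * δ ≤ Metric.infDist ξ K := by
  rcases S.eq_empty_or_nonempty with rfl | hSn
  · exact ⟨1, one_pos, fun ξ hξ => absurd hξ (notMem_empty ξ)⟩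
  · obtain ⟨ξ₀, hξ₀, hmin⟩ := hS.exists_isMinOn hSn (Metric.continuous_infDist_pt K).continuousOn
    have hpos := (hK.isClosed.notMem_iff_infDist_pos hKn).1 (hSK hξ₀)
    exact ⟨Metric.infDist ξ₀ K / 2, by positivity, fun ξ hξ => by
      have : Metric.infDist ξ₀ K ≤ Metric.infDist ξ K := hmin hξ
      linarith⟩

end Pairing

theorem ExpSpace.differentiableOn_borelTransform {K : Set ℂ} (f : ExpSpace K) :
    DifferentiableOn ℂ (borelTransform f) Kᶜ :=
  (isBorelTransform_borelTransform f.entire f.expType).1.mono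
    (compl_subset_compl.2 f.diagram_subset)

/-- `f ↦ (1 / 2πi) ∫ Bf(ξ) A(ξ) e^{B(ξ) z} dξ`. -/
noncomputable def contourTransform (K : Set ℂ) (A B f : ℂ → ℂ) (z : ℂ) : ℂ :=
  pairing K f fun ξ => A ξ * Complex.exp (B ξ * z)

section Operator

variable {K L : Set ℂ} (hK : IsCompact K) (hKc : Convex ℝ K) (hKn : K.Nonempty)
  {A B : ℂ → ℂ} {U : Set ℂ} (hU : IsOpen U) (hKU : K ⊆ U) (hA : DifferentiableOn ℂ A U)
  (hB : DifferentiableOn ℂ B U)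

theorem differentiableOn_mul_exp_mul (hA : DifferentiableOn ℂ A U) (hB : DifferentiableOn ℂ B U)
    (z : ℂ) : DifferentiableOn ℂ (fun ξ => A ξ * Complex.exp (B ξ * z)) U :=
  hA.mul (hB.mul_const z).cexp

include hK hKc hKn hU hKU hA hB

theorem contourTransform_eq {f : ℂ → ℂ} (hf : DifferentiableOn ℂ (borelTransform f) Kᶜ)
    {S : Set ℂ} {I : (ℂ → ℂ) → ℂ} (h : IsCauchyContour S I K U) (z : ℂ) :
    contourTransform K A B f z =
      I (fun ξ => borelTransform f ξ * (A ξ * Complex.exp (B ξ * z))) :=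
  pairing_eq hK hKc hKn hf hU hKU (differentiableOn_mul_exp_mul hA hB z) h

theorem differentiable_contourTransform {f : ℂ → ℂ}
    (hf : DifferentiableOn ℂ (borelTransform f) Kᶜ) :
    Differentiable ℂ (contourTransform K A B f) := by
  obtain ⟨S, I, hI⟩ := exists_isCauchyContour hK hKc hKn hU hKU
  rw [← differentiableOn_univ,
    funext (contourTransform_eq hK hKc hKn hU hKU hA hB hf hI)]
  have hS : MapsTo (fun p : ℂ × ℂ => p.2) (univ ×ˢ S) S := fun p hp => hp.2
  have cf := (hf.continuousOn.mono fun z hz => (hI.subset hz).2).comp continuousOn_snd hS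
  have cA := (hA.continuousOn.mono fun z hz => (hI.subset hz).1).comp continuousOn_snd hS
  have cB := (hB.continuousOn.mono fun z hz => (hI.subset hz).1).comp continuousOn_snd hS
  refine hI.closed.differentiableOn isOpen_univ
    (g := fun z ξ => borelTransform f ξ * (A ξ * Complex.exp (B ξ * z))) ?_ ?_
  · exact cf.mul (cA.mul (cB.mul continuousOn_fst).cexp)
  · exact fun ξ _ => Differentiable.differentiableOn (by fun_prop)

theorem contourTransform_linear {f g h : ℂ → ℂ}
    (hf : Differentiable ℂ f) (hg : Differentiable ℂ g)
    (hh : Differentiable ℂ h) (hfK : HasGrowth K f) (hgK : HasGrowth K g) (hhK : HasGrowth K h)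
    {a b : ℂ} (hab : ∀ z, h z = a * f z + b * g z) (z : ℂ) :
    contourTransform K A B h z = a * contourTransform K A B f z + b * contourTransform K A B g z := by
  obtain ⟨S, I, hI⟩ := exists_isCauchyContour hK hKc hKn hU hKU
  have hS : S ⊆ Kᶜ := fun z hz => (hI.subset hz).2
  have df := _root_.differentiableOn_borelTransform hK hKc hKn hf hfK
  have dg := _root_.differentiableOn_borelTransform hK hKc hKn hg hgK
  have dh := _root_.differentiableOn_borelTransform hK hKc hKn hh hhK
  have cE := (differentiableOn_mul_exp_mul hA hB z).continuousOn.mono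
    fun z hz => (hI.subset hz).1
  rw [contourTransform_eq hK hKc hKn hU hKU hA hB df hI,
    contourTransform_eq hK hKc hKn hU hKU hA hB dg hI,
    contourTransform_eq hK hKc hKn hU hKU hA hB dh hI,
    ← hI.closed.linear a b ((df.continuousOn.mono hS).fun_mul cE)
      ((dg.continuousOn.mono hS).fun_mul cE)]
  refine hI.closed.congr ((dh.continuousOn.mono hS).fun_mul cE) fun ξ hξ => ?_
  rw [borelTransform_linear hK hKc hKn hf hg hh hfK hgK hhK hab (hS hξ)]
  ring

/-- The contour is fixed by ε alone and is then used for every f at once: it is so close to K that B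
maps it into the ε-thickening of L. The bound on Bf needs the growth defect η of f to be small
compared with the distance from the contour to K. -/
theorem exists_norm_contourTransform_le (hL : IsCompact L) (hBL : B '' K ⊆ L) {ε : ℝ}
    (hε : 0 < ε) : ∃ δ > 0, ∃ C, 0 ≤ C ∧ ∀ f : ℂ → ℂ, Differentiable ℂ f → HasGrowth K f →
      ∀ M η, 0 ≤ M → 0 < η → η ≤ δ → (∀ z, ‖f z‖ ≤ M * Real.exp (supportFun K z + η * ‖z‖)) →
        ∀ z, ‖contourTransform K A B f z‖ ≤ C * M * Real.exp (supportFun L z + ε * ‖z‖) := by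
  set U' := U ∩ B ⁻¹' Metric.thickening ε L with hU'
  have hU'o : IsOpen U' := hB.continuousOn.isOpen_inter_preimage hU Metric.isOpen_thickening
  have hKU' : K ⊆ U' := fun z hz => ⟨hKU hz,
    Metric.self_subset_thickening hε L (hBL (mem_image_of_mem B hz))⟩
  obtain ⟨S, I, hI⟩ := exists_isCauchyContour hK hKc hKn hU'o hKU'
  have hSK : S ⊆ Kᶜ := fun z hz => (hI.subset hz).2
  have hSU : S ⊆ U := fun z hz => (hI.subset hz).1.1
  -- The contour has distance at least 2δ from K, so η ≤ δ leaves a denominator of at least δ in the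
  -- bound for Bf.
  obtain ⟨δ, hδ, hδS⟩ := exists_pos_lt_infDist hK hKn hI.closed.isCompact hSK
  obtain ⟨C₀, hC₀, hI₀⟩ := hI.closed.norm_le
  obtain ⟨a, ha⟩ := hI.closed.isCompact.exists_bound_of_continuousOn (hA.continuousOn.mono hSU)
  refine ⟨δ, hδ, C₀ * (1 / δ * |a|), by positivity, fun f hf hfK M η hM hη hηδ hfM z => ?_⟩
  have df := _root_.differentiableOn_borelTransform hK hKc hKn hf hfK
  rw [contourTransform_eq hK hKc hKn hU'o hKU' (hA.mono inter_subset_left)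
    (hB.mono inter_subset_left) df hI]
  have := hI₀ (fun ξ => borelTransform f ξ * (A ξ * Complex.exp (B ξ * z)))
    (M / δ * (|a| * Real.exp (supportFun L z + ε * ‖z‖)))
    ((df.continuousOn.mono hSK).fun_mul
      ((differentiableOn_mul_exp_mul hA hB z).continuousOn.mono hSU)) fun ξ hξ => ?_
  · exact this.trans_eq (by ring)
  · have hd := hδS ξ hξ
    rw [norm_mul, norm_mul]
    refine mul_le_mul ?_ (mul_le_mul ((ha ξ hξ).trans (le_abs_self a)) ?_ (norm_nonneg _)
      (abs_nonneg a)) (by positivity) (by positivity)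
    · refine (norm_borelTransform_le hK hKc hKn hf hfK hM hfM hη (by linarith)).trans ?_
      exact div_le_div_of_nonneg_left hM hδ (by linarith)
    · rw [Complex.norm_exp, mul_comm]
      exact Real.exp_le_exp.2 (re_mul_le_supportFun_add hL (hI.subset hξ).1.2 z)

theorem HasGrowth.contourTransform (hL : IsCompact L) (hBL : B '' K ⊆ L) {f : ℂ → ℂ}
    (hf : Differentiable ℂ f) (hfK : HasGrowth K f) : HasGrowth L (contourTransform K A B f) := by
  intro ε hε
  obtain ⟨δ, hδ, C, hC, h⟩ :=
    exists_norm_contourTransform_le hK hKc hKn hU hKU hA hB hL hBL hε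
  obtain ⟨M, hM, hfM⟩ := hfK δ hδ
  exact ⟨C * M, by positivity, h f hf hfK M δ hM hδ le_rfl hfM⟩

end Operator

section Growth

variable {K : Set ℂ} (hK : IsCompact K) (hKc : Convex ℝ K) (hKn : K.Nonempty)
include hK hKc hKn

/-- The indicator condition bounds f ray by ray only. Uniformity in the direction comes from Pólya's
representation over a contour in the ε-thickening of K, where |e^{ξz}| ≤ exp(H_K(z) + ε|z|). -/
theorem ExpSpace.hasGrowth (f : ExpSpace K) : HasGrowth K f := by
  intro ε hε
  obtain ⟨S, I, hI⟩ := exists_isCauchyContour hK hKc hKn Metric.isOpen_thickening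
    (Metric.self_subset_thickening hε K)
  have hSK : S ⊆ Kᶜ := fun z hz => (hI.subset hz).2
  have df := f.differentiableOn_borelTransform
  obtain ⟨C₀, hC₀, hI₀⟩ := hI.closed.norm_le
  obtain ⟨a, ha⟩ := hI.closed.isCompact.exists_bound_of_continuousOn (df.continuousOn.mono hSK)
  refine ⟨C₀ * |a|, by positivity, fun z => ?_⟩
  rw [← pairing_exp hK hKc hKn f.entire f.expType df z,
    pairing_eq hK hKc hKn df Metric.isOpen_thickening (Metric.self_subset_thickening hε K)
      (Differentiable.differentiableOn (by fun_prop)) hI]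
  refine (hI₀ _ (|a| * Real.exp (supportFun K z + ε * ‖z‖)) ((df.continuousOn.mono hSK).fun_mul
    (by fun_prop)) fun ξ hξ => ?_).trans_eq (by ring)
  rw [norm_mul]
  refine mul_le_mul ((ha ξ hξ).trans (le_abs_self a)) ?_ (norm_nonneg _) (abs_nonneg a)
  rw [Complex.norm_exp, mul_comm]
  exact Real.exp_le_exp.2 (re_mul_le_supportFun_add hK (hI.subset hξ).1 z)

end Growth

/-! ### Norms on `Exp(K)` and continuous operators -/

theorem expNorm_le_iff {K : Set ℂ} {n : ℕ+} {f : ℂ → ℂ} {M : ℝ} (hM : 0 ≤ M) :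
    expNorm K n f ≤ ENNReal.ofReal M ↔
      ∀ z, ‖f z‖ ≤ M * Real.exp (supportFun K z + 1 / (n : ℝ) * ‖z‖) := by
  rw [expNorm, iSup_le_iff]
  refine forall_congr' fun z => ?_
  rw [← ofReal_norm, ← ENNReal.ofReal_mul (norm_nonneg _), ENNReal.ofReal_le_ofReal_iff hM,
    ← neg_add', Real.exp_neg, ← div_eq_mul_inv, div_le_iff₀ (Real.exp_pos _)]

theorem HasGrowth.expNorm_ne_top {K : Set ℂ} {f : ℂ → ℂ} (h : HasGrowth K f) (n : ℕ+) :
    expNorm K n f ≠ ⊤ := by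
  obtain ⟨C, hC, hf⟩ := h (1 / (n : ℝ)) (by positivity)
  exact (((expNorm_le_iff hC).2 hf).trans_lt ENNReal.ofReal_lt_top).ne

theorem HasGrowth.norm_le {K : Set ℂ} {f : ℂ → ℂ} (h : HasGrowth K f) (n : ℕ+) (z : ℂ) :
    ‖f z‖ ≤ (expNorm K n f).toReal * Real.exp (supportFun K z + 1 / (n : ℝ) * ‖z‖) :=
  (expNorm_le_iff ENNReal.toReal_nonneg).1
    (ENNReal.ofReal_toReal (h.expNorm_ne_top n)).ge z

theorem HasGrowth.linear {K : Set ℂ} {f g : ℂ → ℂ} (hf : HasGrowth K f) (hg : HasGrowth K g)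
    (a b : ℂ) : HasGrowth K fun z => a * f z + b * g z := by
  intro ε hε
  obtain ⟨C, hC, hfC⟩ := hf ε hε
  obtain ⟨D, hD, hgD⟩ := hg ε hε
  refine ⟨‖a‖ * C + ‖b‖ * D, by positivity, fun z => ?_⟩
  refine (norm_add_le _ _).trans ?_
  rw [norm_mul, norm_mul, add_mul, mul_assoc, mul_assoc]
  exact add_le_add (mul_le_mul_of_nonneg_left (hfC z) (norm_nonneg _))
    (mul_le_mul_of_nonneg_left (hgD z) (norm_nonneg _))

theorem continuous_of_forall_expNorm_le {K L : Set ℂ} {T : ExpSpace K → ExpSpace L}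
    (h : ∀ n : ℕ+, ∃ (m : ℕ+) (C : NNReal), ∀ f g : ExpSpace K,
      expNorm L n (fun z => T f z - T g z) ≤ C * expNorm K m (fun z => f z - g z)) :
    Continuous T := by
  refine continuous_iInf_rng.2 fun n => ?_
  obtain ⟨m, C, hC⟩ := h n
  refine continuous_iInf_dom (i := m) ?_
  exact @LipschitzWith.continuous _ _ (expDist K m) (expDist L n) C T hC

section Operator

variable {K L : Set ℂ} (hK : IsCompact K) (hKc : Convex ℝ K) (hKn : K.Nonempty)
  {A B : ℂ → ℂ} {U : Set ℂ} (hU : IsOpen U) (hKU : K ⊆ U) (hA : DifferentiableOn ℂ A U)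
  (hB : DifferentiableOn ℂ B U) (hL : IsCompact L) (hBL : B '' K ⊆ L)
include hK hKc hKn

theorem exists_expSpace_linear (a b : ℂ) (f g : ExpSpace K) :
    ∃ h : ExpSpace K, ∀ z, h z = a * f z + b * g z :=
  ⟨.ofGrowth hK hKc hKn (((f.entire.const_mul a).add (g.entire.const_mul b)))
    ((f.hasGrowth hK hKc hKn).linear (g.hasGrowth hK hKc hKn) a b), fun _ => rfl⟩

include hU hKU hA hB hL hBL

theorem exists_isContinuousOperator (hLc : Convex ℝ L) :
    ∃ T : ExpSpace K → ExpSpace L, (∀ f z, T f z = contourTransform K A B f z) ∧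
      IsContinuousOperator T := by
  have hLn : L.Nonempty := (hKn.image B).mono hBL
  set T : ExpSpace K → ExpSpace L := fun f => .ofGrowth hL hLc hLn
    (differentiable_contourTransform hK hKc hKn hU hKU hA hB f.differentiableOn_borelTransform)
    ((f.hasGrowth hK hKc hKn).contourTransform hK hKc hKn hU hKU hA hB hL hBL f.entire) with hT
  have hTf : ∀ (f : ExpSpace K) z, T f z = contourTransform K A B f z := fun _ _ => rfl
  have hlin : ∀ (a b : ℂ) (f g h : ExpSpace K), (∀ z, h z = a * f z + b * g z) →
      ∀ z, T h z = a * T f z + b * T g z := fun a b f g h hh z => by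
    rw [hTf, hTf, hTf]
    exact contourTransform_linear hK hKc hKn hU hKU hA hB f.entire g.entire h.entire
      (f.hasGrowth hK hKc hKn) (g.hasGrowth hK hKc hKn) (h.hasGrowth hK hKc hKn) hh z
  refine ⟨T, hTf, fun a b f g => ?_, continuous_of_forall_expNorm_le fun n => ?_⟩
  · obtain ⟨h, hh⟩ := exists_expSpace_linear hK hKc hKn a b f g
    exact ⟨h, hh, hlin a b f g h hh⟩
  · obtain ⟨δ, hδ, C, hC, hb⟩ := exists_norm_contourTransform_le hK hKc hKn hU hKU hA hB hL hBL
      (ε := 1 / (n : ℝ)) (by positivity)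
    -- The source norm has index m + 1 because the growth defect 1/(m + 1) must not exceed δ.
    obtain ⟨m, hm⟩ := exists_nat_one_div_lt hδ
    refine ⟨⟨m + 1, m.succ_pos⟩, ⟨C, hC⟩, fun f g => ?_⟩
    obtain ⟨h, hh⟩ := exists_expSpace_linear hK hKc hKn 1 (-1) f g
    have h1 : (fun z => f z - g z) = h := by ext z; rw [hh]; ring
    have h2 : (fun z => T f z - T g z) = T h := by
      ext z; rw [hlin 1 (-1) f g h hh]; ring
    rw [h1, h2]
    have hg := h.hasGrowth hK hKc hKn
    set m' : ℕ+ := ⟨m + 1, m.succ_pos⟩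
    have h3 : expNorm L n (T h) ≤ ENNReal.ofReal (C * (expNorm K m' h).toReal) :=
      (expNorm_le_iff (by positivity)).2
        (hb h h.entire hg _ (1 / (m' : ℝ)) ENNReal.toReal_nonneg (by positivity)
          (by simpa [m'] using hm.le) (hg.norm_le m'))
    refine h3.trans_eq ?_
    rw [ENNReal.ofReal_mul hC, ENNReal.ofReal_toReal (hg.expNorm_ne_top m')]
    congr 1
    exact ENNReal.ofReal_eq_coe_nnreal hC

/-- The pairing with a transform is the pairing with the composition. -/
theorem pairing_contourTransform (hLc : Convex ℝ L) {f : ℂ → ℂ} (hf : Differentiable ℂ f)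
    (hfK : HasGrowth K f) {E : ℂ → ℂ} {W : Set ℂ} (hW : IsOpen W) (hLW : L ⊆ W)
    (hE : DifferentiableOn ℂ E W) :
    pairing L (contourTransform K A B f) E = pairing K f (fun ξ => A ξ * E (B ξ)) := by
  have hLn : L.Nonempty := (hKn.image B).mono hBL
  have hg := differentiable_contourTransform hK hKc hKn hU hKU hA hB
    (_root_.differentiableOn_borelTransform hK hKc hKn hf hfK)
  have hgL := hfK.contourTransform hK hKc hKn hU hKU hA hB hL hBL hf
  have df := _root_.differentiableOn_borelTransform hK hKc hKn hf hfK
  have dg := _root_.differentiableOn_borelTransform hL hLc hLn hg hgL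
  -- The contour for L stays outside the closed ε-thickening of L, while B maps the contour for K
  -- into the ε/2-thickening. This keeps w - B(ξ) away from 0 and puts every B(ξ) inside the outer
  -- contour.
  obtain ⟨ε, hε, hεW⟩ := hL.exists_cthickening_subset_open hW hLW
  have hL' : IsCompact (Metric.cthickening ε L) := hL.cthickening
  obtain ⟨S', J, hJ⟩ := exists_isCauchyContour hL' (hLc.cthickening ε)
    (hLn.mono (Metric.self_subset_cthickening L)) hW hεW
  have hJL := hJ.mono_left (Metric.self_subset_cthickening (δ := ε) L)
  set U' := U ∩ B ⁻¹' Metric.thickening (ε / 2) L with hU'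
  have hU'o : IsOpen U' := hB.continuousOn.isOpen_inter_preimage hU Metric.isOpen_thickening
  have hKU' : K ⊆ U' := fun z hz => ⟨hKU hz,
    Metric.self_subset_thickening (half_pos hε) L (hBL (mem_image_of_mem B hz))⟩
  obtain ⟨S, I, hI⟩ := exists_isCauchyContour hK hKc hKn hU'o hKU'
  have hSK : S ⊆ Kᶜ := fun z hz => (hI.subset hz).2
  have hSU : S ⊆ U := fun z hz => (hI.subset hz).1.1
  have hSL : ∀ ξ ∈ S, B ξ ∈ Metric.thickening (ε / 2) L := fun ξ hξ => (hI.subset hξ).1.2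
  have hthick : Metric.thickening (ε / 2) L ⊆ Metric.cthickening ε L :=
    (Metric.thickening_mono (by linarith) L).trans (Metric.thickening_subset_cthickening ε L)
  have cf : ContinuousOn (borelTransform f) S := df.continuousOn.mono hSK
  have cA : ContinuousOn A S := hA.continuousOn.mono hSU
  have cB : ContinuousOn B S := hB.continuousOn.mono hSU
  have hne : ∀ w ∈ S', ∀ ξ ∈ S, w - B ξ ≠ 0 := fun w hw ξ hξ h0 =>
    (hJ.subset hw).2 (hthick (sub_eq_zero.1 h0 ▸ hSL ξ hξ))
  have hSL' : ∀ w ∈ S', ε < Metric.infDist w L := fun w hw => by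
    by_contra! hlt
    exact (hJ.subset hw).2 (Metric.mem_cthickening_of_dist_le w _ ε L
      (hL.exists_infDist_eq_dist hLn w).choose_spec.1
      ((hL.exists_infDist_eq_dist hLn w).choose_spec.2 ▸ hlt))
  -- The Borel transform of the image: the Laplace integral of e^{B(ξ)z} is 1/(w - B(ξ)), taken
  -- under the contour integral.
  have key : ∀ w ∈ S', borelTransform (contourTransform K A B f) w =
      I (fun ξ => borelTransform f ξ * A ξ * (w - B ξ)⁻¹) := by
    intro w hw
    have hwL : w ∉ L := fun h => (hJL.subset hw).2 h
    obtain ⟨θ, hθ⟩ := exists_supportFun_add_infDist_le hL hLc hLn hwL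
    have hd := hSL' w hw
    set e := Complex.exp (θ * Complex.I) with he
    have he1 : ‖e‖ = 1 := Complex.norm_exp_ofReal_mul_I θ
    -- The ray is normal to L towards w, so the gap is more than ε minus the ε/2 by which B(ξ) may
    -- leave L. It gives one exponential decay rate for all ξ on the contour, hence Fubini.
    have hre : ∀ ξ ∈ S, ε / 2 ≤ ((w - B ξ) * e).re := fun ξ hξ => by
      have h1 := re_mul_le_supportFun_add hL (hSL ξ hξ) e
      rw [he1] at h1
      rw [mul_comm, mul_sub, Complex.sub_re]
      linarith
    rw [(borelTransform_eq_laplaceRay hL hLn hg hgL (θ := θ) (by linarith)).2, laplaceRay]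
    obtain ⟨a, ha⟩ := hI.closed.isCompact.exists_bound_of_continuousOn (cf.mul cA)
    have hsnd : MapsTo (fun p : ℝ × ℂ => p.2) (univ ×ˢ S) S := fun p hp => hp.2
    set k : ℝ → ℂ → ℂ := fun r ξ =>
      borelTransform f ξ * A ξ * Complex.exp (-((w - B ξ) * e * r)) * e with hk
    have hkc : ContinuousOn (Function.uncurry k) (univ ×ˢ S) := by
      have c1 : ContinuousOn (fun p : ℝ × ℂ => borelTransform f p.2) (univ ×ˢ S) :=
        cf.comp continuousOn_snd hsnd
      have c2 : ContinuousOn (fun p : ℝ × ℂ => A p.2) (univ ×ˢ S) :=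
        cA.comp continuousOn_snd hsnd
      have c3 : ContinuousOn (fun p : ℝ × ℂ => B p.2) (univ ×ˢ S) :=
        cB.comp continuousOn_snd hsnd
      have c4 : ContinuousOn (fun p : ℝ × ℂ => ((p.1 : ℝ) : ℂ)) (univ ×ˢ S) :=
        (Complex.continuous_ofReal.comp continuous_fst).continuousOn
      exact ((c1.mul c2).mul ((((continuousOn_const.sub c3).mul continuousOn_const).mul
        c4).neg.cexp)).mul continuousOn_const
    have hsw := hI.closed.integral_swap (ν := volume.restrict (Ioi (0 : ℝ))) hkc
      (integrableOn_exp_neg_mul_Ioi (half_pos hε) a) (by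
        filter_upwards [ae_restrict_mem measurableSet_Ioi] with r hr ξ hξ
        rw [hk, norm_mul, norm_mul, he1, mul_one, Complex.norm_exp]
        refine mul_le_mul (ha ξ hξ) (Real.exp_le_exp.2 ?_) (Real.exp_pos _).le
          ((norm_nonneg _).trans (ha ξ hξ))
        rw [Complex.neg_re, Complex.re_mul_ofReal]
        exact neg_le_neg (mul_le_mul_of_nonneg_right (hre ξ hξ) (le_of_lt hr)))
    have h2 : I (fun ξ => ∫ r in Ioi (0 : ℝ), k r ξ) =
        I (fun ξ => borelTransform f ξ * A ξ * (w - B ξ)⁻¹) := by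
      refine (hI.closed.congr ((cf.fun_mul cA).fun_mul ((continuousOn_const.fun_sub cB).fun_inv₀
        (hne w hw))) fun ξ hξ => ?_).symm
      have h3 := integral_pow_mul_exp_neg_mul_Ioi 0 ((half_pos hε).trans_le (hre ξ hξ))
      simp only [pow_zero, one_mul, Nat.factorial_zero, Nat.cast_one, zero_add, pow_one] at h3
      simp only [hk]
      rw [integral_mul_const, integral_const_mul, h3]
      have he0 : e ≠ 0 := Complex.exp_ne_zero _
      have := hne w hw ξ hξ
      field_simp
    rw [← h2, ← hsw]
    congr 1
    ext r
    rw [contourTransform_eq hK hKc hKn hU'o hKU' (hA.mono inter_subset_left)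
      (hB.mono inter_subset_left) df hI, mul_assoc, mul_comm,
      ← hI.closed.const_mul]
    · congr 1
      ext ξ
      simp only [hk]
      have : Complex.exp (-((w - B ξ) * e * r)) =
          Complex.exp (B ξ * (r * e)) * Complex.exp (-(w * (r * e))) := by
        rw [← Complex.exp_add]; congr 1; ring
      rw [this]
      ring
    · exact cf.fun_mul ((differentiableOn_mul_exp_mul hA hB _).continuousOn.mono hSU)
  have cE : ContinuousOn E S' := hE.continuousOn.mono fun w hw => (hJ.subset hw).1
  have hEB : DifferentiableOn ℂ (fun ξ => A ξ * E (B ξ)) U' :=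
    (hA.mono inter_subset_left).fun_mul (hE.comp (hB.mono inter_subset_left)
      fun ξ hξ => hεW (hthick hξ.2))
  rw [pairing_eq hL hLc hLn dg hW hLW hE hJL, pairing_eq hK hKc hKn df hU'o hKU' hEB hI]
  have hkc : ContinuousOn (Function.uncurry fun w ξ : ℂ =>
      E w * (borelTransform f ξ * A ξ * (w - B ξ)⁻¹)) (S' ×ˢ S) := by
    have hsnd : MapsTo (fun p : ℂ × ℂ => p.2) (S' ×ˢ S) S := fun p hp => hp.2
    have hfst : MapsTo (fun p : ℂ × ℂ => p.1) (S' ×ˢ S) S' := fun p hp => hp.1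
    exact (cE.comp continuousOn_fst hfst).mul (((cf.comp continuousOn_snd hsnd).mul
      (cA.comp continuousOn_snd hsnd)).mul ((continuousOn_fst.sub
        (cB.comp continuousOn_snd hsnd)).inv₀ fun p hp => hne p.1 hp.1 p.2 hp.2))
  have h1 : J (fun w => borelTransform (contourTransform K A B f) w * E w) =
      J (fun w => I (fun ξ => E w * (borelTransform f ξ * A ξ * (w - B ξ)⁻¹))) := by
    refine hJ.closed.congr ((dg.continuousOn.mono fun w hw => (hJL.subset hw).2).fun_mul cE)
      fun w hw => ?_
    rw [hI.closed.const_mul, key w hw, mul_comm]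
    exact (cf.fun_mul cA).fun_mul ((continuousOn_const.fun_sub cB).fun_inv₀ (hne w hw))
  rw [h1, hJ.closed.contour_swap hI.closed hkc]
  refine (hI.closed.congr (cf.fun_mul (hEB.continuousOn.mono fun ξ hξ => (hI.subset hξ).1))
    fun ξ hξ => ?_).symm
  -- After the exchange of contours, the outer integral of E(w)/(w - B(ξ)) is E(B(ξ)) by Cauchy's
  -- formula.
  have h2 := hJ.integral_mul_inv_sub hW hE (hthick (hSL ξ hξ)) hεW
  have hinv : ContinuousOn (fun w => (w - B ξ)⁻¹) S' :=
    IsClosedContour.continuousOn_inv_sub fun h => (hJ.subset h).2 (hthick (hSL ξ hξ))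
  rw [← mul_assoc, ← h2, ← hJ.closed.const_mul _ (cE.fun_mul hinv)]
  congr 1
  ext w
  ring

end Operator

/-- By Carathéodory in real dimension 2, the hull is the continuous image of the compact product of
a 2-simplex and three copies of s. Fewer than three affinely independent points are padded by
repetition. -/
theorem isCompact_convexHull_complex {s : Set ℂ} (hs : IsCompact s) :
    IsCompact (convexHull ℝ s) := by
  have hT : IsCompact ((fun p : (Fin 3 → ℝ) × (Fin 3 → ℂ) => ∑ i, p.1 i • p.2 i) ''
      (stdSimplex ℝ (Fin 3) ×ˢ univ.pi fun _ => s)) :=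
    ((isCompact_stdSimplex ℝ (Fin 3)).prod (isCompact_univ_pi fun _ => hs)).image (by fun_prop)
  convert hT
  refine Subset.antisymm (fun x hx => ?_) ?_
  · rw [convexHull_eq_union] at hx
    simp only [mem_iUnion] at hx
    obtain ⟨t, hts, hta, hxt⟩ := hx
    have htn : t.Nonempty := by
      rw [← Finset.coe_nonempty, ← convexHull_nonempty_iff (𝕜 := ℝ)]
      exact ⟨x, hxt⟩
    have hcard : Fintype.card t ≤ Fintype.card (Fin 3) := by
      refine hta.card_le_finrank_succ.trans ?_
      have := Submodule.finrank_le (vectorSpan ℝ (range ((↑) : t → ℂ)))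
      rw [Complex.finrank_real_complex] at this
      rw [Fintype.card_fin]
      lia
    have : Nonempty t := htn.to_subtype
    obtain ⟨e⟩ := Function.Embedding.nonempty_of_card_le hcard
    set z : Fin 3 → ℂ := fun j => (Function.invFun e j : t) with hz
    have hrange : range z = t := by
      rw [hz]
      ext w
      constructor
      · rintro ⟨j, rfl⟩
        exact (Function.invFun e j).2
      · exact fun hw => ⟨e ⟨w, hw⟩, by simp [Function.leftInverse_invFun e.injective _]⟩
    have himg : Fintype.linearCombination ℝ z '' stdSimplex ℝ (Fin 3) = convexHull ℝ t := by
      rw [← convexHull_rangle_single_eq_stdSimplex, LinearMap.image_convexHull, ← range_comp, ← hrange]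
      congr 2
      ext j
      simp [Fintype.linearCombination_apply, Pi.single_apply]
    rw [← himg] at hxt
    obtain ⟨w, hw, rfl⟩ := hxt
    refine ⟨(w, z), ⟨hw, fun i _ => hts ?_⟩, by simp [Fintype.linearCombination_apply]⟩
    rw [← hrange]
    exact mem_range_self i
  · rintro _ ⟨⟨w, z⟩, ⟨hw, hz⟩, rfl⟩
    exact (convex_convexHull ℝ s).sum_mem (fun i _ => hw.1 i) hw.2
      fun i _ => subset_convexHull ℝ s (hz i (mem_univ i))

/-! ### Germs and the operators they define: differentiation and translation -/

section Pairing

variable {K : Set ℂ} (hK : IsCompact K) (hKc : Convex ℝ K) (hKn : K.Nonempty)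
include hK hKc hKn

/-- Only the germ matters: a contour can be chosen inside the neighbourhood on which the two
representatives agree. -/
theorem pairing_congr {f E F : ℂ → ℂ} (hf : DifferentiableOn ℂ (borelTransform f) Kᶜ)
    (hE : AnalyticOnNhd ℂ E K) (hF : AnalyticOnNhd ℂ F K) (hEF : ∀ᶠ ξ in 𝓝ˢ K, E ξ = F ξ) :
    pairing K f E = pairing K f F := by
  obtain ⟨V, hV, hKV, hVEF⟩ := mem_nhdsSet_iff_exists.1 hEF
  set U := V ∩ ({z | AnalyticAt ℂ E z} ∩ {z | AnalyticAt ℂ F z}) with hU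
  have hUo : IsOpen U := hV.inter ((isOpen_analyticAt ℂ E).inter (isOpen_analyticAt ℂ F))
  have hKU : K ⊆ U := fun z hz => ⟨hKV hz, hE z hz, hF z hz⟩
  have dE : DifferentiableOn ℂ E U := fun z hz => hz.2.1.differentiableAt.differentiableWithinAt
  have dF : DifferentiableOn ℂ F U := fun z hz => hz.2.2.differentiableAt.differentiableWithinAt
  obtain ⟨S, I, hI⟩ := exists_isCauchyContour hK hKc hKn hUo hKU
  rw [pairing_eq hK hKc hKn hf hUo hKU dE hI, pairing_eq hK hKc hKn hf hUo hKU dF hI]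
  refine hI.closed.congr ((hf.continuousOn.mono fun z hz => (hI.subset hz).2).fun_mul
    (dE.continuousOn.mono fun z hz => (hI.subset hz).1)) fun ξ hξ => ?_
  rw [show E ξ = F ξ from hVEF (hI.subset hξ).1.1]

omit hK hKc hKn in
theorem exists_isOpen_differentiableOn {E : ℂ → ℂ} (hE : AnalyticOnNhd ℂ E K) :
    ∃ U, IsOpen U ∧ K ⊆ U ∧ DifferentiableOn ℂ E U :=
  ⟨{z | AnalyticAt ℂ E z}, isOpen_analyticAt ℂ E, hE,
    fun _ hz => AnalyticAt.differentiableAt hz |>.differentiableWithinAt⟩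

theorem exists_isGermCycle_of_analyticOnNhd {E : ℂ → ℂ} (hE : AnalyticOnNhd ℂ E K) :
    ∃ Γ, IsGermCycle K E Γ := by
  obtain ⟨U, hU, hKU, hEU⟩ := exists_isOpen_differentiableOn hE
  exact exists_isGermCycle hK hKc hKn hU hKU hEU

theorem IsGermCycle.germIntegral_eq {φ F g : ℂ → ℂ} {Γ : PathCycle} (hΓ : IsGermCycle K φ Γ)
    (hF : ∀ V, DifferentiableOn ℂ φ V → DifferentiableOn ℂ F V)
    (hg : DifferentiableOn ℂ g Kᶜ) : germIntegral K φ (fun ξ => g ξ * F ξ) =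
      (2 * Real.pi * Complex.I)⁻¹ * Γ.integral (fun ξ => g ξ * F ξ) := by
  obtain ⟨Ω, hΩ, -, hKΩ, hφ, hΓ⟩ := hΓ
  exact _root_.germIntegral_eq hK hKc hKn hΩ hKΩ hφ hF hg hΓ.isCauchyContour

theorem germIntegral_eq_pairing {φ F f : ℂ → ℂ} (hφ : AnalyticOnNhd ℂ φ K)
    (hF : ∀ V, DifferentiableOn ℂ φ V → DifferentiableOn ℂ F V)
    (hf : DifferentiableOn ℂ (borelTransform f) Kᶜ) :
    germIntegral K φ (fun ξ => borelTransform f ξ * F ξ) = pairing K f F := by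
  obtain ⟨U, hU, hKU, hφU⟩ := exists_isOpen_differentiableOn hφ
  obtain ⟨S, I, hI⟩ := exists_isCauchyContour hK hKc hKn hU hKU
  rw [_root_.germIntegral_eq hK hKc hKn hU hKU hφU hF hf hI,
    pairing_eq hK hKc hKn hf hU hKU (hF _ hφU) hI]

theorem expTransform_eq_contourTransform {φ f : ℂ → ℂ} (hφ : AnalyticOnNhd ℂ φ K)
    (hf : DifferentiableOn ℂ (borelTransform f) Kᶜ) (z : ℂ) :
    expTransform K φ f z = contourTransform K (fun _ => 1) φ f z := by
  simp only [contourTransform, one_mul]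
  exact germIntegral_eq_pairing hK hKc hKn hφ (fun V hV => (hV.mul_const z).cexp) hf

theorem diffOp_eq_contourTransform {φ f : ℂ → ℂ} (hφ : AnalyticOnNhd ℂ φ K)
    (hf : DifferentiableOn ℂ (borelTransform f) Kᶜ) (z : ℂ) :
    diffOp K φ f z = contourTransform K φ (fun ξ => ξ) f z := by
  simp only [diffOp, contourTransform, mul_assoc]
  exact germIntegral_eq_pairing hK hKc hKn hφ
    (fun V hV => hV.mul (Differentiable.differentiableOn (by fun_prop))) hf

/-- The derivative is written as Cauchy's integral over a unit circle, so that differentiating under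
the contour integral becomes an exchange of two contours. -/
theorem contourTransform_id_eq_deriv {f : ℂ → ℂ} (hf : Differentiable ℂ f)
    (he : IsExponentialType f) (hB : DifferentiableOn ℂ (borelTransform f) Kᶜ) (z : ℂ) :
    contourTransform K (fun ξ => ξ) (fun ξ => ξ) f z = deriv f z := by
  obtain ⟨S, I, hI⟩ := exists_isCauchyContour hK hKc hKn isOpen_univ (subset_univ K)
  have cB : ContinuousOn (borelTransform f) S := hB.continuousOn.mono fun z hz => (hI.subset hz).2
  have hder : ∀ g : ℂ → ℂ, Differentiable ℂ g → (2 * Real.pi * Complex.I : ℂ)⁻¹ *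
      (∮ w in C(z, 1), ((w - z) ^ 2)⁻¹ * g w) = deriv g z := fun g hg => by
    have := Complex.two_pi_I_inv_smul_circleIntegral_sub_sq_inv_smul_of_differentiable
      isOpen_univ (subset_univ (Metric.closedBall z 1)) hg.differentiableOn
      (Metric.mem_ball_self one_pos)
    simpa only [smul_eq_mul] using this
  have hJ := (isClosedContour_circleIntegral z zero_le_one).smul (2 * Real.pi * Complex.I)⁻¹
  have hne : ∀ w ∈ Metric.sphere z 1, (w - z) ^ 2 ≠ 0 := fun w hw h0 => by
    rw [pow_eq_zero_iff two_ne_zero] at h0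
    rw [mem_sphere_iff_norm, h0, norm_zero] at hw
    exact zero_ne_one hw
  have hrep : ∀ w, f w = I (fun ξ => borelTransform f ξ * Complex.exp (ξ * w)) := fun w => by
    rw [← pairing_exp hK hKc hKn hf he hB w]
    exact pairing_eq hK hKc hKn hB isOpen_univ (subset_univ K)
      (Differentiable.differentiableOn (by fun_prop)) hI
  have hcont : ContinuousOn (Function.uncurry fun w ξ : ℂ =>
      ((w - z) ^ 2)⁻¹ * (borelTransform f ξ * Complex.exp (ξ * w))) (Metric.sphere z 1 ×ˢ S) := by
    have hsnd : MapsTo (fun p : ℂ × ℂ => p.2) (Metric.sphere z 1 ×ˢ S) S := fun p hp => hp.2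
    refine ContinuousOn.mul (ContinuousOn.inv₀ (Continuous.continuousOn (by fun_prop))
      fun p hp => hne p.1 hp.1) ((cB.comp continuousOn_snd hsnd).mul
        (Continuous.continuousOn (by fun_prop)))
  have h1 := hJ.contour_swap hI.closed hcont
  have hid : DifferentiableOn ℂ (fun ξ : ℂ => ξ) univ := differentiableOn_id
  rw [contourTransform_eq hK hKc hKn isOpen_univ (subset_univ K) hid hid hB hI, ← hder f hf]
  have h2 : (∮ w in C(z, 1), ((w - z) ^ 2)⁻¹ * f w) = ∮ w in C(z, 1),
      I (fun ξ => ((w - z) ^ 2)⁻¹ * (borelTransform f ξ * Complex.exp (ξ * w))) := by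
    congr 1
    ext w
    rw [hI.closed.const_mul _ (cB.fun_mul (by fun_prop)), ← hrep w]
  rw [h2, h1]
  refine hI.closed.congr (cB.fun_mul (by fun_prop)) fun ξ hξ => ?_
  have h3 := hder (fun w => borelTransform f ξ * Complex.exp (ξ * w)) (by fun_prop)
  rw [h3]
  have h4 : HasDerivAt (fun w => borelTransform f ξ * Complex.exp (ξ * w))
      (borelTransform f ξ * (Complex.exp (ξ * z) * (ξ * 1))) z :=
    (((hasDerivAt_id z).const_mul ξ).cexp).const_mul _
  rw [h4.deriv]
  ring

theorem contourTransform_exp_eq_translation {f : ℂ → ℂ} (hf : Differentiable ℂ f)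
    (he : IsExponentialType f) (hB : DifferentiableOn ℂ (borelTransform f) Kᶜ) (z : ℂ) :
    contourTransform K Complex.exp (fun ξ => ξ) f z = f (z + 1) := by
  rw [← pairing_exp hK hKc hKn hf he hB (z + 1), contourTransform]
  congr 1
  ext ξ
  rw [← Complex.exp_add]
  congr 1
  ring

end Pairing

/-! ### The indicator diagram of a transform -/

section Diagram

variable {K : Set ℂ} (hK : IsCompact K) (hKc : Convex ℝ K) (hKn : K.Nonempty)
include hK hKc hKn

theorem contourTransform_eq_zero {A B f : ℂ → ℂ} {U : Set ℂ} (hU : IsOpen U) (hKU : K ⊆ U)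
    (hA : DifferentiableOn ℂ A U) (hB : DifferentiableOn ℂ B U)
    (hf : Differentiable ℂ (borelTransform f)) : contourTransform K A B f = 0 := by
  obtain ⟨S, I, hI⟩ := exists_isCauchyContour hK hKc hKn hU hKU
  ext z
  rw [contourTransform_eq hK hKc hKn hU hKU hA hB hf.differentiableOn hI]
  exact hI.integral_eq_zero hU (hf.differentiableOn.fun_mul (differentiableOn_mul_exp_mul hA hB z))

/-- A Cauchy contour for K is also one for the smaller set K(f), and Bf is holomorphic off K(f). So
the transform may be computed relative to K(f), and the growth estimate then gives the hull of
B(K(f)). -/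
theorem conjDiagram_contourTransform_subset {A B : ℂ → ℂ} {U : Set ℂ} (hU : IsOpen U)
    (hKU : K ⊆ U) (hA : DifferentiableOn ℂ A U) (hB : DifferentiableOn ℂ B U) (f : ExpSpace K) :
    conjDiagram (contourTransform K A B f) ⊆ convexHull ℝ (B '' conjDiagram f) := by
  have hb := (isBorelTransform_borelTransform f.entire f.expType).1
  rcases (conjDiagram f).eq_empty_or_nonempty with h0 | hne
  · rw [h0, compl_empty, differentiableOn_univ] at hb
    rw [contourTransform_eq_zero hK hKc hKn hU hKU hA hB hb]
    -- If K(f) is empty then Bf is entire and the transform is 0. The diagram of 0 is empty because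
    -- it lies in both {0} and {1}.
    have hg : ∀ p : ℂ, HasGrowth {p} 0 := fun p ε hε => ⟨0, le_rfl, fun z => by simp⟩
    have hs : ∀ p : ℂ, conjDiagram 0 ⊆ {p} := fun p =>
      conjDiagram_subset_of_indicatorFun_le isCompact_singleton (convex_singleton p)
        (singleton_nonempty p) ((hg p).indicatorFun_le isCompact_singleton (singleton_nonempty p))
    intro u hu
    exact absurd ((hs 0 hu).symm.trans (hs 1 hu)) zero_ne_one
  · have hD : IsCompact (conjDiagram f) :=
      hK.of_isClosed_subset (isClosed_conjDiagram _) f.diagram_subset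
    have hDc := convex_conjDiagram f
    have hDU := f.diagram_subset.trans hKU
    obtain ⟨S, I, hI⟩ := exists_isCauchyContour hK hKc hKn hU hKU
    have heq : contourTransform K A B f = contourTransform (conjDiagram f) A B f := by
      ext z
      rw [contourTransform_eq hK hKc hKn hU hKU hA hB f.differentiableOn_borelTransform hI,
        contourTransform_eq hD hDc hne hU hDU hA hB hb (hI.mono_left f.diagram_subset)]
    have hL : IsCompact (convexHull ℝ (B '' conjDiagram f)) :=
      isCompact_convexHull_complex (hD.image_of_continuousOn (hB.continuousOn.mono hDU))
    have hgr := (ExpSpace.hasGrowth hD hDc hne ⟨f, f.entire, f.expType, subset_rfl⟩)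
    rw [heq]
    exact conjDiagram_subset_of_indicatorFun_le hL (convex_convexHull ℝ _)
      ((hne.image B).convexHull) ((hgr.contourTransform hD hDc hne hU hDU hA hB hL
        (subset_convexHull ℝ _) f.entire).indicatorFun_le hL ((hne.image B).convexHull))

end Diagram

/-! ### Exponential monomials -/

theorem isCauchyContour_circle_of_convex {c : ℂ} {R : ℝ} (hR : 0 ≤ R) {K Ω : Set ℂ}
    (hK : K ⊆ Metric.ball c R) (hΩ : IsOpen Ω) (hΩc : Convex ℝ Ω)
    (hcΩ : Metric.closedBall c R ⊆ Ω) : IsCauchyContour (Metric.sphere c R)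
      (fun g => (2 * Real.pi * Complex.I)⁻¹ * ∮ z in C(c, R), g z) K Ω := by
  have h := isCauchyContour_circle hR hK
  have hS := Metric.sphere_subset_closedBall.trans hcΩ
  exact ⟨h.closed, fun z hz => ⟨hS hz, (h.subset hz).2⟩, h.index_one,
    fun w hw => h.closed.index_eq_zero_of_convex hΩ hΩc hS hw⟩

theorem hasGrowth_pow_mul_exp {K : Set ℂ} (hK : IsCompact K) {l : ℂ} (hl : l ∈ K) (k : ℕ) :
    HasGrowth K fun z => z ^ k * Complex.exp (l * z) := by
  intro ε hε
  refine ⟨k.factorial / ε ^ k, by positivity, fun z => ?_⟩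
  rw [norm_mul, norm_pow, Complex.norm_exp, Real.exp_add, mul_comm (Real.exp _), ← mul_assoc]
  refine mul_le_mul ?_ (Real.exp_le_exp.2 ?_) (Real.exp_pos _).le (by positivity)
  · have := Real.pow_div_factorial_le_exp (ε * ‖z‖) (by positivity) k
    rw [div_le_iff₀ (by positivity), mul_pow] at this
    rw [div_mul_eq_mul_div, le_div_iff₀ (by positivity)]
    linarith
  · rw [mul_comm]
    exact re_mul_le_supportFun hK hl z

section Monomial

variable {K : Set ℂ} (hK : IsCompact K) (hKc : Convex ℝ K) (hKn : K.Nonempty)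
include hK hKc hKn

/-- The Laplace integral of the monomial along a separating ray is a Gamma integral in the variable
ξ - l. -/
theorem borelTransform_pow_mul_exp {l : ℂ} (hl : l ∈ K) (k : ℕ) {ξ : ℂ} (hξ : ξ ∉ K) :
    borelTransform (fun z => z ^ k * Complex.exp (l * z)) ξ = k.factorial / (ξ - l) ^ (k + 1) := by
  obtain ⟨θ, hθ⟩ := supportFun_lt_of_notMem hK hKc hKn hξ
  rw [(borelTransform_eq_laplaceRay hK hKn (by fun_prop) (hasGrowth_pow_mul_exp hK hl k) hθ).2,
    laplaceRay]
  set e := Complex.exp (θ * Complex.I) with he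
  have he0 : e ≠ 0 := Complex.exp_ne_zero _
  have hre : 0 < ((ξ - l) * e).re := by
    have h1 := re_mul_le_supportFun hK hl e
    rw [mul_comm, mul_sub, Complex.sub_re]
    linarith
  have h0 : ξ - l ≠ 0 := fun h => by rw [h] at hre; simp at hre
  have h := integral_pow_mul_exp_neg_mul_Ioi k hre
  have h2 : ∀ r : ℝ, (r * e) ^ k * Complex.exp (l * (r * e)) * Complex.exp (-(ξ * (r * e))) * e =
      e ^ (k + 1) * ((r : ℂ) ^ k * Complex.exp (-((ξ - l) * e * r))) := fun r => by
    rw [show -((ξ - l) * e * r) = l * (r * e) + -(ξ * (r * e)) by ring, Complex.exp_add]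
    ring
  simp only [h2]
  rw [integral_const_mul, h, mul_pow]
  field_simp

/-- The integrand has its only singularity at l, so the contour shrinks to a small circle about l
and Cauchy's formula for derivatives applies. -/
theorem pairing_pow_mul_exp {l : ℂ} (hl : l ∈ K) (k : ℕ) {F : ℂ → ℂ} {Ω : Set ℂ}
    (hΩ : IsOpen Ω) (hKΩ : K ⊆ Ω) (hF : DifferentiableOn ℂ F Ω) :
    pairing K (fun z => z ^ k * Complex.exp (l * z)) F = iteratedDeriv k F l := by
  obtain ⟨S, I, hI⟩ := exists_isCauchyContour hK hKc hKn hΩ hKΩ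
  have hgr := hasGrowth_pow_mul_exp hK hl k
  have hd := differentiableOn_borelTransform hK hKc hKn (by fun_prop) hgr
  rw [pairing_eq hK hKc hKn hd hΩ hKΩ hF hI]
  have hSK : S ⊆ Kᶜ := fun z hz => (hI.subset hz).2
  have hSΩ : S ⊆ Ω := fun z hz => (hI.subset hz).1
  rw [hI.closed.congr (g := fun ξ => k.factorial * (1 / (ξ - l) ^ (k + 1) * F ξ))
    ((hd.continuousOn.mono hSK).fun_mul (hF.continuousOn.mono hSΩ)) fun ξ hξ => by
      rw [borelTransform_pow_mul_exp hK hKc hKn hl k (hSK hξ)]; ring]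
  obtain ⟨R, hR, hRΩ⟩ := Metric.isOpen_iff.1 hΩ l (hKΩ hl)
  have hR2 : 0 < R / 2 := by positivity
  have hsub : Metric.closedBall l (R / 2) ⊆ Metric.ball l R :=
    Metric.closedBall_subset_ball (by linarith)
  have hC := isCauchyContour_circle_of_convex hR2.le (K := {l})
    (singleton_subset_iff.2 (Metric.mem_ball_self hR2)) Metric.isOpen_ball (convex_ball l R) hsub
  rw [(hI.mono_left (singleton_subset_iff.2 hl)).integral_eq hC isClosed_singleton hΩ
    Metric.isOpen_ball]
  · have h := (hF.mono (((Metric.closure_ball_subset_closedBall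
      (x := l) (ε := R / 2)).trans hsub).trans hRΩ)).diffContOnCl.circleIntegral_one_div_sub_center_pow_smul hR2 k
    simp only [smul_eq_mul] at h
    rw [circleIntegral.integral_const_mul, h]
    have := Complex.two_pi_I_ne_zero
    have := Nat.factorial_ne_zero k
    field_simp
  · rw [union_eq_left.2 hRΩ]
    refine (DifferentiableOn.fun_mul ?_ (hF.mono sdiff_subset)).const_mul _
    refine (differentiableOn_const _).fun_div (by fun_prop) fun ξ hξ => pow_ne_zero _ ?_
    exact sub_ne_zero.2 fun h => hξ.2 h

/-- The exponential monomials are total: a germ annihilating them vanishes. -/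
theorem eventually_eq_zero_of_pairing_eq_zero {l : ℂ} (hl : l ∈ K) {F : ℂ → ℂ} {Ω : Set ℂ}
    (hΩ : IsOpen Ω) (hKΩ : K ⊆ Ω) (hF : DifferentiableOn ℂ F Ω)
    (h : ∀ f : ExpSpace K, pairing K f F = 0) : ∀ᶠ z in 𝓝 l, F z = 0 := by
  have h0 : ∀ k, iteratedDeriv k F l = 0 := fun k => by
    rw [← pairing_pow_mul_exp hK hKc hKn hl k hΩ hKΩ hF]
    exact h (.ofGrowth hK hKc hKn (f := fun z => z ^ k * Complex.exp (l * z)) (by fun_prop)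
      (hasGrowth_pow_mul_exp hK hl k))
  obtain ⟨R, hR, hRΩ⟩ := Metric.isOpen_iff.1 hΩ l (hKΩ hl)
  filter_upwards [Metric.ball_mem_nhds l hR] with z hz
  have := Complex.hasSum_taylorSeries_on_ball (hF.mono hRΩ) hz
  simp only [h0, smul_zero] at this
  exact this.unique hasSum_zero

end Monomial

/-! ### Weighted spaces of continuous functions -/

open scoped BoundedContinuousFunction

/-- Continuous functions of growth at most `exp (H_L(z) + ε |z|)`. -/
def IsWeightBounded (L : Set ℂ) (ε : ℝ) (h : ℂ → ℂ) : Prop :=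
  Continuous h ∧ ∃ C, ∀ z, ‖h z‖ ≤ C * Real.exp (supportFun L z + ε * ‖z‖)

theorem norm_mul_weight_le_iff {a : ℂ} {x C : ℝ} :
    ‖a * (Real.exp (-x) : ℂ)‖ ≤ C ↔ ‖a‖ ≤ C * Real.exp x := by
  rw [norm_mul, Complex.norm_real, Real.norm_of_nonneg (Real.exp_pos _).le, Real.exp_neg,
    ← div_eq_mul_inv, div_le_iff₀ (Real.exp_pos _)]

open scoped Classical in
/-- The bounded continuous function `z ↦ h(z) exp (- H_L(z) - ε |z|)`. -/
noncomputable def weightedFun (L : Set ℂ) (ε : ℝ) (h : ℂ → ℂ) : ℂ →ᵇ ℂ :=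
  if hh : Continuous (fun z => h z * (Real.exp (-(supportFun L z + ε * ‖z‖)) : ℂ)) ∧
      ∃ C, ∀ z, ‖h z * (Real.exp (-(supportFun L z + ε * ‖z‖)) : ℂ)‖ ≤ C then
    BoundedContinuousFunction.ofNormedAddCommGroup _ hh.1 hh.2.choose hh.2.choose_spec
  else 0

section Weighted

variable {L : Set ℂ} (hL : IsCompact L) (hLn : L.Nonempty) {ε : ℝ}
include hL hLn

theorem weightedFun_apply {h : ℂ → ℂ} (hh : IsWeightBounded L ε h) (z : ℂ) :
    weightedFun L ε h z = h z * (Real.exp (-(supportFun L z + ε * ‖z‖)) : ℂ) := by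
  have hc : Continuous (fun z => h z * (Real.exp (-(supportFun L z + ε * ‖z‖)) : ℂ)) ∧
      ∃ C, ∀ z, ‖h z * (Real.exp (-(supportFun L z + ε * ‖z‖)) : ℂ)‖ ≤ C := by
    refine ⟨hh.1.mul ?_, hh.2.imp fun C hC z => norm_mul_weight_le_iff.2 (hC z)⟩
    have := continuous_supportFun hL hLn
    exact Complex.continuous_ofReal.comp (Real.continuous_exp.comp
      (this.add (continuous_const.mul continuous_norm)).neg)
  rw [weightedFun, dif_pos hc]
  rfl

omit hL hLn in
theorem HasGrowth.isWeightBounded {h : ℂ → ℂ} (hc : Continuous h) (hh : HasGrowth L h)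
    (hε : 0 < ε) : IsWeightBounded L ε h :=
  ⟨hc, (hh ε hε).imp fun _ hC => hC.2⟩

omit hLn in
-- Since ξ lies in the open thickening there is a gap ε - δ in the exponent. Half of it absorbs the
-- power of z; the other half is kept as the factor exp(η|z|), which later makes room for perturbing
-- ξ.
theorem isWeightBounded_pow_mul_exp (k : ℕ) {ξ : ℂ} (hξ : ξ ∈ Metric.thickening ε L) :
    ∃ η > 0, ∃ C, 0 ≤ C ∧ ∀ z : ℂ, ‖z ^ k * Complex.exp (ξ * z)‖ * Real.exp (η * ‖z‖) ≤
      C * Real.exp (supportFun L z + ε * ‖z‖) := by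
  obtain ⟨u, hu, hd⟩ := Metric.mem_thickening_iff.1 hξ
  obtain ⟨δ, hδ1, hδ2⟩ := exists_between hd
  set η := (ε - δ) / 2 with hη
  have hη0 : 0 < η := by rw [hη]; linarith
  have hξδ : ξ ∈ Metric.thickening δ L := Metric.mem_thickening_iff.2 ⟨u, hu, hδ1⟩
  refine ⟨η, hη0, k.factorial / η ^ k, by positivity, fun z => ?_⟩
  have h1 : ‖z‖ ^ k ≤ k.factorial / η ^ k * Real.exp (η * ‖z‖) := by
    have := Real.pow_div_factorial_le_exp (η * ‖z‖) (by positivity) k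
    rw [div_le_iff₀ (by positivity), mul_pow] at this
    rw [div_mul_eq_mul_div, le_div_iff₀ (by positivity)]
    linarith
  have h2 := re_mul_le_supportFun_add hL hξδ z
  rw [mul_comm] at h2
  rw [norm_mul, norm_pow, Complex.norm_exp]
  calc ‖z‖ ^ k * Real.exp (ξ * z).re * Real.exp (η * ‖z‖)
      ≤ k.factorial / η ^ k * Real.exp (η * ‖z‖) * Real.exp (supportFun L z + δ * ‖z‖) *
          Real.exp (η * ‖z‖) := by
        refine mul_le_mul_of_nonneg_right (mul_le_mul h1 (Real.exp_le_exp.2 h2)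
          (Real.exp_pos _).le (by positivity)) (Real.exp_pos _).le
    _ = k.factorial / η ^ k * Real.exp (supportFun L z + ε * ‖z‖) := by
        rw [mul_assoc, mul_assoc, ← Real.exp_add, ← Real.exp_add]
        congr 2
        rw [hη]
        ring

omit hLn in
theorem isWeightBounded_exp (k : ℕ) {ξ : ℂ} (hξ : ξ ∈ Metric.thickening ε L) :
    IsWeightBounded L ε fun z => z ^ k * Complex.exp (ξ * z) := by
  obtain ⟨η, hη, C, hC, h⟩ := isWeightBounded_pow_mul_exp hL k hξ
  refine ⟨by fun_prop, C, fun z => le_trans ?_ (h z)⟩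
  exact le_mul_of_one_le_right (norm_nonneg _) (Real.one_le_exp (by positivity))

/-- The map ξ ↦ e^{ξ·} is holomorphic into the weighted sup-norm space: the second-order remainder
of the exponential is at most |(w - ξ)z|² exp(|w - ξ||z|), and the spare factor exp(η|z|) absorbs
its growth uniformly in z. The powers z^0 and z^1 let one bound serve both the function and its
derivative. -/
theorem hasDerivAt_weightedFun_exp {ξ : ℂ} (hξ : ξ ∈ Metric.thickening ε L) :
    HasDerivAt (fun ξ => weightedFun L ε fun z => z ^ 0 * Complex.exp (ξ * z))
      (weightedFun L ε fun z => z ^ 1 * Complex.exp (ξ * z)) ξ := by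
  obtain ⟨η, hη, C, hC, h⟩ := isWeightBounded_pow_mul_exp hL 2 hξ
  rw [hasDerivAt_iff_isLittleO]
  have hO : (fun w => weightedFun L ε (fun z => z ^ 0 * Complex.exp (w * z)) -
      weightedFun L ε (fun z => z ^ 0 * Complex.exp (ξ * z)) -
        (w - ξ) • weightedFun L ε (fun z => z ^ 1 * Complex.exp (ξ * z))) =O[𝓝 ξ]
      fun w => (w - ξ) ^ 2 := by
    refine Asymptotics.IsBigO.of_bound C ?_
    filter_upwards [Metric.isOpen_thickening.mem_nhds hξ, Metric.ball_mem_nhds ξ hη] with w hw hwη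
    rw [mem_ball_iff_norm] at hwη
    refine (BoundedContinuousFunction.norm_le (by positivity)).2 fun z => ?_
    have heq : (weightedFun L ε (fun z => z ^ 0 * Complex.exp (w * z)) -
        weightedFun L ε (fun z => z ^ 0 * Complex.exp (ξ * z)) -
        (w - ξ) • weightedFun L ε (fun z => z ^ 1 * Complex.exp (ξ * z))) z =
        Complex.exp (ξ * z) * (Complex.exp ((w - ξ) * z) -
          ∑ m ∈ Finset.range 2, ((w - ξ) * z) ^ m / m.factorial) *
            (Real.exp (-(supportFun L z + ε * ‖z‖)) : ℂ) := by
      simp only [BoundedContinuousFunction.sub_apply, BoundedContinuousFunction.smul_apply]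
      rw [weightedFun_apply hL hLn (isWeightBounded_exp hL 0 hw),
        weightedFun_apply hL hLn (isWeightBounded_exp hL 0 hξ),
        weightedFun_apply hL hLn (isWeightBounded_exp hL 1 hξ),
        show w * z = ξ * z + (w - ξ) * z by ring, Complex.exp_add]
      simp [Finset.sum_range_succ]
      ring
    rw [heq, norm_mul_weight_le_iff, norm_mul]
    have h1 := Complex.norm_exp_sub_sum_le_norm_mul_exp ((w - ξ) * z) 2
    have h2 : Real.exp ‖(w - ξ) * z‖ ≤ Real.exp (η * ‖z‖) := by
      rw [norm_mul]
      exact Real.exp_le_exp.2 (mul_le_mul_of_nonneg_right hwη.le (norm_nonneg z))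
    have h3 := h z
    rw [norm_mul, norm_pow] at h3
    calc ‖Complex.exp (ξ * z)‖ * ‖Complex.exp ((w - ξ) * z) -
          ∑ m ∈ Finset.range 2, ((w - ξ) * z) ^ m / m.factorial‖
        ≤ ‖Complex.exp (ξ * z)‖ * (‖(w - ξ) * z‖ ^ 2 * Real.exp (η * ‖z‖)) :=
          mul_le_mul_of_nonneg_left (h1.trans (mul_le_mul_of_nonneg_left h2 (by positivity)))
            (norm_nonneg _)
      _ = ‖(w - ξ) ^ 2‖ * (‖z‖ ^ 2 * ‖Complex.exp (ξ * z)‖ * Real.exp (η * ‖z‖)) := by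
          rw [norm_mul, mul_pow, norm_pow]; ring
      _ ≤ ‖(w - ξ) ^ 2‖ * (C * Real.exp (supportFun L z + ε * ‖z‖)) :=
          mul_le_mul_of_nonneg_left h3 (norm_nonneg _)
      _ = C * ‖(w - ξ) ^ 2‖ * Real.exp (supportFun L z + ε * ‖z‖) := by ring
  refine hO.trans_isLittleO ?_
  have := (Asymptotics.isLittleO_pow_pow (𝕜 := ℂ) (one_lt_two)).comp_tendsto
    (tendsto_sub_nhds_zero_iff.2 (tendsto_id (x := 𝓝 ξ)))
  simpa [Function.comp_def] using this

/-- A continuous functional on the weighted space acts on `Exp(L)` as the pairing with a germ. -/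
theorem exists_differentiableOn_forall_eq_pairing (hLc : Convex ℝ L) (hε : 0 < ε)
    (l : (ℂ →ᵇ ℂ) →L[ℂ] ℂ) : ∃ E : ℂ → ℂ, DifferentiableOn ℂ E (Metric.thickening ε L) ∧
      ∀ g : ExpSpace L, l (weightedFun L ε g) = pairing L g E := by
  set e : ℂ → (ℂ →ᵇ ℂ) := fun ξ => weightedFun L ε fun z => z ^ 0 * Complex.exp (ξ * z) with he
  have hd : DifferentiableOn ℂ e (Metric.thickening ε L) := fun ξ hξ =>
    (hasDerivAt_weightedFun_exp hL hLn hξ).differentiableAt.differentiableWithinAt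
  have hE : DifferentiableOn ℂ (fun ξ => l (e ξ)) (Metric.thickening ε L) :=
    l.differentiable.comp_differentiableOn hd
  refine ⟨fun ξ => l (e ξ), hE, fun g => ?_⟩
  have hLW := Metric.self_subset_thickening hε L
  obtain ⟨S, I, hI⟩ := exists_isCauchyContour hL hLc hLn Metric.isOpen_thickening hLW
  have dg := g.differentiableOn_borelTransform
  have cg : ContinuousOn (borelTransform g) S := dg.continuousOn.mono fun z hz => (hI.subset hz).2
  have ce : ContinuousOn e S := hd.continuousOn.mono fun z hz => (hI.subset hz).1
  -- Pólya's representation holds in the weighted space: the vector-valued integral y of Bg(ξ)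
  -- e^{ξ·} is g, checked by evaluating at points, and l passes under the integral.
  obtain ⟨y, hy⟩ := hI.closed.exists_vector_integral (G := fun ξ => borelTransform g ξ • e ξ)
    (cg.smul ce)
  have hyg : y = weightedFun L ε g := by
    ext z
    have h1 := hy (BoundedContinuousFunction.evalCLM ℂ z)
    rw [BoundedContinuousFunction.evalCLM_apply] at h1
    rw [h1, weightedFun_apply hL hLn
      ((g.hasGrowth hL hLc hLn).isWeightBounded g.entire.continuous hε),
      ← pairing_exp hL hLc hLn g.entire g.expType dg z,
      pairing_eq hL hLc hLn dg Metric.isOpen_thickening hLW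
        (Differentiable.differentiableOn (by fun_prop)) hI, mul_comm,
      ← hI.closed.const_mul _ (cg.fun_mul (by fun_prop))]
    refine (hI.closed.congr (continuousOn_const.fun_mul (cg.fun_mul (by fun_prop)))
      fun ξ hξ => ?_).symm
    simp only [BoundedContinuousFunction.evalCLM_apply, BoundedContinuousFunction.smul_apply, he,
      smul_eq_mul]
    rw [weightedFun_apply hL hLn (isWeightBounded_exp hL 0 (hI.subset hξ).1)]
    ring
  rw [← hyg, hy, pairing_eq hL hLc hLn dg Metric.isOpen_thickening hLW hE hI]
  congr 1
  ext ξ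
  rw [map_smul, smul_eq_mul]

end Weighted


/-! ### Density of the range -/

/-- The open mapping theorem at l; local constancy at a single point would spread over a connected
thickening of K and make the whole germ constant. -/
theorem nhds_le_map_nhds_of_not_isConstantGerm {K : Set ℂ} (hK : IsCompact K)
    (hKc : Convex ℝ K) {B : ℂ → ℂ} (hB : AnalyticOnNhd ℂ B K) (hnc : ¬ IsConstantGerm K B) {l : ℂ}
    (hl : l ∈ K) : 𝓝 (B l) ≤ map B (𝓝 l) := by
  refine (hB l hl).eventually_constant_or_nhds_le_map_nhds.resolve_left fun hc => hnc ?_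
  obtain ⟨δ, hδ, hδU⟩ := hK.exists_thickening_subset_open (isOpen_analyticAt ℂ B) hB
  have hKδ := Metric.self_subset_thickening hδ K
  have han : AnalyticOnNhd ℂ B (Metric.thickening δ K) := fun z hz => hδU hz
  have heq := han.eqOn_of_preconnected_of_eventuallyEq (g := fun _ => B l)
    (fun z _ => analyticAt_const) (hKc.thickening δ).isPreconnected (hKδ hl) hc
  exact ⟨B l, mem_nhdsSet_iff_exists.2 ⟨_, Metric.isOpen_thickening, hKδ, heq⟩⟩

theorem expNorm_mono (L : Set ℂ) {n m : ℕ+} (h : n ≤ m) (f : ℂ → ℂ) :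
    expNorm L n f ≤ expNorm L m f := by
  refine iSup_mono fun z => ?_
  gcongr
  exact_mod_cast h

/-- The norms increase with n, so approximating with error 1/(k + 1) in the norm of index k + 1
yields a sequence converging in all of them. -/
theorem denseRange_of_forall_exists_expNorm_le {X : Type*} {L : Set ℂ} {Φ : X → ExpSpace L}
    (h : ∀ (g : ExpSpace L) (n : ℕ+), ∀ ε > 0, ∃ f,
      expNorm L n (fun z => Φ f z - g z) ≤ ENNReal.ofReal ε) : DenseRange Φ := by
  intro g
  choose f hf using fun k : ℕ => h g k.succPNat (1 / (k + 1 : ℝ)) (by positivity)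
  refine mem_closure_of_tendsto (f := fun k => Φ (f k)) (b := atTop) ?_
    (Eventually.of_forall fun k => mem_range_self _)
  rw [nhds_iInf, tendsto_iInf]
  intro n
  refine (@tendsto_iff_edist_tendsto_0 _ _ (expDist L n) atTop (fun k => Φ (f k)) g).2 ?_
  have h0 : Tendsto (fun k : ℕ => ENNReal.ofReal (1 / (k + 1 : ℝ))) atTop (𝓝 0) := by
    have := ENNReal.tendsto_ofReal (tendsto_one_div_add_atTop_nhds_zero_nat (𝕜 := ℝ))
    rwa [ENNReal.ofReal_zero] at this
  refine tendsto_of_tendsto_of_tendsto_of_le_of_le' tendsto_const_nhds h0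
    (Eventually.of_forall fun k => zero_le) ?_
  filter_upwards [eventually_ge_atTop (n : ℕ)] with k hk
  refine (expNorm_mono L ?_ _).trans (hf k)
  rw [← PNat.coe_le_coe, Nat.succPNat_coe]
  exact hk.trans (Nat.le_succ k)

theorem weightedFun_linear {L : Set ℂ} (hL : IsCompact L) (hLn : L.Nonempty) {ε : ℝ}
    {f g h : ℂ → ℂ} (hf : IsWeightBounded L ε f) (hg : IsWeightBounded L ε g)
    (hh : IsWeightBounded L ε h) {a b : ℂ} (hab : ∀ z, h z = a * f z + b * g z) :
    weightedFun L ε h = a • weightedFun L ε f + b • weightedFun L ε g := by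
  ext z
  simp only [BoundedContinuousFunction.add_apply, BoundedContinuousFunction.smul_apply, smul_eq_mul]
  rw [weightedFun_apply hL hLn hf, weightedFun_apply hL hLn hg, weightedFun_apply hL hLn hh, hab]
  ring

/-- A point outside a closed subspace is detected by a functional vanishing on the subspace. -/
theorem Submodule.exists_dual_ne_zero_of_notMem {E : Type*} [NormedAddCommGroup E]
    [NormedSpace ℂ E] (p : Submodule ℂ E) (hp : IsClosed (p : Set E)) {x : E} (hx : x ∉ p) :
    ∃ l : E →L[ℂ] ℂ, (∀ y ∈ p, l y = 0) ∧ l x ≠ 0 := by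
  let : NormedSpace ℝ E := NormedSpace.restrictScalars ℝ ℂ E
  have hconv : Convex ℝ (p : Set E) := (p.restrictScalars ℝ).convex
  obtain ⟨l, u, hlx, hl⟩ := RCLike.geometric_hahn_banach_point_closed (𝕜 := ℂ) hconv hp hx
  have hu : u < 0 := by simpa using hl 0 p.zero_mem
  refine ⟨l, fun y hy => ?_, fun h => ?_⟩
  · by_contra h0
    -- A multiple of y on which l takes the value u - 1 would lie on the wrong side of the
    -- separating level u.
    have := hl (((u - 1 : ℝ) / l y : ℂ) • y) (p.smul_mem _ hy)
    rw [map_smul, smul_eq_mul, div_mul_cancel₀ _ h0] at this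
    simp at this
    linarith
  · rw [h] at hlx
    simp at hlx
    linarith

section Dense

variable {K L : Set ℂ} (hK : IsCompact K) (hKc : Convex ℝ K) (hKn : K.Nonempty)
  {B : ℂ → ℂ} (hB : AnalyticOnNhd ℂ B K) (hL : IsCompact L) (hBL : B '' K ⊆ L)
include hK hKc hKn hB hL hBL

/-- A germ on `L` annihilating the range of the transform vanishes near `L`. -/
theorem eqOn_zero_of_pairing_contourTransform_eq_zero (hLc : Convex ℝ L)
    (hnc : ¬ IsConstantGerm K B) {E : ℂ → ℂ} {W : Set ℂ} (hW : IsOpen W) (hWc : Convex ℝ W)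
    (hLW : L ⊆ W) (hE : DifferentiableOn ℂ E W)
    (h : ∀ f : ExpSpace K, pairing L (contourTransform K (fun _ => 1) B f) E = 0) :
    EqOn E 0 W := by
  obtain ⟨U, hU, hKU, hBU⟩ := exists_isOpen_differentiableOn hB
  obtain ⟨l, hl⟩ := hKn
  set Ω := U ∩ B ⁻¹' W with hΩ
  have hΩo : IsOpen Ω := hBU.continuousOn.isOpen_inter_preimage hU hW
  have hBlL : ∀ ξ ∈ K, B ξ ∈ W := fun ξ hξ => hLW (hBL (mem_image_of_mem B hξ))
  have hKΩ : K ⊆ Ω := fun ξ hξ => ⟨hKU hξ, hBlL ξ hξ⟩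
  have hF : DifferentiableOn ℂ (fun ξ => 1 * E (B ξ)) Ω :=
    (differentiableOn_const _).fun_mul
      (hE.comp (hBU.mono inter_subset_left) fun ξ hξ => hξ.2)
  -- Transposition turns the hypothesis into the vanishing of E ∘ B against all of Exp(K), hence
  -- near l. Openness of B carries this to E near B(l), and the identity theorem to W.
  have hz := eventually_eq_zero_of_pairing_eq_zero hK hKc ⟨l, hl⟩ hl hΩo hKΩ hF fun f => by
    rw [← h f, pairing_contourTransform hK hKc ⟨l, hl⟩ hU hKU (differentiableOn_const _) hBU hL hBL
      hLc f.entire (f.hasGrowth hK hKc ⟨l, hl⟩) hW hLW hE]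
  have hz' : ∀ᶠ w in 𝓝 (B l), E w = 0 :=
    nhds_le_map_nhds_of_not_isConstantGerm hK hKc hB hnc hl
      (hz.mono fun ξ hξ => by simpa using hξ)
  exact (hE.analyticOnNhd hW).eqOn_zero_of_preconnected_of_eventuallyEq_zero
    hWc.isPreconnected (hBlL l hl) hz'

/-- For the norm of index n the weight has ε = 1/n, and this norm is the sup norm of `weightedFun`.
Were g outside the closure of the range, a functional separating them would be pairing with a germ
that vanishes near L, and so would kill g as well. -/
theorem denseRange_contourTransform (hLc : Convex ℝ L) (hnc : ¬ IsConstantGerm K B)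
    {Φ : ExpSpace K → ExpSpace L} (hΦ : ∀ f z, Φ f z = contourTransform K (fun _ => 1) B f z)
    (hlin : IsContinuousOperator Φ) : DenseRange Φ := by
  have hLn : L.Nonempty := (hKn.image B).mono hBL
  refine denseRange_of_forall_exists_expNorm_le fun g n ε' hε' => ?_
  set ε : ℝ := 1 / (n : ℝ) with hεdef
  have hε : 0 < ε := by positivity
  have hwb : ∀ g : ExpSpace L, IsWeightBounded L ε g := fun g =>
    (g.hasGrowth hL hLc hLn).isWeightBounded g.entire.continuous hε
  have hcomb : ∀ (a b : ℂ) (f₁ f₂ : ExpSpace K), ∃ f, weightedFun L ε (Φ f) =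
      a • weightedFun L ε (Φ f₁) + b • weightedFun L ε (Φ f₂) := fun a b f₁ f₂ => by
    obtain ⟨f, -, hf⟩ := hlin.linear a b f₁ f₂
    exact ⟨f, weightedFun_linear hL hLn (hwb _) (hwb _) (hwb _) hf⟩
  have f₀ : ExpSpace K := .ofGrowth hK hKc hKn (f := 0) (differentiable_const 0)
    fun ε _ => ⟨0, le_rfl, fun z => by simp⟩
  set p : Submodule ℂ (ℂ →ᵇ ℂ) :=
    { carrier := range fun f => weightedFun L ε (Φ f)
      add_mem' := by
        rintro _ _ ⟨f₁, rfl⟩ ⟨f₂, rfl⟩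
        obtain ⟨f, hf⟩ := hcomb 1 1 f₁ f₂
        exact ⟨f, by simpa using hf⟩
      zero_mem' := by
        obtain ⟨f, hf⟩ := hcomb 0 0 f₀ f₀
        exact ⟨f, by simpa using hf⟩
      smul_mem' := by
        rintro a _ ⟨f₁, rfl⟩
        obtain ⟨f, hf⟩ := hcomb a 0 f₁ f₁
        exact ⟨f, by simpa using hf⟩ } with hp
  have hmem : weightedFun L ε g ∈ closure (range fun f => weightedFun L ε (Φ f)) := by
    by_contra hnot
    obtain ⟨l, hlp, hlg⟩ := p.topologicalClosure.exists_dual_ne_zero_of_notMem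
      p.isClosed_topologicalClosure (x := weightedFun L ε g) hnot
    obtain ⟨E, hE, hlE⟩ := exists_differentiableOn_forall_eq_pairing hL hLn hLc hε l
    have hLW := Metric.self_subset_thickening hε L
    have h0 := eqOn_zero_of_pairing_contourTransform_eq_zero hK hKc hKn hB hL hBL hLc hnc
      Metric.isOpen_thickening (hLc.thickening ε) hLW hE fun f => by
        rw [← funext (hΦ f), ← hlE]
        exact hlp _ (p.le_topologicalClosure ⟨f, rfl⟩)
    refine hlg ?_
    rw [hlE]
    obtain ⟨S, I, hI⟩ := exists_isCauchyContour hL hLc hLn Metric.isOpen_thickening hLW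
    rw [pairing_eq hL hLc hLn g.differentiableOn_borelTransform Metric.isOpen_thickening hLW hE hI,
      ← zero_mul (I fun ξ => (0 : ℂ)), ← hI.closed.const_mul 0 continuousOn_const]
    refine (hI.closed.congr continuousOn_const fun ξ hξ => ?_).symm
    simp [h0 (hI.subset hξ).1]
  obtain ⟨_, ⟨f, rfl⟩, hf⟩ := Metric.mem_closure_iff.1 hmem ε' hε'
  refine ⟨f, (expNorm_le_iff hε'.le).2 fun z => ?_⟩
  rw [← norm_mul_weight_le_iff, sub_mul]
  have h1 := (BoundedContinuousFunction.dist_coe_le_dist z).trans hf.le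
  rw [dist_eq_norm, norm_sub_rev, weightedFun_apply hL hLn (hwb _),
    weightedFun_apply hL hLn (hwb _)] at h1
  exact h1

end Dense

/-! ### Quasi-conjugacy -/

section QuasiConjugacy

variable {K : Set ℂ} (hK : IsCompact K) (hKc : Convex ℝ K) (hKn : K.Nonempty)
include hK hKc hKn

theorem exists_isContinuousOperator_diffOp {φ : ℂ → ℂ} (hφ : AnalyticOnNhd ℂ φ K) :
    ∃ T : ExpSpace K → ExpSpace K, (∀ f z, T f z = diffOp K φ f z) ∧ IsContinuousOperator T := by
  obtain ⟨U, hU, hKU, hφU⟩ := exists_isOpen_differentiableOn hφ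
  obtain ⟨T, hT, hTc⟩ := exists_isContinuousOperator hK hKc hKn hU hKU hφU
    (B := fun ξ => ξ) differentiableOn_id hK (image_id' K).subset hKc
  exact ⟨T, fun f z => by
    rw [hT, diffOp_eq_contourTransform hK hKc hKn hφ f.differentiableOn_borelTransform], hTc⟩

/-- All three conjugacies are instances of this. Transposition applied to both compositions gives
pairings of f with φ e^{Bz} and (ψ ∘ B) e^{Bz}, which are the same germ on K. -/
theorem exists_isQuasiConjugated {φ B ψ : ℂ → ℂ} (hφ : AnalyticOnNhd ℂ φ K)
    (hB : AnalyticOnNhd ℂ B K) (hnc : ¬ IsConstantGerm K B)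
    (hψ : AnalyticOnNhd ℂ ψ (convexHull ℝ (B '' K))) (hcomp : ∀ᶠ ξ in 𝓝ˢ K, ψ (B ξ) = φ ξ)
    {T : ExpSpace K → ExpSpace K} (hT : ∀ f z, T f z = diffOp K φ f z)
    (hTc : IsContinuousOperator T) :
    ∃ (Φ : ExpSpace K → ExpSpace (convexHull ℝ (B '' K)))
      (S : ExpSpace (convexHull ℝ (B '' K)) → ExpSpace (convexHull ℝ (B '' K))),
      (∀ f z, Φ f z = expTransform K B f z) ∧
      (∀ g z, S g z = diffOp (convexHull ℝ (B '' K)) ψ g z) ∧ IsQuasiConjugated S T Φ := by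
  set L := convexHull ℝ (B '' K) with hLdef
  have hBL : B '' K ⊆ L := subset_convexHull ℝ _
  have hL : IsCompact L := isCompact_convexHull_complex (hK.image_of_continuousOn hB.continuousOn)
  have hLc : Convex ℝ L := convex_convexHull ℝ _
  have hLn : L.Nonempty := (hKn.image B).mono hBL
  obtain ⟨U, hU, hKU, hBU⟩ := exists_isOpen_differentiableOn hB
  obtain ⟨V, hV, hKV, hφV⟩ := exists_isOpen_differentiableOn hφ
  obtain ⟨W, hW, hLW, hψW⟩ := exists_isOpen_differentiableOn hψ
  obtain ⟨Φ, hΦ, hΦc⟩ := exists_isContinuousOperator hK hKc hKn hU hKU (A := fun _ => 1)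
    (differentiableOn_const _) hBU hL hBL hLc
  obtain ⟨S, hS, hSc⟩ := exists_isContinuousOperator_diffOp hL hLc hLn hψ
  refine ⟨Φ, S, fun f z => ?_, hS, hSc, hTc, hΦc,
    denseRange_contourTransform hK hKc hKn hB hL hBL hLc hnc hΦ hΦc, ?_⟩
  · rw [hΦ, expTransform_eq_contourTransform hK hKc hKn hB f.differentiableOn_borelTransform]
  · funext f
    ext z
    have df := f.differentiableOn_borelTransform
    have hf := f.hasGrowth hK hKc hKn
    have hTf : (T f : ℂ → ℂ) = contourTransform K φ (fun ξ => ξ) f := by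
      ext w
      rw [hT, diffOp_eq_contourTransform hK hKc hKn hφ df]
    have hΦf : (Φ f : ℂ → ℂ) = contourTransform K (fun _ => 1) B f := funext (hΦ f)
    have h1 : Φ (T f) z = pairing K f fun ξ => φ ξ * (1 * Complex.exp (B ξ * z)) := by
      rw [hΦ, hTf, contourTransform]
      exact pairing_contourTransform hK hKc hKn hV hKV hφV differentiableOn_id hK
        (image_id' K).subset hKc f.entire hf hU hKU
        (differentiableOn_mul_exp_mul (differentiableOn_const _) hBU z)
    have h2 : S (Φ f) z = pairing K f fun ξ => 1 * (ψ (B ξ) * Complex.exp (B ξ * z)) := by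
      rw [hS, diffOp_eq_contourTransform hL hLc hLn hψ (Φ f).differentiableOn_borelTransform, hΦf,
        contourTransform]
      exact pairing_contourTransform hK hKc hKn hU hKU (differentiableOn_const _) hBU hL hBL hLc
        f.entire hf hW hLW (differentiableOn_mul_exp_mul hψW differentiableOn_id z)
    have aE : AnalyticOnNhd ℂ (fun ξ => Complex.exp (B ξ * z)) K := fun ξ hξ =>
      ((hB ξ hξ).fun_mul analyticAt_const).cexp
    rw [Function.comp_apply, Function.comp_apply, h1, h2]
    refine pairing_congr hK hKc hKn df (fun ξ hξ => (hφ ξ hξ).fun_mul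
      (analyticAt_const.fun_mul (aE ξ hξ))) (fun ξ hξ => analyticAt_const.fun_mul
        (AnalyticAt.fun_mul ?_ (aE ξ hξ))) ?_
    · exact (hψ _ (hBL (mem_image_of_mem B hξ))).comp (hB ξ hξ)
    · filter_upwards [hcomp] with ξ hξ
      rw [hξ]
      ring

end QuasiConjugacy

/-! ### Logarithms and inverses of germs -/

/-- By continuity f(w) - f(z) has imaginary part in (-π, π) near z, where the principal logarithm
inverts exp; hence f = f(z) + log(g/g(z)) locally. -/
theorem analyticAt_of_exp_eq {f g : ℂ → ℂ} {z : ℂ} (hg : AnalyticAt ℂ g z)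
    (hf : ContinuousAt f z) (h : ∀ᶠ w in 𝓝 z, Complex.exp (f w) = g w) : AnalyticAt ℂ f z := by
  have hz : Complex.exp (f z) = g z := h.self_of_nhds
  have h0 : g z ≠ 0 := hz ▸ Complex.exp_ne_zero _
  have han : AnalyticAt ℂ (fun w => f z + Complex.log (g w / g z)) z :=
    analyticAt_const.fun_add ((hg.fun_div analyticAt_const h0).clog (by
      rw [div_self h0]; exact Complex.one_mem_slitPlane))
  refine han.congr ?_
  have him : ∀ᶠ w in 𝓝 z, |(f w - f z).im| < Real.pi := by
    have hc : ContinuousAt (fun w => |(f w - f z).im|) z :=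
      (Complex.continuous_im.continuousAt.comp (hf.sub continuousAt_const)).abs
    exact hc.eventually (gt_mem_nhds (by simpa using Real.pi_pos))
  filter_upwards [h, him] with w hw hwi
  rw [abs_lt] at hwi
  rw [← hw, ← hz, ← Complex.exp_sub, Complex.log_exp hwi.1 hwi.2.le]
  ring

theorem exists_isLogGerm {K : Set ℂ} (hK : IsCompact K) (hKc : Convex ℝ K) (hKn : K.Nonempty)
    {φ : ℂ → ℂ} (hφ : AnalyticOnNhd ℂ φ K) (h0 : IsZeroFreeGerm K φ) : ∃ L, IsLogGerm K φ L := by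
  obtain ⟨V, hV, hKV, hV0⟩ := mem_nhdsSet_iff_exists.1 h0
  obtain ⟨δ, hδ, hδU⟩ := hK.exists_thickening_subset_open
    (hV.inter (isOpen_analyticAt ℂ φ)) fun z hz => ⟨hKV hz, hφ z hz⟩
  have hKδ := Metric.self_subset_thickening hδ K
  have hopen : IsOpen (Metric.thickening δ K) := Metric.isOpen_thickening
  obtain ⟨L, hLc, hL⟩ := Complex.exists_continuousOn_eqOn_exp_comp
    ((hKc.thickening δ).isSimplyConnected (hKn.mono hKδ)) hopen (g := φ)
    (fun z hz => (hδU hz).2.continuousAt.continuousWithinAt) (by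
      rintro ⟨z, hz, hz0⟩
      exact hV0 (hδU hz).1 hz0)
  refine ⟨L, fun z hz => ?_, mem_nhdsSet_iff_exists.2 ⟨_, hopen, hKδ, hL⟩⟩
  have hmem := hopen.mem_nhds (hKδ hz)
  exact analyticAt_of_exp_eq (hφ z hz) (hLc.continuousAt hmem) (eventually_of_mem hmem hL)

theorem IsLogGerm.not_isConstantGerm {K : Set ℂ} {φ L : ℂ → ℂ} (hL : IsLogGerm K φ L)
    (hφ : ¬ IsConstantGerm K φ) : ¬ IsConstantGerm K L := by
  rintro ⟨c, hc⟩
  refine hφ ⟨Complex.exp c, ?_⟩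
  filter_upwards [hc, hL.2] with z hz hz'
  rw [← hz', hz]

namespace IsBiholomorphicOn

variable {ψ χ : ℂ → ℂ} {V : Set ℂ} (h : IsBiholomorphicOn ψ χ V)
include h

/-- Openness of the image is not part of the definition; it follows from the open mapping theorem,
since injectivity excludes local constancy. -/
theorem isOpen_image : IsOpen (ψ '' V) := by
  rw [isOpen_iff_mem_nhds]
  rintro _ ⟨v, hv, rfl⟩
  have hVv := h.isOpen.mem_nhds hv
  have han := h.holomorphic.analyticAt hVv
  refine han.eventually_constant_or_nhds_le_map_nhds.resolve_left (fun hc => ?_)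
    (image_mem_map hVv)
  have h1 : ∀ᶠ z in 𝓝 v, z = v := by
    filter_upwards [hc, hVv] with z hz hzV
    rw [← h.left_inv z hzV, hz, h.left_inv v hv]
  obtain ⟨z, hz, hne⟩ := ((h1.filter_mono nhdsWithin_le_nhds).and
    (self_mem_nhdsWithin : ∀ᶠ z in 𝓝[≠] v, z ∈ ({v}ᶜ : Set ℂ))).exists
  exact hne hz

theorem right_inv {w : ℂ} (hw : w ∈ ψ '' V) : ψ (χ w) = w := by
  obtain ⟨v, hv, rfl⟩ := hw
  rw [h.left_inv v hv]

variable {K : Set ℂ} {φ : ℂ → ℂ} (hφ : AnalyticOnNhd ℂ φ K) (hKV : φ '' K ⊆ ψ '' V)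
include hφ hKV

theorem analyticOnNhd_comp : AnalyticOnNhd ℂ (χ ∘ φ) K := fun z hz =>
  (h.inv_holomorphic.analyticAt (h.isOpen_image.mem_nhds (hKV (mem_image_of_mem φ hz)))).comp
    (hφ z hz)

theorem eventually_comp_eq : ∀ᶠ z in 𝓝ˢ K, ψ ((χ ∘ φ) z) = φ z := by
  rw [eventually_nhdsSet_iff_forall]
  intro z hz
  have := (hφ z hz).continuousAt.eventually
    (h.isOpen_image.mem_nhds (hKV (mem_image_of_mem φ hz)))
  filter_upwards [this] with w hw using h.right_inv hw

theorem not_isConstantGerm_comp (hc : ¬ IsConstantGerm K φ) : ¬ IsConstantGerm K (χ ∘ φ) := by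
  rintro ⟨c, hc'⟩
  refine hc ⟨ψ c, ?_⟩
  filter_upwards [hc', h.eventually_comp_eq hφ hKV] with z hz hz'
  rw [← hz', hz]

end IsBiholomorphicOn

theorem mainTheorem7 (K : Set ℂ) (hKc : IsCompact K) (hKconv : Convex ℝ K) (hKne : K.Nonempty)
    (φ : ℂ → ℂ) (hφ : AnalyticOnNhd ℂ φ K) (hφnc : ¬ IsConstantGerm K φ) :
    -- the integrals defining `Φ_φ` and `φ(D)` make sense and do not depend on the Cauchy cycle
    (∀ f : ExpSpace K, IsBorelTransform f (borelTransform f)) ∧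
    (∃ Γ, IsGermCycle K φ Γ) ∧
    (∀ Γ, IsGermCycle K φ Γ → ∀ (f : ExpSpace K) (z : ℂ),
      expTransform K φ f z = (2 * Real.pi * Complex.I)⁻¹ *
        Γ.integral (fun ξ => borelTransform f ξ * Complex.exp (φ ξ * z)) ∧
      diffOp K φ f z = (2 * Real.pi * Complex.I)⁻¹ *
        Γ.integral (fun ξ => borelTransform f ξ * φ ξ * Complex.exp (ξ * z))) ∧
    -- `φ(D)` as an operator `T` on `Exp(K)`
    ∃ T : ExpSpace K → ExpSpace K, (∀ f z, T f z = diffOp K φ f z) ∧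
      -- mapping properties of `Φ_φ`, and quasi-conjugacy of `φ(D)` to `D`
      (∃ (Φ : ExpSpace K → ExpSpace (convexHull ℝ (φ '' K)))
          (S : ExpSpace (convexHull ℝ (φ '' K)) → ExpSpace (convexHull ℝ (φ '' K))),
        (∀ f z, Φ f z = expTransform K φ f z) ∧
        (∀ f, conjDiagram (Φ f) ⊆ convexHull ℝ (φ '' conjDiagram f)) ∧
        (∀ g z, S g z = deriv g z) ∧
        IsQuasiConjugated S T Φ) ∧
      -- quasi-conjugacy to the translation `e₁(D)` for zero-free `φ`
      (IsZeroFreeGerm K φ →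
        (∃ L, IsLogGerm K φ L) ∧
        ∀ L, IsLogGerm K φ L →
          ∃ (Φ : ExpSpace K → ExpSpace (convexHull ℝ (L '' K)))
            (S : ExpSpace (convexHull ℝ (L '' K)) → ExpSpace (convexHull ℝ (L '' K))),
          (∀ f z, Φ f z = expTransform K L f z) ∧
          (∀ g z, S g z = diffOp (convexHull ℝ (L '' K)) Complex.exp g z) ∧
          (∀ g z, S g z = g (z + 1)) ∧
          IsQuasiConjugated S T Φ) ∧
      -- quasi-conjugacy to `ψ(D)` for biholomorphic `ψ`
      (∀ (C : Set ℂ) (ψ χ : ℂ → ℂ) (V : Set ℂ), IsCompact C → Convex ℝ C → C ⊆ V →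
        IsBiholomorphicOn ψ χ V → φ '' K ⊆ ψ '' C →
          ∃ (Φ : ExpSpace K → ExpSpace (convexHull ℝ ((χ ∘ φ) '' K)))
            (S : ExpSpace (convexHull ℝ ((χ ∘ φ) '' K)) →
              ExpSpace (convexHull ℝ ((χ ∘ φ) '' K))),
          (∀ f z, Φ f z = expTransform K (χ ∘ φ) f z) ∧
          (∀ g z, S g z = diffOp (convexHull ℝ ((χ ∘ φ) '' K)) ψ g z) ∧
          IsQuasiConjugated S T Φ) := by
  obtain ⟨T, hT, hTc⟩ := exists_isContinuousOperator_diffOp hKc hKconv hKne hφ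
  refine ⟨fun f => isBorelTransform_borelTransform f.entire f.expType,
    exists_isGermCycle_of_analyticOnNhd hKc hKconv hKne hφ, fun Γ hΓ f z => ⟨?_, ?_⟩, T, hT,
    ?_, fun h0 => ⟨exists_isLogGerm hKc hKconv hKne hφ h0, fun L hL => ?_⟩, ?_⟩
  · exact hΓ.germIntegral_eq hKc hKconv hKne (fun V hV => (hV.mul_const z).cexp)
      f.differentiableOn_borelTransform
  · simp only [diffOp, mul_assoc]
    have := hΓ.germIntegral_eq hKc hKconv hKne (F := fun ξ => φ ξ * Complex.exp (ξ * z))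
      (fun V hV => hV.mul (Differentiable.differentiableOn (by fun_prop)))
      f.differentiableOn_borelTransform
    simpa only [mul_assoc] using this
  · obtain ⟨Φ, S, hΦ, hS, hq⟩ := exists_isQuasiConjugated hKc hKconv hKne hφ hφ hφnc
      (ψ := fun ξ => ξ) (fun _ _ => analyticAt_id) (Eventually.of_forall fun _ => rfl) hT hTc
    have hL := isCompact_convexHull_complex (hKc.image_of_continuousOn hφ.continuousOn)
    have hLn := (hKne.image φ).mono (subset_convexHull ℝ (φ '' K))
    refine ⟨Φ, S, hΦ, fun f => ?_, fun g z => ?_, hq⟩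
    · obtain ⟨U, hU, hKU, hφU⟩ := exists_isOpen_differentiableOn hφ
      rw [show (Φ f : ℂ → ℂ) = contourTransform K (fun _ => 1) φ f by
        ext z
        rw [hΦ, expTransform_eq_contourTransform hKc hKconv hKne hφ
          f.differentiableOn_borelTransform]]
      exact conjDiagram_contourTransform_subset hKc hKconv hKne hU hKU
        (differentiableOn_const _) hφU f
    · rw [hS, diffOp_eq_contourTransform (φ := fun ξ => ξ) hL (convex_convexHull ℝ _) hLn
        (fun _ _ => analyticAt_id) g.differentiableOn_borelTransform]
      exact contourTransform_id_eq_deriv hL (convex_convexHull ℝ _) hLn g.entire g.expType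
        g.differentiableOn_borelTransform z
  · obtain ⟨Φ, S, hΦ, hS, hq⟩ := exists_isQuasiConjugated hKc hKconv hKne hφ hL.1
      (hL.not_isConstantGerm hφnc) (ψ := Complex.exp) (fun _ _ => analyticAt_cexp) hL.2 hT hTc
    have hLc := isCompact_convexHull_complex (hKc.image_of_continuousOn hL.1.continuousOn)
    have hLn := (hKne.image L).mono (subset_convexHull ℝ (L '' K))
    refine ⟨Φ, S, hΦ, hS, fun g z => ?_, hq⟩
    rw [hS, diffOp_eq_contourTransform hLc (convex_convexHull ℝ _) hLn
      (fun _ _ => analyticAt_cexp) g.differentiableOn_borelTransform]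
    exact contourTransform_exp_eq_translation hLc (convex_convexHull ℝ _) hLn g.entire g.expType
      g.differentiableOn_borelTransform z
  · intro C ψ χ V _ hCc hCV hψ hφC
    have hKV : φ '' K ⊆ ψ '' V := hφC.trans (image_mono hCV)
    -- Convexity of C is what makes ψ holomorphic near the whole hull: χ(φ(K)) lies in C, so its
    -- hull does too.
    have hLC : convexHull ℝ ((χ ∘ φ) '' K) ⊆ C := by
      refine convexHull_min ?_ hCc
      rintro _ ⟨z, hz, rfl⟩
      obtain ⟨c, hc, hcz⟩ := hφC (mem_image_of_mem φ hz)
      rw [Function.comp_apply, ← hcz, hψ.left_inv c (hCV hc)]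
      exact hc
    exact exists_isQuasiConjugated hKc hKconv hKne hφ (hψ.analyticOnNhd_comp hφ hKV)
      (hψ.not_isConstantGerm_comp hφ hKV hφnc)
      (fun w hw => hψ.holomorphic.analyticAt (hψ.isOpen.mem_nhds (hCV (hLC hw))))
      (hψ.eventually_comp_eq hφ hKV) hT hTc
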